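/- For $\alpha\ge 0$ let $-\Delta_\alpha$ be the non-negative self-adjoint operator of point interaction at the origin of $\mathbb R^3$: with $G_\lambda(x)=\frac{e^{-\sqrt\lambda|x|}}{4\pi|x|}$ and an arbitrary $\lambda>0$ (on which the operator does not depend), $$\mathcal D(-\Delta_\alpha)=\Big\{g=f+\tfrac{f(0)}{\alpha+\frac{\sqrt\lambda}{4\pi}}\,G_\lambda \ \Big|\ f\in H^2(\mathbb R^3)\Big\},\qquad (-\Delta_\alpha+\lambda)g=(-\Delta+\lambda)f .$$ Fractional powers are defined by the spectral theorem. Let $\lambda>0$ and $s\in(0,2)$. For every $\alpha\ge0$ the operators $(-\Delta_\alpha)^{s/2}$ and $(-\Delta_\alpha+\lambda)^{s/2}$ have the same domain; denote by $H^s_\alpha(\mathbb R^3)$ this domain, with norm $\|g\|_{H^s_\alpha}:=\|(-\Delta_\alpha+\lambda)^{s/2}g\|_{2}$, and by $\|\cdot\|_{H^s}$ the classical Sobolev norm. (i) If $s\in(0,\frac12)$, there are constants $c,C>0$ depending only on $s,\lambda$ such that for all $\alpha\ge 0$ one has $H^s_\alpha(\mathbb R^3)=H^s(\mathbb R^3)$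 as sets and $$c\,\|g\|_{H^s}\le\|g\|_{H^s_\alpha}\le C\,\|g\|_{H^s}\qquad\text{for all } g\in H^s(\mathbb R^3).$$ (ii) If $s\in(\frac12,\frac32)$, then for every $\alpha\ge 0$ one has $H^s_\alpha(\mathbb R^3)=\{F+c\,G_\lambda : F\in H^s(\mathbb R^3),\ c\in\mathbb C\}$, and there are constants $c_1,C_1>0$ (depending on $s,\lambda,\alpha$) such that for all $F\in H^s(\mathbb R^3)$ and $c\in\mathbb C$ $$c_1\big(\|F\|_{H^s}+(1+\alpha)|c|\big)\le\|F+c\,G_\lambda\|_{H^s_\alpha}\le C_1\big(\|F\|_{H^s}+(1+\alpha)|c|\big).$$ (iii) If $s\in(\frac32,2)$, every $F\in H^s(\mathbb R^3)$ has a continuous representative, so that $F(0)$ is defined, and there are constants $c,C>0$ depending only on $s,\lambda$ such that for all $\alpha\ge 0$ one has $H^s_\alpha(\mathbb R^3)=\big\{F+\frac{F(0)}{\alpha+\frac{\sqrt\lambda}{4\pi}}G_\lambda : F\in H^s(\mathbb R^3)\big\}$ and $$c\,\|F\|_{H^s}\le\Big\|F+\tfrac{F(0)}{\alpha+\frac{\sqrt\lambda}{4\pi}}\,G_\lambda\Big\|_{H^s_\alpha}\le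 C\,\|F\|_{H^s}\qquad\text{for all }F\in H^s(\mathbb R^3).$$ -/

import Mathlib

open MeasureTheory
open scoped FourierTransform Laplacian SchwartzMap

noncomputable section

namespace PointInteraction

/-! ### Fractional powers of nonnegative self-adjoint operators -/

section FractionalPowers

variable {H : Type*} [NormedAddCommGroup H] [InnerProductSpace ℂ H]

/-- The bounded operator `R` is the two-sided inverse of `A + 1 : dom A → H`. -/
def IsInvAddOne (A : H →ₗ.[ℂ] H) (R : H →L[ℂ] H) : Prop :=
  (∀ h : H, ∃ hR : R h ∈ A.domain, A ⟨R h, hR⟩ + R h = h) ∧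
    ∀ g : A.domain, R (A g + (g : H)) = g

open Classical in
/-- The resolvent `(A + 1)⁻¹` of an unbounded operator `A`
(by convention `0` if `A + 1` has no bounded inverse). -/
def invAddOne (A : H →ₗ.[ℂ] H) : H →L[ℂ] H :=
  if h : ∃ R : H →L[ℂ] H, IsInvAddOne A R then h.choose else 0

/-- The power `A ^ r`, `r > 0`, of a nonnegative self-adjoint operator `A`, by the spectral theorem
applied to the bounded operator `R = (A + 1)⁻¹`, `0 ≤ R ≤ 1`. Since `t = (1 - x) / x` for
`x = (t + 1)⁻¹`, one has `A ^ r = (1 - R) ^ r (R ^ r)⁻¹`, with domain the range of `R ^ r`; in other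
words, the graph of `A ^ r` is the set of all pairs `(R ^ r h, (1 - R) ^ r h)`. The powers of `R`
and of `1 - R` are those of the continuous functional calculus. -/
def nonnegPow [CompleteSpace H] (A : H →ₗ.[ℂ] H) (r : ℝ) : H →ₗ.[ℂ] H :=
  (LinearMap.range
    ((invAddOne A ^ r).prod ((1 - invAddOne A) ^ r)).toLinearMap).toLinearPMap

/-- The operator `A + lam`, with the same domain as `A`. -/
def shift (A : H →ₗ.[ℂ] H) (lam : ℝ) : H →ₗ.[ℂ] H :=
  ((lam : ℂ) • (LinearMap.id : H →ₗ[ℂ] H)) +ᵥ A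

end FractionalPowers

/-! ### Sobolev spaces on `ℝ³` -/

/-- Euclidean space `ℝ³`. -/
abbrev E3 : Type := EuclideanSpace ℝ (Fin 3)

/-- The complex Hilbert space `L²(ℝ³)`. -/
abbrev L2 : Type := Lp ℂ 2 (volume : Measure E3)

/-- `F ∈ Hˢ(ℝ³)`. -/
def MemHs (s : ℝ) (F : L2) : Prop :=
  TemperedDistribution.MemSobolev s 2 (F : 𝓢'(E3, ℂ))

/-- The classical norm of `Hˢ(ℝ³)`, namely `‖(1 - Δ)^{s/2} F‖₂ = ‖(1 + p²)^{s/2} F̂‖₂`. With Mathlib's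
normalization of the Fourier transform the momentum is `p = 2πξ`. -/
def sobolevNorm (s : ℝ) (F : L2) : ℝ :=
  (eLpNorm (fun ξ : E3 => (((1 + (2 * Real.pi * ‖ξ‖) ^ 2) ^ (s / 2) : ℝ) : ℂ) * (𝓕 F : L2) ξ)
    2 volume).toReal

/-- The class `F` has a continuous representative whose value at the origin is `v`. -/
def HasValueAtZero (F : L2) (v : ℂ) : Prop :=
  ∃ f : E3 → ℂ, Continuous f ∧ F =ᵐ[volume] f ∧ f 0 = v

/-- `HasValueAtZero` determines the value. -/
theorem HasValueAtZero.unique {F : L2} {v w : ℂ} (hv : HasValueAtZero F v)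
    (hw : HasValueAtZero F w) : v = w := by
  obtain ⟨f, hf, hFf, rfl⟩ := hv
  obtain ⟨f', hf', hFf', rfl⟩ := hw
  rw [(hf.ae_eq_iff_eq volume hf').1 (hFf.symm.trans hFf')]

theorem HasValueAtZero.add {F F' : L2} {v v' : ℂ} (h : HasValueAtZero F v)
    (h' : HasValueAtZero F' v') : HasValueAtZero (F + F') (v + v') := by
  obtain ⟨f, hf, hFf, rfl⟩ := h
  obtain ⟨f', hf', hFf', rfl⟩ := h'
  exact ⟨f + f', hf.add hf', (Lp.coeFn_add F F').trans (hFf.add hFf'), rfl⟩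

theorem HasValueAtZero.smul {F : L2} {v : ℂ} (c : ℂ) (h : HasValueAtZero F v) :
    HasValueAtZero (c • F) (c * v) := by
  obtain ⟨f, hf, hFf, rfl⟩ := h
  exact ⟨c • f, hf.const_smul c, (Lp.coeFn_smul c F).trans (hFf.const_smul c), rfl⟩

theorem HasValueAtZero.zero : HasValueAtZero 0 0 :=
  ⟨0, continuous_const, Lp.coeFn_zero _ _ _, rfl⟩

/-! ### The Green function and the point interaction -/

/-- The Green function `G_λ(x) = exp(-√λ |x|) / (4π|x|)` of `-Δ + λ` on `ℝ³`. -/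
def green (lam : ℝ) (x : E3) : ℂ :=
  ((Real.exp (-(Real.sqrt lam * ‖x‖)) / (4 * Real.pi * ‖x‖) : ℝ) : ℂ)

theorem memLp_green {lam : ℝ} (hlam : 0 < lam) : MemLp (green lam) 2 (volume : Measure E3) := by
  have hmeas : AEStronglyMeasurable (green lam) (volume : Measure E3) := by
    apply Measurable.aestronglyMeasurable
    unfold green
    fun_prop
  rw [memLp_two_iff_integrable_sq_norm hmeas]
  have h := (integrable_fun_norm_addHaar (volume : Measure E3)
    (f := fun r : ℝ => (Real.exp (-(Real.sqrt lam * r)) / (4 * Real.pi * r)) ^ 2)).2 ?_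
  · refine h.congr (Filter.Eventually.of_forall fun x => ?_)
    simp only [green, Complex.norm_real, Real.norm_eq_abs, sq_abs]
  · have hb : 0 < 2 * Real.sqrt lam := by positivity
    have h2 := (exp_neg_integrableOn_Ioi 0 hb).const_mul ((4 * Real.pi) ^ 2)⁻¹
    refine (integrableOn_congr_fun (fun r hr => ?_) measurableSet_Ioi).1 h2
    have hr' : r ≠ 0 := ne_of_gt hr
    have hexp : Real.exp (-(2 * Real.sqrt lam) * r) = Real.exp (-(Real.sqrt lam * r)) ^ 2 := by
      rw [← Real.exp_nat_mul]
      congr 1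
      push_cast
      ring
    simp only [finrank_euclideanSpace, Fintype.card_fin, smul_eq_mul, hexp]
    have hpi := Real.pi_ne_zero
    field_simp

/-- `G_λ` as an element of `L²(ℝ³)`. -/
def greenL2 {lam : ℝ} (hlam : 0 < lam) : L2 := (memLp_green hlam).toLp (green lam)

/-- The coefficient `α + √λ / (4π)`. -/
def coef (α lam : ℝ) : ℂ := ((α + Real.sqrt lam / (4 * Real.pi) : ℝ) : ℂ)

/-- The graph of `-Δ_α`: the pairs `(g, k)` such that, for some `F ∈ H²(ℝ³)`,
`g = F + F(0) / (α + √λ / (4π)) G_λ` and `k + λ g = (-Δ + λ) F`. Here `λ > 0` is an arbitrary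
constant on which the resulting operator does not depend; it is normalized to `λ = 1`. -/
def graphPointInteraction (α : ℝ) : Submodule ℂ (L2 × L2) where
  carrier := {p | ∃ (F : L2) (v : ℂ), MemHs 2 F ∧ HasValueAtZero F v ∧
    p.1 = F + (v / coef α 1) • greenL2 one_pos ∧
    ((p.2 + p.1 : L2) : 𝓢'(E3, ℂ)) = -Δ (F : 𝓢'(E3, ℂ)) + (F : 𝓢'(E3, ℂ))}
  zero_mem' := by
    refine ⟨0, 0, ?_, HasValueAtZero.zero, by simp, ?_⟩
    · unfold MemHs
      rw [← Lp.toTemperedDistributionCLM_apply, map_zero]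
      exact TemperedDistribution.memSobolev_fun_zero _ _ _ _
    · simp only [Prod.fst_zero, Prod.snd_zero, add_zero, ← Lp.toTemperedDistributionCLM_apply,
        map_zero, TemperedDistribution.laplacian_eq_fourierMultiplierCLM, smul_zero, neg_zero]
  add_mem' := by
    rintro ⟨g, k⟩ ⟨g', k'⟩ ⟨F, v, hF, hv, hg, hk⟩ ⟨F', v', hF', hv', hg', hk'⟩
    refine ⟨F + F', v + v', ?_, hv.add hv', ?_, ?_⟩
    · unfold MemHs at *
      rw [← Lp.toTemperedDistributionCLM_apply, map_add]
      exact hF.add hF'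
    · simp only [Prod.mk_add_mk] at *
      rw [hg, hg', add_div, add_smul]
      abel
    · simp only [Prod.mk_add_mk, ← Lp.toTemperedDistributionCLM_apply,
        TemperedDistribution.laplacian_eq_fourierMultiplierCLM, map_add, smul_add] at *
      rw [add_add_add_comm, hk, hk']
      abel
  smul_mem' := by
    rintro c ⟨g, k⟩ ⟨F, v, hF, hv, hg, hk⟩
    refine ⟨c • F, c * v, ?_, hv.smul c, ?_, ?_⟩
    · unfold MemHs at *
      rw [← Lp.toTemperedDistributionCLM_apply, map_smul]
      exact hF.smul c
    · simp only [Prod.smul_mk] at *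
      rw [hg, smul_add, smul_smul, mul_div_assoc]
    · simp only [Prod.smul_mk, ← Lp.toTemperedDistributionCLM_apply,
        TemperedDistribution.laplacian_eq_fourierMultiplierCLM, map_add, map_smul] at *
      rw [← smul_add, hk, smul_add, smul_neg, smul_comm c]

/-- The point interaction Hamiltonian `-Δ_α` on `L²(ℝ³)`. -/
def pointInteraction (α : ℝ) : L2 →ₗ.[ℂ] L2 := (graphPointInteraction α).toLinearPMap

/-- The singular Sobolev space `H^s_α(ℝ³)`, i.e. the domain of `(-Δ_α)^{s/2}`. -/
def singularSpace (α s : ℝ) : Submodule ℂ L2 := (nonnegPow (pointInteraction α) (s / 2)).domain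

/-- The operator `(-Δ_α + λ)^{s/2}`. -/
def shiftedPow (α lam s : ℝ) : L2 →ₗ.[ℂ] L2 :=
  nonnegPow (shift (pointInteraction α) lam) (s / 2)

open Classical in
/-- The singular Sobolev norm `‖(-Δ_α + λ)^{s/2} g‖₂`, for `g` in the domain of
`(-Δ_α + λ)^{s/2}` (and `0` by convention for all other `g`). -/
def singularNorm (α lam s : ℝ) (g : L2) : ℝ :=
  if h : g ∈ (shiftedPow α lam s).domain then ‖shiftedPow α lam s ⟨g, h⟩‖ else 0

end PointInteraction

end

/-!
Put `T = (-Δ_α + lam)⁻¹`, so that `H^s_α` is the range of `T ^ r` with `r = s / 2`, and the norm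
of `T ^ r h` in `H^s_α` is `‖h‖`. By Krein's formula the resolvent at `lam + t` is a rank-one
perturbation of the free one, `S_t = (-Δ + lam + t)⁻¹ + a(t)⁻¹ ⟪G_{lam+t}, ·⟫ G_{lam+t}`, where
`a(t) = α + √(lam + t) / (4π)`, and `T ^ r` is obtained from the `S_t` by integration over `t`.
For `s < 1/2` and for `s > 3/2` the estimates use only `a(t)⁻¹ ≤ 4π (lam + t) ^ (-1/2)` about `α`,
so their constants do not depend on it. With `P = lam + |p|²` in momentum space, `G_{lam+t}` has
Fourier transform `(P + t)⁻¹`, and everything rests on the estimate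
`lintegral_rpow_mul_lintegral_sq_le`, valid for `-3/2 < σ < 1/2`:
`∫₀^∞ t ^ (-1/2 - σ) (∫ f / (P + t))² dt ≤ C ∫ P ^ (-σ) f²`.

*From `T ^ r h` to Sobolev regularity.* In `c T ^ r h = ∫₀^∞ t ^ (-r) S_t h dt`, paired with `φ`,
the free part gives `P ^ (-r) h` exactly. For `s < 1/2` the rank-one part is bounded by the
estimate with `σ = 0` on `h` and `σ = s` on `φ`, hence `T ^ r h ∈ H^s`
(`exists_freePow_eq_opPow`). For `s > 1/2`, first replace the last factor `G_{lam+t}` by `G_lam`: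
this splits off `q G_lam`, where `c q = ∫₀^∞ t ^ (-r) a(t)⁻¹ ⟪G_{lam+t}, h⟫ dt` converges, and as
the transform of `G_lam - G_{lam+t}` is `t / (P (P + t))`, the remainder is bounded by the
estimate with `σ = 0` on `h` and `σ = s - 2` on `φ / P` (`exists_freePow_add_smul_eq_opPow`).

*From Sobolev regularity to the range of `T ^ r`.* By `exists_rpow_eq_of_lintegral_le`, it
suffices that `∫₀^∞ t ^ (s - 1) ‖g - t S_t g‖² dt` be finite, and this integral bounds the norm.
For `g = F + q G_lam` one has
`g - t S_t g = (P / (P + t)) F + a(t)⁻¹ (q a(0) - t ⟪G_{lam+t}, F⟫) G_{lam+t}`, where `P` acts as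
a Fourier multiplier, and `‖G_{lam+t}‖² = (8π √(lam + t))⁻¹`. For `s < 3/2` both terms of the
coefficient are square integrable with the weight (`exists_opPow_eq_freePow_add`, with `σ = -s`).
For `s > 3/2` this holds when `q a(0) = F(0)`, since `F(0) - t ⟪G_{lam+t}, F⟫` is the integral of
`P F̂ / (P + t)` (`exists_opPow_eq_of_hasValueAtZero`, with `σ = 2 - s`).

*Uniqueness.* For `s ≥ 1/2`, `G_lam ∉ H^s`, so the decomposition `F + q G_lam` is unique. For
`s > 3/2`, `G_lam` is not in the range of `T ^ r` (`eq_zero_of_opPow_eq_smul_greenL2`), which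
forces the boundary condition `q a(0) = F(0)`.
-/

noncomputable section

namespace PointInteraction

/-! ### Scalar integrals -/

theorem integrableOn_rpow_mul_one_add_rpow {β γ : ℝ} (hβ : -1 < β) (hγ : β + 1 < γ) :
    IntegrableOn (fun t : ℝ => t ^ β * (1 + t) ^ (-γ)) (Set.Ioi 0) := by
  have hmeas : Measurable (fun t : ℝ => t ^ β * (1 + t) ^ (-γ)) := by fun_prop
  rw [← Set.Ioc_union_Ioi_eq_Ioi zero_le_one]
  refine IntegrableOn.union ?_ ?_
  · have h : IntegrableOn (fun t : ℝ => t ^ β) (Set.Ioc 0 1) := by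
      rw [← intervalIntegrable_iff_integrableOn_Ioc_of_le zero_le_one]
      exact intervalIntegral.intervalIntegrable_rpow' hβ
    refine h.mono' hmeas.aestronglyMeasurable ?_
    filter_upwards [ae_restrict_mem measurableSet_Ioc] with t ht
    have h0 : 0 < t := ht.1
    have h1 : (1 + t) ^ (-γ) ≤ 1 := Real.rpow_le_one_of_one_le_of_nonpos (by linarith) (by linarith)
    rw [Real.norm_of_nonneg (by positivity)]
    exact mul_le_of_le_one_right (by positivity) h1
  · refine (integrableOn_Ioi_rpow_of_lt (a := β - γ) (by linarith) one_pos).mono'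
      hmeas.aestronglyMeasurable ?_
    filter_upwards [ae_restrict_mem measurableSet_Ioi] with t ht
    have h0 : 0 < t := lt_trans one_pos ht
    rw [Real.norm_of_nonneg (by positivity), sub_eq_add_neg, Real.rpow_add h0]
    gcongr 1
    exact Real.rpow_le_rpow_of_nonpos h0 (by linarith) (by linarith)

/-- The constant `∫₀^∞ t ^ β (1 + t) ^ (-γ) dt`. -/
def powerIntegral (β γ : ℝ) : ℝ := ∫ t in Set.Ioi (0 : ℝ), t ^ β * (1 + t) ^ (-γ)

theorem powerIntegral_pos {β γ : ℝ} (hβ : -1 < β) (hγ : β + 1 < γ) : 0 < powerIntegral β γ := by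
  unfold powerIntegral
  rw [setIntegral_pos_iff_support_of_nonneg_ae _ (integrableOn_rpow_mul_one_add_rpow hβ hγ)]
  · have : Set.Ioi (0 : ℝ) ⊆
        Function.support (fun t : ℝ => t ^ β * (1 + t) ^ (-γ)) ∩ Set.Ioi 0 := by
      intro t ht
      have h0 : 0 < t := ht
      exact ⟨ne_of_gt (by positivity), ht⟩
    exact lt_of_lt_of_le (by simp) (measure_mono this)
  · filter_upwards [ae_restrict_mem measurableSet_Ioi] with t ht
    have h0 : 0 < t := ht
    exact (by positivity : 0 ≤ t ^ β * (1 + t) ^ (-γ))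

/-- The scaling identity behind the integral formulas for the powers of an operator. -/
theorem integral_rpow_mul_div_pow {β : ℝ} {j : ℕ} (hβ : -1 < β) (hβj : β + 1 < j)
    {x : ℝ} (hx : 0 ≤ x) :
    ∫ t in Set.Ioi (0 : ℝ), t ^ β * (x / (1 + t * x)) ^ j =
      powerIntegral β j * x ^ ((j : ℝ) - 1 - β) := by
  rcases hx.eq_or_lt with rfl | hx
  · rw [Real.zero_rpow (by linarith)]
    have hj : j ≠ 0 := by
      rintro rfl
      norm_num at hβj
      linarith
    simp [zero_pow hj]
  have h := integral_comp_mul_right_Ioi (fun u : ℝ => u ^ β * (1 + u) ^ (-(j : ℝ))) 0 hx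
  rw [zero_mul, smul_eq_mul] at h
  have h' : ∫ t in Set.Ioi (0 : ℝ), t ^ β * (x / (1 + t * x)) ^ j =
      ∫ t in Set.Ioi (0 : ℝ), x ^ ((j : ℝ) - β) * ((t * x) ^ β * (1 + t * x) ^ (-(j : ℝ))) := by
    refine setIntegral_congr_fun measurableSet_Ioi fun t ht => ?_
    have h0 : (0 : ℝ) < t := ht
    have h1 : 0 < 1 + t * x := by positivity
    rw [Real.rpow_neg h1.le, Real.rpow_natCast, Real.mul_rpow h0.le hx.le, Real.rpow_sub hx,
      Real.rpow_natCast, div_pow]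
    have := (Real.rpow_pos_of_pos hx β).ne'
    field_simp
  rw [h', integral_const_mul, h, powerIntegral, show (j : ℝ) - 1 - β = (j - β) - 1 by ring,
    Real.rpow_sub_one hx.ne']
  field_simp

/-! ### Functional calculus of a nonnegative operator -/

section Operator

variable {H : Type*} [NormedAddCommGroup H] [InnerProductSpace ℂ H] [CompleteSpace H]

/-- For `T = A⁻¹`, the operator `(A + t)⁻¹ = T (1 + t T)⁻¹`. -/
def resolventOf (T : H →L[ℂ] H) (t : ℝ) : H →L[ℂ] H := cfc (fun x : ℝ => x / (1 + t * x)) T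

/-- The power `T ^ r`. On `L²` the notation `T ^ r` is not available, because the real vector space
structures that come from `Lp` and from restriction of scalars do not agree reducibly. For the same
reason real scalars act through `ℂ` in the statements that are applied to `L²`. -/
abbrev opPow (T : H →L[ℂ] H) (r : ℝ) : H →L[ℂ] H := T ^ r

variable {T : H →L[ℂ] H}

theorem continuousOn_div_one_add (hT : 0 ≤ T) {t : ℝ} (ht : 0 ≤ t) :
    ContinuousOn (fun x : ℝ => x / (1 + t * x)) (spectrum ℝ T) := by
  refine ContinuousOn.div (by fun_prop) (by fun_prop) fun x hx => ?_
  have := spectrum_nonneg_of_nonneg hT hx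
  positivity

theorem continuousOn_rpow_spectrum {r : ℝ} (hr : 0 ≤ r) (T : H →L[ℂ] H) :
    ContinuousOn (fun x : ℝ => x ^ r) (spectrum ℝ T) :=
  (Real.continuous_rpow_const hr).continuousOn

theorem exists_spectrum_bound (T : H →L[ℂ] H) :
    ∃ C : ℝ, 1 ≤ C ∧ ∀ x ∈ spectrum ℝ T, x ≤ C := by
  refine ⟨max 1 (‖T‖ * ‖(1 : H →L[ℂ] H)‖), le_max_left _ _, fun x hx => ?_⟩
  exact (le_abs_self x).trans ((spectrum.norm_le_norm_mul_of_mem hx).trans (le_max_right _ _))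

/-- The functional calculus version of `integral_rpow_mul_div_pow`. -/
theorem integral_rpow_smul_cfc (hT : 0 ≤ T) {β : ℝ} {j : ℕ} (hβ : -1 < β) (hβj : β + 1 < j) :
    IntegrableOn (fun t : ℝ => cfc (fun x : ℝ => t ^ β * (x / (1 + t * x)) ^ j) T) (Set.Ioi 0) ∧
    ∫ t in Set.Ioi (0 : ℝ), cfc (fun x : ℝ => t ^ β * (x / (1 + t * x)) ^ j) T =
      powerIntegral β j • T ^ ((j : ℝ) - 1 - β) := by
  have hsa : IsSelfAdjoint T := IsSelfAdjoint.of_nonneg hT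
  obtain ⟨C, hC1, hC⟩ := exists_spectrum_bound T
  have hcont : ContinuousOn
      (Function.uncurry fun (t x : ℝ) => t ^ β * (x / (1 + t * x)) ^ j)
      (Set.Ioi 0 ×ˢ spectrum ℝ T) := by
    rintro ⟨t, x⟩ ⟨ht, hx⟩
    have h0 : (0 : ℝ) < t := ht
    have h1 : 0 ≤ x := spectrum_nonneg_of_nonneg hT hx
    have h2 : 1 + t * x ≠ 0 := by positivity
    apply ContinuousAt.continuousWithinAt
    unfold Function.uncurry
    refine ContinuousAt.mul ?_ ?_
    · exact continuousAt_fst.rpow_const (Or.inl h0.ne')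
    · refine ContinuousAt.pow ?_ j
      exact ContinuousAt.div (by fun_prop) (by fun_prop) h2
  have hbound : ∀ᵐ t ∂(volume.restrict (Set.Ioi (0 : ℝ))), ∀ x ∈ spectrum ℝ T,
      ‖t ^ β * (x / (1 + t * x)) ^ j‖ ≤ C ^ j * (t ^ β * (1 + t) ^ (-(j : ℝ))) := by
    filter_upwards [ae_restrict_mem measurableSet_Ioi] with t ht x hx
    have h0 : (0 : ℝ) < t := ht
    have h1 : 0 ≤ x := spectrum_nonneg_of_nonneg hT hx
    have h2 : x / (1 + t * x) ≤ C / (1 + t) := by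
      rw [div_le_div_iff₀ (by positivity) (by positivity)]
      nlinarith [hC x hx, mul_nonneg h0.le h1]
    rw [Real.norm_of_nonneg (by positivity), Real.rpow_neg (by positivity), Real.rpow_natCast]
    calc t ^ β * (x / (1 + t * x)) ^ j ≤ t ^ β * (C / (1 + t)) ^ j := by gcongr
      _ = _ := by rw [div_pow]; ring
  have hint := (integrableOn_rpow_mul_one_add_rpow hβ hβj).const_mul (C ^ j)
  refine ⟨integrableOn_cfc measurableSet_Ioi _ _ T hcont hbound hint.hasFiniteIntegral hsa, ?_⟩
  rw [← cfc_setIntegral measurableSet_Ioi _ _ T hcont hbound hint.hasFiniteIntegral hsa,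
    CFC.rpow_eq_cfc_real hT, ← cfc_smul _ _ _ (continuousOn_rpow_spectrum (by linarith) T)]
  refine cfc_congr fun x hx => ?_
  simp only [smul_eq_mul]
  exact integral_rpow_mul_div_pow hβ hβj (spectrum_nonneg_of_nonneg hT hx)

theorem inner_cfc_left (f : ℝ → ℝ) (T : H →L[ℂ] H) (g h : H) :
    inner ℂ (cfc f T g) h = inner ℂ g (cfc f T h) :=
  (cfc_predicate f T : IsSelfAdjoint (cfc f T)).isSymmetric g h

theorem rpow_mul_rpow_of_nonneg (hT : 0 ≤ T) {r q : ℝ} (hr : 0 ≤ r) (hq : 0 ≤ q) :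
    T ^ r * T ^ q = T ^ (r + q) := by
  have hsa : IsSelfAdjoint T := IsSelfAdjoint.of_nonneg hT
  rw [CFC.rpow_eq_cfc_real hT, CFC.rpow_eq_cfc_real hT, CFC.rpow_eq_cfc_real hT,
    ← cfc_mul _ _ T (continuousOn_rpow_spectrum hr T) (continuousOn_rpow_spectrum hq T)]
  exact cfc_congr fun x hx => (Real.rpow_add_of_nonneg (spectrum_nonneg_of_nonneg hT hx) hr hq).symm

theorem inner_rpow_left (hT : 0 ≤ T) (r : ℝ) (g h : H) :
    inner ℂ ((T ^ r) g) h = inner ℂ g ((T ^ r) h) := by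
  rw [CFC.rpow_eq_cfc_real hT]
  exact inner_cfc_left _ _ _ _

theorem injective_rpow (hT : 0 ≤ T) (hinj : Function.Injective T) {r : ℝ} (hr0 : 0 ≤ r) :
    Function.Injective (T ^ r) := by
  obtain ⟨n, hn⟩ := exists_nat_ge r
  have hpow : ∀ m : ℕ, Function.Injective (T ^ m) := by
    intro m
    induction m with
    | zero => exact fun x y h => by simpa using h
    | succ m ih =>
      intro x y h
      rw [pow_succ] at h
      exact hinj (ih h)
  intro x y h
  apply hpow n
  have h2 : T ^ ((n : ℝ) - r) * T ^ r = T ^ n := by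
    rw [rpow_mul_rpow_of_nonneg hT (by linarith) hr0, sub_add_cancel, CFC.rpow_natCast T n hT]
  rw [← h2]
  simp only [mul_apply_eq_comp, h]

theorem denseRange_of_isSelfAdjoint {D : H →L[ℂ] H} (hD : IsSelfAdjoint D)
    (hinj : Function.Injective D) : DenseRange D := by
  have h1 : (LinearMap.range D.toLinearMap)ᗮ = ⊥ := by
    rw [ContinuousLinearMap.orthogonal_range, hD.adjoint_eq]
    exact LinearMap.ker_eq_bot.2 hinj
  have h2 := (Submodule.topologicalClosure_eq_top_iff).2 h1
  intro x
  have hx : x ∈ (LinearMap.range D.toLinearMap).topologicalClosure := by rw [h2]; trivial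
  exact hx

/-- A vector `g` lies in the range of a self-adjoint operator `D` as soon as the functional
`D k ↦ ⟪g, k⟫` is bounded. -/
theorem exists_eq_of_norm_inner_le {D : H →L[ℂ] H} (hD : IsSelfAdjoint D)
    (hinj : Function.Injective D) {g : H} {M : ℝ} (hM : 0 ≤ M)
    (hg : ∀ k, ‖inner ℂ k g‖ ≤ M * ‖D k‖) : ∃ h, D h = g ∧ ‖h‖ ≤ M := by
  have hdense : DenseRange D.toLinearMap := denseRange_of_isSelfAdjoint hD hinj
  let f : H →ₗ[ℂ] ℂ := (innerSL ℂ g).toLinearMap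
  have hf : ∀ k, ‖f k‖ ≤ M * ‖D.toLinearMap k‖ := fun k => by
    have := hg k
    rw [norm_inner_symm] at this
    simpa [f] using this
  let e : H →L[ℂ] ℂ := f.extendOfNorm D.toLinearMap
  have he : ∀ k, e (D k) = inner ℂ g k := fun k => by
    have := LinearMap.extendOfNorm_eq hdense ⟨M, hf⟩ k
    simpa [e, f] using this
  refine ⟨(InnerProductSpace.toDual ℂ H).symm e, ?_, ?_⟩
  · refine ext_inner_right ℂ fun k => ?_
    have h1 : inner ℂ (D ((InnerProductSpace.toDual ℂ H).symm e)) k =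
        inner ℂ ((InnerProductSpace.toDual ℂ H).symm e) (D k) := hD.isSymmetric _ _
    rw [h1, InnerProductSpace.toDual_symm_apply, he]
  · rw [LinearIsometryEquiv.norm_map]
    exact LinearMap.opNorm_extendOfNorm_le hdense hM hf

/-! ### Fractional powers through resolvents -/

theorem cfc_rpow_mul_div_one (hT : 0 ≤ T) {t : ℝ} (ht : 0 ≤ t) (β : ℝ) :
    cfc (fun x : ℝ => t ^ β * (x / (1 + t * x)) ^ 1) T = (t ^ β) • resolventOf T t := by
  rw [resolventOf, ← cfc_smul _ _ _ (continuousOn_div_one_add hT ht)]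
  simp

theorem cfc_rpow_mul_div_two (hT : 0 ≤ T) {t : ℝ} (ht : 0 ≤ t) (β : ℝ) :
    cfc (fun x : ℝ => t ^ β * (x / (1 + t * x)) ^ 2) T =
      (t ^ β) • (resolventOf T t * resolventOf T t) := by
  have hc := continuousOn_div_one_add hT ht
  rw [resolventOf, ← cfc_mul _ _ T hc hc, ← cfc_smul _ _ _ (hc.fun_mul hc)]
  simp [pow_two]

/-- The resolvent formula `⟪φ, T ^ r h⟫ = c ∫₀^∞ t ^ (-r) ⟪φ, (T⁻¹ + t)⁻¹ h⟫ dt`. -/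
theorem integral_rpow_mul_inner_resolventOf (hT : 0 ≤ T) {r : ℝ} (hr0 : 0 < r) (hr1 : r < 1)
    (φ h : H) :
    IntegrableOn (fun t : ℝ => ((t ^ (-r) : ℝ) : ℂ) * inner ℂ φ (resolventOf T t h)) (Set.Ioi 0) ∧
    ∫ t in Set.Ioi (0 : ℝ), ((t ^ (-r) : ℝ) : ℂ) * inner ℂ φ (resolventOf T t h) =
      (powerIntegral (-r) 1 : ℂ) * inner ℂ φ (opPow T r h) := by
  obtain ⟨h1, h2⟩ := integral_rpow_smul_cfc hT (β := -r) (j := 1) (by linarith)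
    (by push_cast; linarith)
  let Λ : (H →L[ℂ] H) →L[ℂ] ℂ := (innerSL ℂ φ).comp (ContinuousLinearMap.apply ℂ H h)
  have h3 := Λ.integrable_comp h1
  have h4 := Λ.integral_comp_comm h1
  have h5 : ∀ t ∈ Set.Ioi (0 : ℝ), Λ (cfc (fun x : ℝ => t ^ (-r) * (x / (1 + t * x)) ^ 1) T) =
      ((t ^ (-r) : ℝ) : ℂ) * inner ℂ φ (resolventOf T t h) := by
    intro t ht
    rw [cfc_rpow_mul_div_one hT (le_of_lt ht)]
    simp [Λ]
  refine ⟨(integrableOn_congr_fun h5 measurableSet_Ioi).1 h3, ?_⟩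
  rw [← setIntegral_congr_fun measurableSet_Ioi h5, h4, h2]
  simp [Λ]

theorem aestronglyMeasurable_resolventOf (hT : 0 ≤ T) (g : H) :
    AEStronglyMeasurable (fun t : ℝ => resolventOf T t g) (volume.restrict (Set.Ioi 0)) := by
  obtain ⟨h1, -⟩ := integral_rpow_smul_cfc hT (β := -(1 / 2)) (j := 1) (by norm_num)
    (by norm_num)
  have h2 := ((ContinuousLinearMap.apply ℂ H g).integrable_comp h1).aestronglyMeasurable
  have h3 : AEStronglyMeasurable (fun t : ℝ => t ^ (1 / 2 : ℝ)) (volume.restrict (Set.Ioi 0)) :=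
    (by fun_prop : Measurable fun t : ℝ => t ^ (1 / 2 : ℝ)).aestronglyMeasurable
  refine (h3.smul h2).congr ?_
  filter_upwards [ae_restrict_mem measurableSet_Ioi] with t ht
  have h0 : (0 : ℝ) < t := ht
  rw [Pi.smul_apply', cfc_rpow_mul_div_one hT h0.le]
  simp only [ContinuousLinearMap.apply_apply, smul_apply, smul_smul]
  rw [← Real.rpow_add h0]
  simp

theorem lintegral_mul_sq_le {X : Type*} [MeasurableSpace X] {μ : Measure X} {f g : X → ENNReal}
    (hf : AEMeasurable f μ) (hg : AEMeasurable g μ) :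
    (∫⁻ x, f x * g x ∂μ) ^ 2 ≤ (∫⁻ x, f x ^ 2 ∂μ) * ∫⁻ x, g x ^ 2 ∂μ := by
  have h := ENNReal.lintegral_mul_le_Lp_mul_Lq μ Real.HolderConjugate.two_two hf hg
  have h2 : ∀ a : ENNReal, (a ^ (1 / 2 : ℝ)) ^ 2 = a := fun a => by
    rw [← ENNReal.rpow_natCast, ← ENNReal.rpow_mul]; norm_num
  calc (∫⁻ x, f x * g x ∂μ) ^ 2 ≤ _ := pow_le_pow_left' h 2
    _ = _ := by
      rw [mul_pow, h2, h2]
      simp only [ENNReal.rpow_two]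

theorem mul_resolventOf_sub (hT : 0 ≤ T) {t : ℝ} (ht : 0 ≤ t) :
    T * (resolventOf T t * (1 - t • resolventOf T t)) = resolventOf T t * resolventOf T t := by
  have hsa : IsSelfAdjoint T := IsSelfAdjoint.of_nonneg hT
  have hc := continuousOn_div_one_add hT ht
  have h1 : (1 : H →L[ℂ] H) - t • resolventOf T t =
      cfc (fun x : ℝ => 1 - t * (x / (1 + t * x))) T := by
    rw [cfc_sub _ _ _ (by fun_prop) (by fun_prop), cfc_const_one ℝ T, resolventOf,
      ← cfc_smul _ _ _ hc]
    rfl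
  have hc' : ContinuousOn (fun x : ℝ => 1 - t * (x / (1 + t * x))) (spectrum ℝ T) := by fun_prop
  rw [h1, resolventOf, ← cfc_mul _ _ T hc hc', ← cfc_mul _ _ T hc hc]
  conv_lhs => rw [← cfc_id ℝ T]
  rw [cfc_id ℝ T]
  nth_rewrite 1 [← cfc_id ℝ T]
  rw [← cfc_mul _ _ T (by fun_prop) (by fun_prop)]
  refine cfc_congr fun x hx => ?_
  have h0 := spectrum_nonneg_of_nonneg hT hx
  have : 1 + t * x ≠ 0 := by positivity
  simp only [id]
  field_simp
  ring

/-- Integration over `t` recovers a power of `T` exactly: for each `x` in the spectrum, the integral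
of `t ^ (1 - 2r) (x / (1 + t x))²` is a multiple of `x ^ (2r)`. -/
theorem lintegral_norm_resolventOf_sq (hT : 0 ≤ T) {r : ℝ} (hr0 : 0 < r) (hr1 : r < 1) (k : H) :
    ∫⁻ t in Set.Ioi (0 : ℝ), ENNReal.ofReal (t ^ (1 - 2 * r) * ‖resolventOf T t k‖ ^ 2) =
      ENNReal.ofReal (powerIntegral (1 - 2 * r) 2 * ‖(T ^ r) k‖ ^ 2) := by
  obtain ⟨h1, h2⟩ := integral_rpow_smul_cfc hT (β := 1 - 2 * r) (j := 2) (by linarith)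
    (by push_cast; linarith)
  let Λ : (H →L[ℂ] H) →L[ℝ] ℝ :=
    Complex.reCLM.comp (((innerSL ℂ k).comp (ContinuousLinearMap.apply ℂ H k)).restrictScalars ℝ)
  have h3 := Λ.integrable_comp h1
  have h4 := Λ.integral_comp_comm h1
  have h5 : ∀ t ∈ Set.Ioi (0 : ℝ),
      Λ (cfc (fun x : ℝ => t ^ (1 - 2 * r) * (x / (1 + t * x)) ^ 2) T) =
      t ^ (1 - 2 * r) * ‖resolventOf T t k‖ ^ 2 := by
    intro t ht
    rw [cfc_rpow_mul_div_two hT (le_of_lt ht)]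
    simp only [Λ, ContinuousLinearMap.comp_apply, ContinuousLinearMap.coe_restrictScalars',
      ContinuousLinearMap.apply_apply, smul_apply,
      mul_apply_eq_comp, innerSL_apply_apply, inner_smul_right_eq_smul,
      Complex.reCLM_apply, Complex.real_smul, Complex.re_ofReal_mul]
    rw [resolventOf, ← inner_cfc_left]
    rw [← inner_self_eq_norm_sq (𝕜 := ℂ)]
    rfl
  rw [← ofReal_integral_eq_lintegral_ofReal ((integrableOn_congr_fun h5 measurableSet_Ioi).1 h3)]
  · rw [← setIntegral_congr_fun measurableSet_Ioi h5, h4, h2]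
    congr 1
    simp only [Λ, ContinuousLinearMap.comp_apply, ContinuousLinearMap.coe_restrictScalars',
      ContinuousLinearMap.apply_apply, smul_apply,
      innerSL_apply_apply, inner_smul_right_eq_smul,
      Complex.reCLM_apply, Complex.real_smul, Complex.re_ofReal_mul]
    rw [show ((2 : ℕ) : ℝ) - 1 - (1 - 2 * r) = r + r by push_cast; ring,
      ← rpow_mul_rpow_of_nonneg hT hr0.le hr0.le, mul_apply_eq_comp,
      ← inner_rpow_left hT, ← inner_self_eq_norm_sq (𝕜 := ℂ)]
    rfl
  · filter_upwards [ae_restrict_mem measurableSet_Ioi] with t ht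
    have h0 : (0 : ℝ) < t := ht
    exact (by positivity : 0 ≤ t ^ (1 - 2 * r) * ‖resolventOf T t k‖ ^ 2)

/-- The constant of `exists_rpow_eq_of_lintegral_le`. -/
def squareConst (r : ℝ) : ℝ := √(powerIntegral (1 - 2 * r) 2) / powerIntegral 0 2

/-- Square function criterion. With `A = T⁻¹`, a vector `g` lies in the domain of `A ^ r` as soon as
`∫₀^∞ t ^ (2r - 1) ‖A (A + t)⁻¹ g‖² dt` is finite. The proof pairs `g` with
`k = ∫₀^∞ A (A + t)⁻² k dt` and uses `∫₀^∞ t ^ (1 - 2r) ‖(A + t)⁻¹ k‖² dt = c ‖T ^ r k‖²`. -/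
theorem exists_rpow_eq_of_lintegral_le (hT : 0 ≤ T) (hinj : Function.Injective T) {r : ℝ}
    (hr0 : 0 < r) (hr1 : r < 1) {g : H} {M : ℝ} (hM : 0 ≤ M)
    (hg : ∫⁻ t in Set.Ioi (0 : ℝ),
      ENNReal.ofReal (t ^ (2 * r - 1) * ‖g - (t : ℂ) • resolventOf T t g‖ ^ 2) ≤
        ENNReal.ofReal (M ^ 2)) :
    ∃ h, opPow T r h = g ∧ ‖h‖ ≤ squareConst r * M := by
  simp only [Complex.coe_smul] at hg
  have hsa : IsSelfAdjoint T := IsSelfAdjoint.of_nonneg hT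
  have hK : 0 < powerIntegral 0 2 := powerIntegral_pos (by norm_num) (by norm_num)
  have hsaD : IsSelfAdjoint (T ^ r) := IsSelfAdjoint.of_nonneg CFC.rpow_nonneg
  have hC : 0 ≤ squareConst r := by unfold squareConst; positivity
  refine exists_eq_of_norm_inner_le hsaD (injective_rpow hT hinj hr0.le)
    (mul_nonneg hC hM) fun k => ?_
  have hclosed : IsClosed {k : H | ‖inner ℂ k g‖ ≤ squareConst r * M * ‖(T ^ r) k‖} :=
    isClosed_le (by fun_prop) (by fun_prop)
  refine (denseRange_of_isSelfAdjoint hsa hinj).induction_on (p := fun k =>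
    ‖inner ℂ k g‖ ≤ squareConst r * M * ‖(T ^ r) k‖) k hclosed fun u => ?_
  -- the reproducing formula for `k = T u`
  set k := T u with hk
  obtain ⟨h1, h2⟩ := integral_rpow_smul_cfc hT (β := 0) (j := 2) (by norm_num) (by norm_num)
  let Λ : (H →L[ℂ] H) →L[ℂ] ℂ := (innerSL ℂ u).comp (ContinuousLinearMap.apply ℂ H g)
  have h4 := Λ.integral_comp_comm h1
  have h5 : ∀ t ∈ Set.Ioi (0 : ℝ),
      Λ (cfc (fun x : ℝ => t ^ (0 : ℝ) * (x / (1 + t * x)) ^ 2) T) =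
      inner ℂ (resolventOf T t k) (g - t • resolventOf T t g) := by
    intro t ht
    rw [cfc_rpow_mul_div_two hT (le_of_lt ht), Real.rpow_zero, one_smul,
      ← mul_resolventOf_sub hT (le_of_lt ht)]
    simp only [Λ, ContinuousLinearMap.comp_apply, ContinuousLinearMap.apply_apply,
      mul_apply_eq_comp, innerSL_apply_apply, sub_apply,
      one_apply_eq_self, smul_apply]
    have h6 : ∀ a b : H, inner ℂ a (T b) = inner ℂ (T a) b := fun a b => (hsa.isSymmetric a b).symm
    rw [h6, resolventOf, ← inner_cfc_left]
  rw [setIntegral_congr_fun measurableSet_Ioi h5, h2] at h4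
  have h7 : Λ (powerIntegral 0 ((2 : ℕ) : ℝ) • T ^ (((2 : ℕ) : ℝ) - 1 - 0)) =
      (powerIntegral 0 2 : ℂ) * inner ℂ k g := by
    rw [show (((2 : ℕ) : ℝ) - 1 - 0) = 1 by norm_num, CFC.rpow_one T hT]
    simp only [Λ, ContinuousLinearMap.comp_apply, ContinuousLinearMap.apply_apply,
      smul_apply, innerSL_apply_apply, inner_smul_right_eq_smul, Nat.cast_ofNat,
      Complex.real_smul, hk]
    congr 1
    exact (hsa.isSymmetric u g).symm
  rw [h7] at h4
  have hmw : AEStronglyMeasurable (fun t : ℝ => g - t • resolventOf T t g)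
      (volume.restrict (Set.Ioi 0)) :=
    aestronglyMeasurable_const.sub
      (measurable_id.aestronglyMeasurable.smul (aestronglyMeasurable_resolventOf hT g))
  have hmk := aestronglyMeasurable_resolventOf hT k
  have h8 : ENNReal.ofReal ((powerIntegral 0 2 * ‖inner ℂ k g‖) ^ 2) ≤
      ENNReal.ofReal (powerIntegral (1 - 2 * r) 2 * ‖(T ^ r) k‖ ^ 2) * ENNReal.ofReal (M ^ 2) := by
    calc ENNReal.ofReal ((powerIntegral 0 2 * ‖inner ℂ k g‖) ^ 2)
        = ‖(powerIntegral 0 2 : ℂ) * inner ℂ k g‖ₑ ^ 2 := by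
          rw [ENNReal.ofReal_pow (by positivity), ← ofReal_norm, norm_mul, Complex.norm_real,
            Real.norm_of_nonneg hK.le]
      _ ≤ (∫⁻ t in Set.Ioi (0 : ℝ),
            ‖inner ℂ (resolventOf T t k) (g - t • resolventOf T t g)‖ₑ) ^ 2 := by
          rw [← h4]
          exact pow_le_pow_left' (enorm_integral_le_lintegral_enorm _) 2
      _ ≤ (∫⁻ t in Set.Ioi (0 : ℝ), ENNReal.ofReal (t ^ (1 / 2 - r) * ‖resolventOf T t k‖) *
            ENNReal.ofReal (t ^ (r - 1 / 2) * ‖g - t • resolventOf T t g‖)) ^ 2 := by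
          refine pow_le_pow_left' (setLIntegral_mono_ae' measurableSet_Ioi ?_) 2
          filter_upwards with t ht
          have h0 : (0 : ℝ) < t := ht
          rw [← ENNReal.ofReal_mul (by positivity), ← ofReal_norm]
          refine ENNReal.ofReal_le_ofReal ((norm_inner_le_norm _ _).trans (le_of_eq ?_))
          have : t ^ (1 / 2 - r) * t ^ (r - 1 / 2) = 1 := by
            rw [← Real.rpow_add h0]; simp
          linear_combination (-‖resolventOf T t k‖ * ‖g - t • resolventOf T t g‖) * this
      _ ≤ _ := lintegral_mul_sq_le
          (((by fun_prop : Measurable fun t : ℝ => t ^ (1 / 2 - r)).aemeasurable.mul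
            hmk.norm.aemeasurable).ennreal_ofReal)
          (((by fun_prop : Measurable fun t : ℝ => t ^ (r - 1 / 2)).aemeasurable.mul
            hmw.norm.aemeasurable).ennreal_ofReal)
      _ ≤ _ := by
          refine mul_le_mul' (le_of_eq ?_) (le_trans (le_of_eq ?_) hg)
          · rw [← lintegral_norm_resolventOf_sq hT hr0 hr1]
            refine setLIntegral_congr_fun measurableSet_Ioi fun t ht => ?_
            have h0 : (0 : ℝ) < t := ht
            rw [← ENNReal.ofReal_pow (by positivity), mul_pow, ← Real.rpow_natCast (t ^ _),
              ← Real.rpow_mul h0.le]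
            congr 3
            push_cast
            ring
          · refine setLIntegral_congr_fun measurableSet_Ioi fun t ht => ?_
            have h0 : (0 : ℝ) < t := ht
            rw [← ENNReal.ofReal_pow (by positivity), mul_pow, ← Real.rpow_natCast (t ^ _),
              ← Real.rpow_mul h0.le]
            congr 3
            push_cast
            ring
  have hK2 : 0 < powerIntegral (1 - 2 * r) 2 := powerIntegral_pos (by linarith) (by linarith)
  rw [← ENNReal.ofReal_mul (by positivity), ENNReal.ofReal_le_ofReal_iff (by positivity)] at h8
  have h9 : powerIntegral 0 2 * ‖inner ℂ k g‖ ≤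
      √(powerIntegral (1 - 2 * r) 2) * ‖(T ^ r) k‖ * M := by
    refine le_of_sq_le_sq ?_ (by positivity)
    rw [mul_pow _ M, mul_pow √_, Real.sq_sqrt hK2.le]
    exact h8
  rw [squareConst, div_mul_eq_mul_div, div_mul_eq_mul_div, le_div_iff₀ hK]
  linarith

/-- For `A = T⁻¹`, one has `‖A (A + t)⁻¹ T ^ r‖ ≤ t ^ (-r)`. -/
theorem norm_rpow_sub_resolventOf_le (hT : 0 ≤ T) {r : ℝ} (hr0 : 0 ≤ r) (hr1 : r ≤ 1) {t : ℝ}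
    (ht : 0 < t) (h : H) :
    ‖opPow T r h - (t : ℂ) • resolventOf T t (opPow T r h)‖ ≤ t ^ (-r) * ‖h‖ := by
  rw [Complex.coe_smul]
  have hsa : IsSelfAdjoint T := IsSelfAdjoint.of_nonneg hT
  have hc := continuousOn_div_one_add hT ht.le
  have hcr := continuousOn_rpow_spectrum hr0 T
  have h1 : T ^ r - t • (resolventOf T t * T ^ r) =
      cfc (fun x : ℝ => x ^ r - t * (x / (1 + t * x) * x ^ r)) T := by
    rw [cfc_sub _ _ _ hcr (by fun_prop), CFC.rpow_eq_cfc_real hT, resolventOf,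
      ← cfc_mul _ _ T hc hcr,
      ← cfc_smul _ _ _ (hc.fun_mul hcr)]
    rfl
  have h2 : ‖T ^ r - t • (resolventOf T t * T ^ r)‖ ≤ t ^ (-r) := by
    rw [h1]
    refine norm_cfc_le (by positivity) fun x hx => ?_
    have h0 := spectrum_nonneg_of_nonneg hT hx
    have h3 : x ^ r - t * (x / (1 + t * x) * x ^ r) = x ^ r / (1 + t * x) := by
      have : 1 + t * x ≠ 0 := by positivity
      field_simp
      ring
    rw [h3, Real.norm_of_nonneg (by positivity), div_le_iff₀ (by positivity),
      Real.rpow_neg ht.le, ← div_eq_inv_mul, le_div_iff₀ (by positivity),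
      ← Real.mul_rpow h0 ht.le, mul_comm x t]
    -- `y ^ r ≤ 1 + y`
    have hy : 0 ≤ t * x := by positivity
    rcases le_total (t * x) 1 with h4 | h4
    · exact (Real.rpow_le_one hy h4 hr0).trans (by linarith)
    · calc (t * x) ^ r ≤ (t * x) ^ (1 : ℝ) := Real.rpow_le_rpow_of_exponent_le h4 hr1
        _ ≤ _ := by rw [Real.rpow_one]; linarith
  calc ‖(T ^ r) h - t • resolventOf T t ((T ^ r) h)‖
      = ‖(T ^ r - t • (resolventOf T t * T ^ r)) h‖ := rfl
    _ ≤ _ := (ContinuousLinearMap.le_opNorm _ _).trans (by gcongr)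

end Operator

section Operator
variable {H : Type*} [NormedAddCommGroup H] [InnerProductSpace ℂ H] [CompleteSpace H]
  {T : H →L[ℂ] H}

/-! ### Powers of an unbounded operator in terms of its inverse -/

theorem continuousOn_inv_one_add (hT : 0 ≤ T) {t : ℝ} (ht : 0 ≤ t) :
    ContinuousOn (fun x : ℝ => (1 + t * x)⁻¹) (spectrum ℝ T) := by
  refine ContinuousOn.inv₀ (by fun_prop) fun x hx => ?_
  have := spectrum_nonneg_of_nonneg hT hx
  positivity

theorem continuousOn_one_add_rpow (hT : 0 ≤ T) {t : ℝ} (ht : 0 ≤ t) (r : ℝ) :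
    ContinuousOn (fun x : ℝ => (1 + t * x) ^ r) (spectrum ℝ T) := by
  refine ContinuousOn.rpow_const (by fun_prop) fun x hx => Or.inl ?_
  have := spectrum_nonneg_of_nonneg hT hx
  positivity

theorem cfc_rpow_of_nonneg (hT : 0 ≤ T) {f : ℝ → ℝ} (hf : ContinuousOn f (spectrum ℝ T))
    (hf0 : ∀ x ∈ spectrum ℝ T, 0 ≤ f x) {r : ℝ} (hr : 0 ≤ r) :
    (cfc f T) ^ r = cfc (fun x => f x ^ r) T := by
  have hsa : IsSelfAdjoint T := IsSelfAdjoint.of_nonneg hT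
  rw [CFC.rpow_eq_cfc_real (cfc_nonneg hf0),
    ← cfc_comp (fun x : ℝ => x ^ r) f T hsa (Real.continuous_rpow_const hr).continuousOn hf]
  rfl

theorem cfc_id_mul (hT : 0 ≤ T) {f : ℝ → ℝ} (hf : ContinuousOn f (spectrum ℝ T)) :
    cfc (fun x => x * f x) T = T * cfc f T := by
  have hsa : IsSelfAdjoint T := IsSelfAdjoint.of_nonneg hT
  rw [cfc_mul _ _ T (by fun_prop) hf, cfc_id' ℝ T]

theorem resolventOf_eq_mul (hT : 0 ≤ T) {t : ℝ} (ht : 0 ≤ t) :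
    resolventOf T t = T * cfc (fun x : ℝ => (1 + t * x)⁻¹) T := by
  rw [← cfc_id_mul hT (continuousOn_inv_one_add hT ht)]
  rfl

theorem one_sub_resolventOf (hT : 0 ≤ T) {t : ℝ} (ht : 0 ≤ t) :
    1 - t • resolventOf T t = cfc (fun x : ℝ => (1 + t * x)⁻¹) T := by
  have hsa : IsSelfAdjoint T := IsSelfAdjoint.of_nonneg hT
  have hc := continuousOn_div_one_add hT ht
  rw [resolventOf, ← cfc_smul _ _ _ hc, ← cfc_const_one ℝ T, ← cfc_sub _ _ _ (by fun_prop)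
    (by fun_prop)]
  refine cfc_congr fun x hx => ?_
  have h0 := spectrum_nonneg_of_nonneg hT hx
  have : 1 + t * x ≠ 0 := by positivity
  simp only [smul_eq_mul]
  field_simp
  ring

theorem inv_one_add_mul_one_add (hT : 0 ≤ T) {t : ℝ} (ht : 0 ≤ t) :
    cfc (fun x : ℝ => (1 + t * x)⁻¹) T * (1 + t • T) = 1 := by
  have hsa : IsSelfAdjoint T := IsSelfAdjoint.of_nonneg hT
  have h1 : 1 + t • T = cfc (fun x : ℝ => 1 + t * x) T := by
    rw [cfc_add _ _ _ (by fun_prop) (by fun_prop), cfc_const_one ℝ T, cfc_const_mul_id t T]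
  rw [h1, ← cfc_mul _ _ T (continuousOn_inv_one_add hT ht) (by fun_prop), ← cfc_one ℝ T]
  refine cfc_congr fun x hx => ?_
  have h0 := spectrum_nonneg_of_nonneg hT hx
  exact inv_mul_cancel₀ (by positivity)

theorem eq_resolventOf (hT : 0 ≤ T) {t : ℝ} (ht : 0 ≤ t) {S : H →L[ℂ] H}
    (hS : S + (t : ℂ) • (T * S) = T) : S = resolventOf T t := by
  rw [Complex.coe_smul] at hS
  have h1 : cfc (fun x : ℝ => (1 + t * x)⁻¹) T * (S + t • (T * S)) = S := by
    rw [show S + t • (T * S) = (1 + t • T) * S by rw [add_mul, one_mul, smul_mul_assoc],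
      ← mul_assoc, inv_one_add_mul_one_add hT ht, one_mul]
  rw [hS] at h1
  rw [← h1, resolventOf_eq_mul hT ht]
  have h2 := cfc_commute_cfc (fun x : ℝ => (1 + t * x)⁻¹) (fun x : ℝ => x) T
  rw [cfc_id' ℝ T (IsSelfAdjoint.of_nonneg hT)] at h2
  exact h2

theorem resolventOf_add_mul (hT : 0 ≤ T) {t : ℝ} (ht : 0 ≤ t) :
    resolventOf T t + t • (resolventOf T t * T) = T := by
  rw [resolventOf_eq_mul hT ht]
  have h2 := inv_one_add_mul_one_add hT ht
  calc _ = T * (cfc (fun x : ℝ => (1 + t * x)⁻¹) T * (1 + t • T)) := by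
        simp only [mul_add, mul_one, mul_smul_comm, mul_assoc]
    _ = T := by rw [h2, mul_one]

theorem resolventOf_rpow_mul (hT : 0 ≤ T) {t : ℝ} (ht : 0 ≤ t) {r : ℝ} (hr : 0 ≤ r) :
    resolventOf T t ^ r * cfc (fun x : ℝ => (1 + t * x) ^ r) T = T ^ r := by
  have h0 : ∀ x ∈ spectrum ℝ T, 0 ≤ x := fun x hx => spectrum_nonneg_of_nonneg hT hx
  have hc := continuousOn_div_one_add hT ht
  have hn : ∀ x ∈ spectrum ℝ T, 0 ≤ x / (1 + t * x) := fun x hx => by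
    have := h0 x hx
    positivity
  rw [resolventOf, cfc_rpow_of_nonneg hT hc hn hr,
    ← cfc_mul _ _ T (hc.rpow_const fun _ _ => Or.inr hr) (continuousOn_one_add_rpow hT ht r),
    CFC.rpow_eq_cfc_real hT]
  refine cfc_congr fun x hx => ?_
  have h1 := h0 x hx
  have h2 : 0 < 1 + t * x := by positivity
  rw [← Real.mul_rpow (by positivity) h2.le, div_mul_cancel₀ _ h2.ne']

theorem rpow_mul_one_add_rpow_neg (hT : 0 ≤ T) {t : ℝ} (ht : 0 ≤ t) {r : ℝ} (hr : 0 ≤ r) :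
    T ^ r * cfc (fun x : ℝ => (1 + t * x) ^ (-r)) T = resolventOf T t ^ r := by
  have h0 : ∀ x ∈ spectrum ℝ T, 0 ≤ x := fun x hx => spectrum_nonneg_of_nonneg hT hx
  have hc := continuousOn_div_one_add hT ht
  have hn : ∀ x ∈ spectrum ℝ T, 0 ≤ x / (1 + t * x) := fun x hx => by
    have := h0 x hx
    positivity
  rw [resolventOf, cfc_rpow_of_nonneg hT hc hn hr, CFC.rpow_eq_cfc_real hT,
    ← cfc_mul _ _ T (continuousOn_rpow_spectrum hr T) (continuousOn_one_add_rpow hT ht _)]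
  refine cfc_congr fun x hx => ?_
  have h1 := h0 x hx
  have h2 : 0 < 1 + t * x := by positivity
  rw [Real.div_rpow h1 h2.le, Real.rpow_neg h2.le, div_eq_mul_inv]

theorem one_sub_resolventOf_rpow_mul (hT : 0 ≤ T) {r : ℝ} (hr : 0 ≤ r) :
    (1 - resolventOf T 1) ^ r * cfc (fun x : ℝ => (1 + 1 * x) ^ r) T = 1 := by
  have h0 : ∀ x ∈ spectrum ℝ T, 0 ≤ x := fun x hx => spectrum_nonneg_of_nonneg hT hx
  have hsa : IsSelfAdjoint T := IsSelfAdjoint.of_nonneg hT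
  have h1 := one_sub_resolventOf hT zero_le_one
  have hc := continuousOn_inv_one_add hT zero_le_one
  rw [one_smul] at h1
  rw [h1, cfc_rpow_of_nonneg hT hc (fun x hx => ?_) hr, ← cfc_mul _ _ T
    (hc.rpow_const fun _ _ => Or.inr hr) (continuousOn_one_add_rpow hT zero_le_one r),
    ← cfc_one ℝ T]
  · refine cfc_congr fun x hx => ?_
    have h2 := h0 x hx
    have h3 : 0 < 1 + 1 * x := by positivity
    simp only [Pi.one_apply]
    rw [← Real.mul_rpow (by positivity) h3.le, inv_mul_cancel₀ h3.ne', Real.one_rpow]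
  · have := h0 x hx
    positivity

theorem range_resolventOf_rpow (hT : 0 ≤ T) {t : ℝ} (ht : 0 ≤ t) {r : ℝ} (hr : 0 ≤ r) :
    LinearMap.range (opPow (resolventOf T t) r).toLinearMap =
      LinearMap.range (opPow T r).toLinearMap := by
  apply le_antisymm
  · rintro _ ⟨h, rfl⟩
    exact ⟨cfc (fun x : ℝ => (1 + t * x) ^ (-r)) T h,
      congrArg (fun B : H →L[ℂ] H => B h) (rpow_mul_one_add_rpow_neg hT ht hr)⟩
  · rintro _ ⟨h, rfl⟩
    exact ⟨cfc (fun x : ℝ => (1 + t * x) ^ r) T h,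
      congrArg (fun B : H →L[ℂ] H => B h) (resolventOf_rpow_mul hT ht hr)⟩

theorem invAddOne_eq {H : Type*} [NormedAddCommGroup H] [InnerProductSpace ℂ H]
    {A : H →ₗ.[ℂ] H} {R : H →L[ℂ] H} (hR : IsInvAddOne A R) :
    invAddOne A = R := by
  have hex : ∃ R : H →L[ℂ] H, IsInvAddOne A R := ⟨R, hR⟩
  rw [invAddOne, dif_pos hex]
  ext h
  obtain ⟨hd, he⟩ := hR.1 h
  have h1 := hex.choose_spec.2 ⟨R h, hd⟩
  rw [he] at h1
  exact h1

theorem domain_nonnegPow {A : H →ₗ.[ℂ] H} {R : H →L[ℂ] H} (hR : IsInvAddOne A R) (r : ℝ) :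
    (nonnegPow A r).domain = LinearMap.range (opPow R r).toLinearMap := by
  rw [nonnegPow, Submodule.toLinearPMap_domain, invAddOne_eq hR]
  ext g
  simp only [Submodule.mem_map, LinearMap.mem_range]
  constructor
  · rintro ⟨_, ⟨h, rfl⟩, rfl⟩
    exact ⟨h, rfl⟩
  · rintro ⟨h, rfl⟩
    exact ⟨_, ⟨h, rfl⟩, rfl⟩

theorem injective_resolventOf (hT : 0 ≤ T) (hinj : Function.Injective T) {t : ℝ} (ht : 0 ≤ t) :
    Function.Injective (resolventOf T t) := by
  have h1 := resolventOf_add_mul hT ht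
  have h2 : Commute (resolventOf T t) T := by
    have h := cfc_commute_cfc (fun x : ℝ => x / (1 + t * x)) (fun x : ℝ => x) T
    rwa [cfc_id' ℝ T (IsSelfAdjoint.of_nonneg hT)] at h
  rw [h2.eq] at h1
  intro x y hxy
  apply hinj
  rw [← h1]
  simp [hxy]

/-- If `(A + 1)⁻¹ = T (1 + T)⁻¹`, that is `A = T⁻¹`, then the domain of `A ^ r` is the range of
`T ^ r`, and `A ^ r` inverts `T ^ r`. -/
theorem nonnegPow_apply (hT : 0 ≤ T) (hinj : Function.Injective T) {A : H →ₗ.[ℂ] H}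
    (hA : IsInvAddOne A (resolventOf T 1)) {r : ℝ} (hr : 0 < r) (h : H)
    (hd : opPow T r h ∈ (nonnegPow A r).domain) : nonnegPow A r ⟨opPow T r h, hd⟩ = h := by
  set R := resolventOf T 1 with hRdef
  have hR0 : 0 ≤ R := cfc_nonneg fun x hx => by
    have := spectrum_nonneg_of_nonneg hT hx
    positivity
  have hRinj : Function.Injective (R ^ r) :=
    injective_rpow hR0 (injective_resolventOf hT hinj zero_le_one) hr.le
  have hg : ∀ x ∈ LinearMap.range ((R ^ r).prod ((1 - R) ^ r)).toLinearMap,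
      x.1 = 0 → x.2 = 0 := by
    rintro _ ⟨k, rfl⟩ hk
    have : k = 0 := hRinj (by simpa using hk)
    simp [this]
  have h1 := Submodule.mem_graph_toLinearPMap hg ⟨(T ^ r) h, by
    have := hd
    rwa [nonnegPow, Submodule.toLinearPMap_domain, invAddOne_eq hA] at this⟩
  obtain ⟨k, hk⟩ := h1
  have hk1 : (R ^ r) k = (T ^ r) h := congrArg Prod.fst hk
  have hk2 := congrArg Prod.snd hk
  have hkh : k = cfc (fun x : ℝ => (1 + 1 * x) ^ r) T h := by
    apply hRinj
    rw [hk1, ← resolventOf_rpow_mul hT zero_le_one hr.le]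
    rfl
  have h2 : ((1 - R) ^ r) k = h := by
    rw [hkh]
    exact congrArg (fun B : H →L[ℂ] H => B h) (one_sub_resolventOf_rpow_mul hT hr.le)
  have h3 : ∀ (R' : H →L[ℂ] H) (_ : R' = R) (hd' : (T ^ r) h ∈ (LinearMap.range
      ((R' ^ r).prod ((1 - R') ^ r)).toLinearMap).toLinearPMap.domain),
      (LinearMap.range ((R' ^ r).prod ((1 - R') ^ r)).toLinearMap).toLinearPMap
        ⟨(T ^ r) h, hd'⟩ = ((1 - R) ^ r) k := by
    rintro _ rfl hd'
    exact hk2.symm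
  exact (h3 _ (invAddOne_eq hA) hd).trans h2

theorem isInvAddOne_shift (hT : 0 ≤ T) {A : H →ₗ.[ℂ] H} (hA : IsInvAddOne A T) {lam : ℝ}
    (hlam : 0 ≤ lam) : IsInvAddOne (shift A lam) (resolventOf T lam) := by
  constructor
  · intro h
    set W := cfc (fun x : ℝ => (1 + lam * x)⁻¹) T with hW
    have h1 : resolventOf T lam h = T (W h) := by
      rw [resolventOf_eq_mul hT hlam]; rfl
    have h2 : W h = h - lam • resolventOf T lam h := by
      rw [hW, ← one_sub_resolventOf hT hlam]; rfl
    obtain ⟨hd, he⟩ := hA.1 (W h)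
    have hd' : resolventOf T lam h ∈ A.domain := by rw [h1]; exact hd
    refine ⟨hd', ?_⟩
    have h3 : shift A lam ⟨resolventOf T lam h, hd'⟩ =
        (lam : ℂ) • resolventOf T lam h + A ⟨resolventOf T lam h, hd'⟩ := rfl
    have h4 : A ⟨resolventOf T lam h, hd'⟩ = W h - resolventOf T lam h := by
      rw [eq_sub_iff_add_eq]
      simp only [h1]
      exact he
    rw [h3, h4, h2, Complex.coe_smul]
    abel
  · intro g
    have h1 := hA.2 g
    have h3 : shift A lam g = (lam : ℂ) • (g : H) + A g := rfl
    rw [h3]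
    set m := A g + (g : H)
    have h4 : (lam : ℂ) • (g : H) + A g + (g : H) = m + lam • T m := by
      rw [h1, Complex.coe_smul]
      simp only [m]
      abel
    change resolventOf T lam ((lam : ℂ) • (g : H) + A g + (g : H)) = (g : H)
    rw [h4, ← h1]
    exact congrArg (fun B : H →L[ℂ] H => B m) (by
      simpa [mul_add] using resolventOf_add_mul hT hlam :
      resolventOf T lam * (1 + lam • T) = T) |>.trans rfl

end Operator

/-! ### Weighted integrals in momentum space -/

/-- The Fourier symbol `lam + |p|²` of `-Δ + lam`, where `p = 2πξ`. -/
def symbol (lam : ℝ) (ξ : E3) : ℝ := lam + (2 * Real.pi * ‖ξ‖) ^ 2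

theorem symbol_pos {lam : ℝ} (hlam : 0 < lam) (ξ : E3) : 0 < symbol lam ξ := by
  unfold symbol; positivity

theorem le_symbol (lam : ℝ) (ξ : E3) : lam ≤ symbol lam ξ := by
  unfold symbol
  linarith [sq_nonneg (2 * Real.pi * ‖ξ‖)]

theorem symbol_add (lam t : ℝ) (ξ : E3) : symbol (lam + t) ξ = symbol lam ξ + t := by
  unfold symbol; ring

@[fun_prop]
theorem measurable_symbol (lam : ℝ) : Measurable (symbol lam) := by
  unfold symbol; fun_prop

theorem integral_rpow_mul_add_rpow {β γ : ℝ} (hβ : -1 < β) (hγ : β + 1 < γ) {p : ℝ} (hp : 0 < p) :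
    IntegrableOn (fun t : ℝ => t ^ β * (p + t) ^ (-γ)) (Set.Ioi 0) ∧
    ∫ t in Set.Ioi (0 : ℝ), t ^ β * (p + t) ^ (-γ) = powerIntegral β γ * p ^ (β + 1 - γ) := by
  have h1 : ∀ t ∈ Set.Ioi (0 : ℝ), p ^ (γ - β) * (t ^ β * (p + t) ^ (-γ)) =
      (p⁻¹ * t) ^ β * (1 + p⁻¹ * t) ^ (-γ) := by
    intro t ht
    have h0 : (0 : ℝ) < t := ht
    rw [show 1 + p⁻¹ * t = p⁻¹ * (p + t) by field_simp, Real.mul_rpow (by positivity) h0.le,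
      Real.mul_rpow (by positivity) (by positivity), sub_eq_add_neg, add_comm γ,
      Real.rpow_add hp, Real.inv_rpow hp.le, Real.inv_rpow hp.le, Real.rpow_neg hp.le,
      Real.rpow_neg hp.le, inv_inv]
    ring
  have hi := integrableOn_rpow_mul_one_add_rpow hβ hγ
  have hi' : IntegrableOn (fun t : ℝ => (p⁻¹ * t) ^ β * (1 + p⁻¹ * t) ^ (-γ)) (Set.Ioi 0) := by
    have := (integrableOn_Ioi_comp_mul_left_iff
      (fun t : ℝ => t ^ β * (1 + t) ^ (-γ)) 0 (inv_pos.2 hp)).2 (by rwa [mul_zero])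
    exact this
  have hc : (p ^ (γ - β) : ℝ) ≠ 0 := by positivity
  have hi'' := ((integrableOn_congr_fun h1 measurableSet_Ioi).2 hi').const_mul (p ^ (γ - β))⁻¹
  refine ⟨?_, ?_⟩
  · refine hi''.congr (Filter.Eventually.of_forall fun t => ?_)
    simp only
    field_simp
  · have h2 := integral_comp_mul_left_Ioi (fun t : ℝ => t ^ β * (1 + t) ^ (-γ)) 0 (inv_pos.2 hp)
    rw [mul_zero, ← setIntegral_congr_fun measurableSet_Ioi h1, integral_const_mul, inv_inv,
      smul_eq_mul, ← powerIntegral] at h2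
    have h3 : p ^ (β + 1 - γ) = p / p ^ (γ - β) := by
      rw [show β + 1 - γ = 1 - (γ - β) by ring, Real.rpow_sub hp, Real.rpow_one]
    rw [h3]
    field_simp
    linarith

theorem lintegral_rpow_mul_add_rpow {β γ : ℝ} (hβ : -1 < β) (hγ : β + 1 < γ) {p : ℝ}
    (hp : 0 < p) :
    ∫⁻ t in Set.Ioi (0 : ℝ), ENNReal.ofReal (t ^ β * (p + t) ^ (-γ)) =
      ENNReal.ofReal (powerIntegral β γ * p ^ (β + 1 - γ)) := by
  obtain ⟨h1, h2⟩ := integral_rpow_mul_add_rpow hβ hγ hp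
  rw [← h2, ofReal_integral_eq_lintegral_ofReal h1]
  filter_upwards [ae_restrict_mem measurableSet_Ioi] with t ht
  have h0 : (0 : ℝ) < t := ht
  exact (by positivity : 0 ≤ t ^ β * (p + t) ^ (-γ))

/-- Integrating out the spectral parameter `t`. -/
theorem lintegral_lintegral_rpow_symbol {β γ : ℝ} (hβ : -1 < β) (hγ : β + 1 < γ) {lam : ℝ}
    (hlam : 0 < lam) {f : E3 → ENNReal} (hf : Measurable f) :
    ∫⁻ t in Set.Ioi (0 : ℝ), ENNReal.ofReal (t ^ β) *
        ∫⁻ ξ, f ξ * ENNReal.ofReal ((symbol lam ξ + t) ^ (-γ)) =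
      ENNReal.ofReal (powerIntegral β γ) *
        ∫⁻ ξ, f ξ * ENNReal.ofReal (symbol lam ξ ^ (β + 1 - γ)) := by
  have hK := (powerIntegral_pos hβ hγ).le
  calc _ = ∫⁻ t in Set.Ioi (0 : ℝ), ∫⁻ ξ,
        ENNReal.ofReal (t ^ β) * (f ξ * ENNReal.ofReal ((symbol lam ξ + t) ^ (-γ))) := by
        refine lintegral_congr fun t => ?_
        rw [lintegral_const_mul _ (by fun_prop)]
    _ = ∫⁻ ξ, ∫⁻ t in Set.Ioi (0 : ℝ),
        ENNReal.ofReal (t ^ β) * (f ξ * ENNReal.ofReal ((symbol lam ξ + t) ^ (-γ))) := by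
        refine lintegral_lintegral_swap (Measurable.aemeasurable ?_)
        unfold Function.uncurry
        fun_prop
    _ = ∫⁻ ξ, ENNReal.ofReal (powerIntegral β γ) *
          (f ξ * ENNReal.ofReal (symbol lam ξ ^ (β + 1 - γ))) := by
        refine lintegral_congr fun ξ => ?_
        rw [mul_left_comm, ← ENNReal.ofReal_mul hK,
          ← lintegral_rpow_mul_add_rpow hβ hγ (symbol_pos hlam ξ),
          ← lintegral_const_mul _ (by fun_prop)]
        refine setLIntegral_congr_fun measurableSet_Ioi fun t ht => ?_
        have h0 : (0 : ℝ) < t := ht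
        rw [ENNReal.ofReal_mul (by positivity)]
        ring
    _ = _ := lintegral_const_mul _ (by fun_prop)

/-- The constant of `lintegral_symbol_rpow_mul_inv_le`. -/
def radialConst (a : ℝ) : ℝ :=
  3 * ((volume : Measure E3).real (Metric.ball 0 1) * (2 * powerIntegral (2 - 2 * a) 2))

theorem lintegral_symbol_rpow_mul_inv_le {a : ℝ} (ha : 1 / 2 < a) (ha' : a < 3 / 2) {lam : ℝ}
    (hlam : 0 < lam) {t : ℝ} (ht : 0 < t) :
    ∫⁻ ξ, ENNReal.ofReal (symbol lam ξ ^ (-a) * (symbol lam ξ + t)⁻¹) ≤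
      ENNReal.ofReal (radialConst a * t ^ (1 / 2 - a)) := by
  have hst : 0 < √t := Real.sqrt_pos.2 ht
  obtain ⟨h1, h2⟩ := integral_rpow_mul_add_rpow (β := 2 - 2 * a) (γ := 2) (by linarith)
    (by linarith) hst
  let k : ℝ → ℝ := fun ρ => 2 * (ρ ^ (-(2 * a)) * (√t + ρ) ^ (-2 : ℝ))
  have hk : ∀ ρ ∈ Set.Ioi (0 : ℝ), 2 * (ρ ^ (2 - 2 * a) * (√t + ρ) ^ (-2 : ℝ)) =
      ρ ^ 2 * k ρ := by
    intro ρ hρ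
    have h0 : (0 : ℝ) < ρ := hρ
    simp only [k]
    rw [sub_eq_add_neg, Real.rpow_add h0, Real.rpow_two]
    ring
  have hi : Integrable (fun ξ : E3 => k ‖ξ‖) := by
    refine (integrable_fun_norm_addHaar (volume : Measure E3)).2 ?_
    have := (integrableOn_congr_fun hk measurableSet_Ioi).1 (h1.const_mul 2)
    simpa using this
  have hv : ∫ ξ : E3, k ‖ξ‖ = radialConst a * t ^ (1 / 2 - a) := by
    rw [integral_fun_norm_addHaar (volume : Measure E3) k]
    have h3 := setIntegral_congr_fun (μ := volume) measurableSet_Ioi hk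
    rw [integral_const_mul, h2] at h3
    have h4 : √t ^ (2 - 2 * a + 1 - 2) = t ^ (1 / 2 - a) := by
      rw [Real.sqrt_eq_rpow, ← Real.rpow_mul ht.le]
      congr 1
      ring
    rw [h4] at h3
    simp only [finrank_euclideanSpace, Fintype.card_fin, nsmul_eq_mul, smul_eq_mul, radialConst]
    norm_num
    rw [← h3]
    ring
  rw [← hv, ofReal_integral_eq_lintegral_ofReal hi]
  · refine lintegral_mono_ae ?_
    have hne : ∀ᵐ ξ : E3, ξ ≠ 0 := by
      simp [ae_iff]
    filter_upwards [hne] with ξ hξ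
    have hn : 0 < ‖ξ‖ := norm_pos_iff.2 hξ
    refine ENNReal.ofReal_le_ofReal ?_
    have hpi : 1 ≤ 2 * Real.pi := by linarith [Real.pi_gt_three]
    have hP : ‖ξ‖ ^ 2 ≤ symbol lam ξ := by
      unfold symbol
      nlinarith [mul_le_mul_of_nonneg_right hpi hn.le]
    have hA : symbol lam ξ ^ (-a) ≤ ‖ξ‖ ^ (-(2 * a)) := by
      calc symbol lam ξ ^ (-a) ≤ (‖ξ‖ ^ 2) ^ (-a) :=
            Real.rpow_le_rpow_of_nonpos (by positivity) hP (by linarith)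
        _ = _ := by
            rw [← Real.rpow_natCast, ← Real.rpow_mul hn.le]
            congr 1
            push_cast
            ring
    have hB : (symbol lam ξ + t)⁻¹ ≤ 2 * (√t + ‖ξ‖) ^ (-2 : ℝ) := by
      rw [Real.rpow_neg (by positivity), Real.rpow_two, ← div_eq_mul_inv, inv_eq_one_div,
        div_le_div_iff₀ (by have := symbol_pos hlam ξ; positivity) (by positivity)]
      nlinarith [Real.sq_sqrt ht.le, sq_nonneg (√t - ‖ξ‖)]
    have := symbol_pos hlam ξ
    calc _ ≤ ‖ξ‖ ^ (-(2 * a)) * (2 * (√t + ‖ξ‖) ^ (-2 : ℝ)) := by gcongr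
      _ = k ‖ξ‖ := by simp only [k]; ring
  · exact Filter.Eventually.of_forall fun ξ => (by positivity : 0 ≤ k ‖ξ‖)

/-- The constant of `lintegral_rpow_mul_lintegral_sq_le`. -/
def pairingConst (σ : ℝ) : ENNReal :=
  ENNReal.ofReal (radialConst (3 / 4 - σ / 2)) * ENNReal.ofReal (powerIntegral (-σ / 2 - 3 / 4) 1)

theorem pairingConst_ne_top (σ : ℝ) : pairingConst σ ≠ ⊤ :=
  ENNReal.mul_ne_top ENNReal.ofReal_ne_top ENNReal.ofReal_ne_top

/-- The weighted estimate for the pairing `⟪G_{lam+t}, f⟫ = ∫ f / (symbol lam + t)`. It is a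
Cauchy–Schwarz estimate with weight `symbol lam ^ a`, where `a` has to satisfy
`1/2 < a < 3/2` and `-σ < a < 1 - σ`; the choice `a = 3/4 - σ/2` works for all
`-3/2 < σ < 1/2`. -/
theorem lintegral_rpow_mul_lintegral_sq_le {σ : ℝ} (hσ : -(3 / 2) < σ) (hσ' : σ < 1 / 2) {lam : ℝ}
    (hlam : 0 < lam) {f : E3 → ENNReal} (hf : Measurable f) :
    ∫⁻ t in Set.Ioi (0 : ℝ), ENNReal.ofReal (t ^ (-(1 / 2) - σ)) *
        (∫⁻ ξ, f ξ * ENNReal.ofReal (symbol lam ξ + t)⁻¹) ^ 2 ≤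
      pairingConst σ * ∫⁻ ξ, f ξ ^ 2 * ENNReal.ofReal (symbol lam ξ ^ (-σ)) := by
  set a : ℝ := 3 / 4 - σ / 2 with ha
  have hpos := symbol_pos hlam
  have hC : 0 ≤ radialConst a := by
    have := (powerIntegral_pos (β := 2 - 2 * a) (γ := 2) (by linarith) (by linarith)).le
    unfold radialConst
    positivity
  have h1 : ∀ t ∈ Set.Ioi (0 : ℝ),
      (∫⁻ ξ, f ξ * ENNReal.ofReal (symbol lam ξ + t)⁻¹) ^ 2 ≤
      (∫⁻ ξ, (f ξ ^ 2 * ENNReal.ofReal (symbol lam ξ ^ a)) *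
        ENNReal.ofReal ((symbol lam ξ + t) ^ (-1 : ℝ))) *
        ENNReal.ofReal (radialConst a * t ^ (1 / 2 - a)) := by
    intro t ht
    have h0 : (0 : ℝ) < t := ht
    have hp : ∀ ξ, 0 < symbol lam ξ + t := fun ξ => add_pos (hpos ξ) h0
    have h2 : ∀ ξ, f ξ * ENNReal.ofReal (symbol lam ξ + t)⁻¹ =
        (f ξ * ENNReal.ofReal (symbol lam ξ ^ (a / 2) * (symbol lam ξ + t) ^ (-(1 / 2) : ℝ))) *
          ENNReal.ofReal (symbol lam ξ ^ (-(a / 2)) * (symbol lam ξ + t) ^ (-(1 / 2) : ℝ)) := by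
      intro ξ
      have h3 := hpos ξ
      have h4 := hp ξ
      rw [mul_assoc, ← ENNReal.ofReal_mul (by positivity)]
      congr 2
      rw [mul_mul_mul_comm, ← Real.rpow_add h3, ← Real.rpow_add h4]
      norm_num
      rw [Real.rpow_neg_one]
    simp_rw [h2]
    refine (lintegral_mul_sq_le (by fun_prop) (by fun_prop)).trans ?_
    refine mul_le_mul' (lintegral_mono fun ξ => le_of_eq ?_) (le_trans (lintegral_mono fun ξ =>
      le_of_eq ?_) (lintegral_symbol_rpow_mul_inv_le (by linarith) (by linarith) hlam h0))
    · have h3 := hpos ξ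
      have h4 := hp ξ
      rw [mul_pow, mul_assoc, ← ENNReal.ofReal_mul (by positivity),
        ← ENNReal.ofReal_pow (by positivity), mul_pow, ← Real.rpow_mul_natCast h3.le,
        ← Real.rpow_mul_natCast h4.le]
      norm_num
    · have h3 := hpos ξ
      have h4 := hp ξ
      rw [← ENNReal.ofReal_pow (by positivity), mul_pow, ← Real.rpow_mul_natCast h3.le,
        ← Real.rpow_mul_natCast h4.le]
      norm_num
      rw [Real.rpow_neg_one]
  calc _ ≤ ∫⁻ t in Set.Ioi (0 : ℝ), ENNReal.ofReal (radialConst a) *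
        (ENNReal.ofReal (t ^ (-σ - a)) *
        ∫⁻ ξ, (f ξ ^ 2 * ENNReal.ofReal (symbol lam ξ ^ a)) *
          ENNReal.ofReal ((symbol lam ξ + t) ^ (-1 : ℝ))) := by
        refine setLIntegral_mono_ae' measurableSet_Ioi ?_
        filter_upwards with t ht
        have h0 : (0 : ℝ) < t := ht
        refine (mul_le_mul_right (h1 t ht) _).trans (le_of_eq ?_)
        rw [ENNReal.ofReal_mul hC, show -σ - a = (-(1 / 2) - σ) + (1 / 2 - a) by ring,
          Real.rpow_add h0, ENNReal.ofReal_mul (by positivity)]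
        ring
    _ = ENNReal.ofReal (radialConst a) * (ENNReal.ofReal (powerIntegral (-σ - a) 1) *
        ∫⁻ ξ, (f ξ ^ 2 * ENNReal.ofReal (symbol lam ξ ^ a)) *
          ENNReal.ofReal (symbol lam ξ ^ ((-σ - a) + 1 - 1))) := by
        rw [← lintegral_lintegral_rpow_symbol (by linarith) (by linarith) hlam (by fun_prop),
          lintegral_const_mul' _ _ ENNReal.ofReal_ne_top]
    _ = _ := by
        rw [pairingConst, ← ha, show -σ / 2 - 3 / 4 = -σ - a by rw [ha]; ring, mul_assoc]
        congr 2
        refine lintegral_congr fun ξ => ?_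
        have h3 := hpos ξ
        rw [mul_assoc, ← ENNReal.ofReal_mul (by positivity), ← Real.rpow_add h3]
        congr 3
        ring

/-- `G_lam` does not belong to `H^s` for `1/2 ≤ s`. -/
theorem lintegral_symbol_rpow_eq_top {s : ℝ} (hs : 1 / 2 ≤ s) (hs2 : s ≤ 2) {lam : ℝ}
    (hlam : 0 < lam) : ∫⁻ ξ, ENNReal.ofReal (symbol lam ξ ^ (s - 2)) = ⊤ := by
  by_contra hne
  have h1 : Integrable (fun ξ => symbol lam ξ ^ (s - 2)) := by
    refine ⟨(by fun_prop : Measurable _).aestronglyMeasurable, ?_⟩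
    rw [hasFiniteIntegral_iff_ofReal (Filter.Eventually.of_forall fun ξ =>
      Real.rpow_nonneg (symbol_pos hlam ξ).le _)]
    exact lt_top_iff_ne_top.2 hne
  have h2 := (integrable_fun_norm_addHaar (volume : Measure E3)
    (f := fun ρ => (lam + (2 * Real.pi * ρ) ^ 2) ^ (s - 2))).1 h1
  have h3 := h2.mono_set (Set.Ioi_subset_Ioi zero_le_one)
  set c : ℝ := lam + (2 * Real.pi) ^ 2 with hc
  have hc0 : 0 < c := by positivity
  have h4 : IntegrableOn (fun ρ : ℝ => ρ ^ (2 * s - 2)) (Set.Ioi 1) := by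
    refine (h3.const_mul (c ^ (2 - s))).mono'
      (by fun_prop : Measurable fun ρ : ℝ => ρ ^ (2 * s - 2)).aestronglyMeasurable ?_
    filter_upwards [ae_restrict_mem measurableSet_Ioi] with ρ hρ
    have h1ρ : (1 : ℝ) < ρ := hρ
    have h0 : 0 < ρ := by linarith
    have hle : lam + (2 * Real.pi * ρ) ^ 2 ≤ c * ρ ^ 2 := by
      rw [hc]
      nlinarith [mul_nonneg hlam.le (by nlinarith : (0 : ℝ) ≤ ρ ^ 2 - 1)]
    have hle2 : (c * ρ ^ 2) ^ (s - 2) ≤ (lam + (2 * Real.pi * ρ) ^ 2) ^ (s - 2) :=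
      Real.rpow_le_rpow_of_nonpos (by positivity) hle (by linarith)
    rw [Real.norm_of_nonneg (by positivity)]
    simp only [finrank_euclideanSpace, Fintype.card_fin, smul_eq_mul]
    norm_num
    calc ρ ^ (2 * s - 2) = c ^ (2 - s) * (ρ ^ 2 * (c * ρ ^ 2) ^ (s - 2)) := by
          rw [Real.mul_rpow hc0.le (by positivity), ← Real.rpow_natCast ρ 2, ← Real.rpow_mul h0.le,
            show c ^ (2 - s) * (ρ ^ ((2 : ℕ) : ℝ) * (c ^ (s - 2) * ρ ^ (((2 : ℕ) : ℝ) * (s - 2)))) =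
              (c ^ (2 - s) * c ^ (s - 2)) * (ρ ^ ((2 : ℕ) : ℝ) * ρ ^ (((2 : ℕ) : ℝ) * (s - 2))) by
                ring,
            ← Real.rpow_add hc0, ← Real.rpow_add h0]
          norm_num
          congr 1
          ring
      _ ≤ _ := by gcongr
  rw [integrableOn_Ioi_rpow_iff one_pos] at h4
  linarith

theorem integrable_symbol_rpow_neg {s : ℝ} (hs : 3 / 2 < s) {lam : ℝ} (hlam : 0 < lam) :
    Integrable (fun ξ => symbol lam ξ ^ (-s)) := by
  have h1 := integrable_rpow_neg_one_add_norm_sq (E := E3) (μ := volume) (r := 2 * s)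
    (by simp only [finrank_euclideanSpace, Fintype.card_fin]; push_cast; linarith)
  set c : ℝ := min lam 1 with hc
  have hc0 : 0 < c := by positivity
  refine (h1.const_mul (c ^ (-s))).mono' (by fun_prop : Measurable _).aestronglyMeasurable ?_
  filter_upwards with ξ
  have hp := symbol_pos hlam ξ
  rw [Real.norm_of_nonneg (by positivity), show -(2 * s) / 2 = -s by ring,
    ← Real.mul_rpow hc0.le (by positivity)]
  refine Real.rpow_le_rpow_of_nonpos (by positivity) ?_ (by linarith)
  have h2 : c ≤ lam := min_le_left _ _
  have h3 : c ≤ 1 := min_le_right _ _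
  have hpi : 1 ≤ (2 * Real.pi) ^ 2 := by nlinarith [Real.pi_gt_three]
  unfold symbol
  rw [mul_pow]
  nlinarith [mul_le_mul_of_nonneg_right hpi (sq_nonneg ‖ξ‖),
    mul_le_mul_of_nonneg_right h3 (sq_nonneg ‖ξ‖)]

/-! ### The Fourier transform of the Green function -/

open Filter Topology in
theorem integral_Ioi_zero_of_hasDerivAt {g g' : ℝ → ℝ} {l m : ℝ}
    (hderiv : ∀ x ∈ Set.Ioi (0 : ℝ), HasDerivAt g (g' x) x)
    (hpos : ∀ x ∈ Set.Ioi (0 : ℝ), 0 ≤ g' x) (h0 : Tendsto g (𝓝[>] 0) (𝓝 l))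
    (hinf : Tendsto g atTop (𝓝 m)) :
    IntegrableOn g' (Set.Ioi 0) ∧ ∫ x in Set.Ioi (0 : ℝ), g' x = m - l := by
  set f := Function.update g 0 l with hf
  have hf0 : f 0 = l := Function.update_self _ _ _
  have hcont : ContinuousWithinAt f (Set.Ici 0) 0 := by
    rw [hf, continuousWithinAt_update_same, Set.Ici_sdiff_left]
    exact h0
  have hd : ∀ x ∈ Set.Ioi (0 : ℝ), HasDerivAt f (g' x) x := by
    intro x hx
    refine (hderiv x hx).congr_of_eventuallyEq ?_
    filter_upwards [Ioi_mem_nhds hx] with y hy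
    exact Function.update_of_ne (ne_of_gt hy) _ _
  have ht : Tendsto f atTop (𝓝 m) := by
    refine hinf.congr' ?_
    filter_upwards [eventually_gt_atTop 0] with y hy
    exact (Function.update_of_ne (ne_of_gt hy) _ _).symm
  refine ⟨integrableOn_Ioi_deriv_of_nonneg hcont hd hpos ht, ?_⟩
  rw [integral_Ioi_of_hasDerivAt_of_nonneg hcont hd hpos ht, hf0]

/-- The antiderivative `∫₀^x exp (-y²) dy` of the Gaussian. -/
def gaussPrimitive (x : ℝ) : ℝ := ∫ y in (0 : ℝ)..x, Real.exp (-y ^ 2)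

theorem hasDerivAt_gaussPrimitive (x : ℝ) :
    HasDerivAt gaussPrimitive (Real.exp (-x ^ 2)) x := by
  have hc : Continuous fun y : ℝ => Real.exp (-y ^ 2) := by fun_prop
  exact intervalIntegral.integral_hasDerivAt_right (hc.intervalIntegrable _ _)
    (hc.stronglyMeasurableAtFilter _ _) hc.continuousAt

open Filter Topology in
theorem tendsto_gaussPrimitive_atTop : Tendsto gaussPrimitive atTop (𝓝 (√Real.pi / 2)) := by
  have hi : Integrable fun y : ℝ => Real.exp (-y ^ 2) := by
    simpa using integrable_exp_neg_mul_sq (b := 1) one_pos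
  have h := intervalIntegral_tendsto_integral_Ioi 0 hi.integrableOn tendsto_id
  have h2 := integral_gaussian_Ioi 1
  simp only [neg_mul, one_mul, div_one] at h2
  rw [h2] at h
  exact h

theorem gaussPrimitive_neg (x : ℝ) : gaussPrimitive (-x) = -gaussPrimitive x := by
  unfold gaussPrimitive
  have h := intervalIntegral.integral_comp_neg (a := 0) (b := x) (fun y : ℝ => Real.exp (-y ^ 2))
  rw [neg_zero] at h
  simp only [neg_sq] at h
  rw [h, intervalIntegral.integral_symm]

open Filter Topology in
theorem tendsto_gaussPrimitive_atBot : Tendsto gaussPrimitive atBot (𝓝 (-(√Real.pi / 2))) := by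
  have h := (tendsto_gaussPrimitive_atTop.comp tendsto_neg_atBot_atTop).neg
  refine h.congr fun x => ?_
  simp [gaussPrimitive_neg]

open Filter Topology in
/-- The integral `∫₀^∞ exp (-r² u² - b² / u²) du = √π / (2r) exp (-2 r b)`. An antiderivative of
the integrand is `(e^{2rb} E (ru + b/u) + e^{-2rb} E (ru - b/u)) / (2r)`, where `E` is the
antiderivative of the Gaussian. -/
theorem integral_exp_neg_sq_sub_inv_sq {r b : ℝ} (hr : 0 < r) (hb : 0 < b) :
    ∫ u in Set.Ioi (0 : ℝ), Real.exp (-(r * u) ^ 2 - (b / u) ^ 2) =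
      √Real.pi / (2 * r) * Real.exp (-(2 * r * b)) := by
  let g : ℝ → ℝ := fun u => (2 * r)⁻¹ * (Real.exp (2 * r * b) * gaussPrimitive (r * u + b / u) +
    Real.exp (-(2 * r * b)) * gaussPrimitive (r * u - b / u))
  have hderiv : ∀ u ∈ Set.Ioi (0 : ℝ),
      HasDerivAt g (Real.exp (-(r * u) ^ 2 - (b / u) ^ 2)) u := by
    intro u hu
    have hu0 : u ≠ 0 := ne_of_gt hu
    have hdiv : HasDerivAt (fun u : ℝ => b / u) (-(b / u ^ 2)) u := by
      simpa [div_eq_mul_inv] using (hasDerivAt_inv hu0).const_mul b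
    have hlin : HasDerivAt (fun u : ℝ => r * u) r u := by
      simpa using (hasDerivAt_id u).const_mul r
    have h1 := ((hasDerivAt_gaussPrimitive _).comp u (hlin.fun_add hdiv)).const_mul
      (Real.exp (2 * r * b))
    have h2 := ((hasDerivAt_gaussPrimitive _).comp u (hlin.fun_sub hdiv)).const_mul
      (Real.exp (-(2 * r * b)))
    have h3 := (h1.add h2).const_mul (2 * r)⁻¹
    refine h3.congr_deriv ?_
    have e1 : Real.exp (2 * r * b) * Real.exp (-(r * u + b / u) ^ 2) =
        Real.exp (-(r * u) ^ 2 - (b / u) ^ 2) := by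
      rw [← Real.exp_add]
      congr 1
      field_simp
      ring
    have e2 : Real.exp (-(2 * r * b)) * Real.exp (-(r * u - b / u) ^ 2) =
        Real.exp (-(r * u) ^ 2 - (b / u) ^ 2) := by
      rw [← Real.exp_add]
      congr 1
      field_simp
      ring
    rw [← mul_assoc, ← mul_assoc, e1, e2]
    field_simp
    ring
  have hatTop : Tendsto (fun u : ℝ => b / u) atTop (𝓝 0) := tendsto_const_nhds.div_atTop tendsto_id
  have hlinTop : Tendsto (fun u : ℝ => r * u) atTop atTop := tendsto_id.const_mul_atTop hr
  have hdiv0 : Tendsto (fun u : ℝ => b / u) (𝓝[>] 0) atTop := by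
    simpa [div_eq_mul_inv] using tendsto_inv_nhdsGT_zero.const_mul_atTop hb
  have hlin0 : Tendsto (fun u : ℝ => r * u) (𝓝[>] 0) (𝓝 0) := by
    have : Continuous fun u : ℝ => r * u := by fun_prop
    simpa using (this.tendsto 0).mono_left nhdsWithin_le_nhds
  have hinf : Tendsto g atTop (𝓝 ((2 * r)⁻¹ * (Real.exp (2 * r * b) * (√Real.pi / 2) +
      Real.exp (-(2 * r * b)) * (√Real.pi / 2)))) := by
    refine ((Tendsto.const_mul _ (tendsto_gaussPrimitive_atTop.comp ?_)).add
      (Tendsto.const_mul _ (tendsto_gaussPrimitive_atTop.comp ?_))).const_mul _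
    · exact hlinTop.atTop_add hatTop
    · simpa [sub_eq_add_neg] using hlinTop.atTop_add hatTop.neg
  have h0 : Tendsto g (𝓝[>] 0) (𝓝 ((2 * r)⁻¹ * (Real.exp (2 * r * b) * (√Real.pi / 2) +
      Real.exp (-(2 * r * b)) * (-(√Real.pi / 2))))) := by
    refine ((Tendsto.const_mul _ (tendsto_gaussPrimitive_atTop.comp ?_)).add
      (Tendsto.const_mul _ (tendsto_gaussPrimitive_atBot.comp ?_))).const_mul _
    · exact hlin0.add_atTop hdiv0
    · simpa [sub_eq_add_neg] using hlin0.add_atBot (tendsto_neg_atTop_atBot.comp hdiv0)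
  rw [(integral_Ioi_zero_of_hasDerivAt hderiv (fun _ _ => (Real.exp_pos _).le) h0 hinf).2]
  field_simp
  ring

open Filter Topology in
theorem integral_inv_cube_mul_exp {B : ℝ} (hB : 0 < B) :
    IntegrableOn (fun u : ℝ => (u ^ 3)⁻¹ * Real.exp (-(B / u ^ 2))) (Set.Ioi 0) ∧
    ∫ u in Set.Ioi (0 : ℝ), (u ^ 3)⁻¹ * Real.exp (-(B / u ^ 2)) = (2 * B)⁻¹ := by
  have hderiv : ∀ u ∈ Set.Ioi (0 : ℝ), HasDerivAt (fun u : ℝ => (2 * B)⁻¹ *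
      Real.exp (-(B / u ^ 2))) ((u ^ 3)⁻¹ * Real.exp (-(B / u ^ 2))) u := by
    intro u hu
    have hu0 : u ≠ 0 := ne_of_gt hu
    have h1 : HasDerivAt (fun u : ℝ => -(B / u ^ 2)) (2 * B / u ^ 3) u := by
      have := ((hasDerivAt_pow 2 u).fun_inv (pow_ne_zero 2 hu0)).const_mul (-B)
      refine (this.congr_of_eventuallyEq (Eventually.of_forall fun x => ?_)).congr_deriv ?_
      · simp [div_eq_mul_inv]
      · field_simp
        push_cast
        ring
    refine (h1.exp.const_mul _).congr_deriv ?_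
    field_simp
  have hinf : Tendsto (fun u : ℝ => (2 * B)⁻¹ * Real.exp (-(B / u ^ 2))) atTop
      (𝓝 ((2 * B)⁻¹ * 1)) := by
    refine Tendsto.const_mul _ ?_
    have h2 : Tendsto (fun u : ℝ => -(B / u ^ 2)) atTop (𝓝 0) := by
      simpa using (tendsto_const_nhds (x := B) |>.div_atTop
        (tendsto_pow_atTop (two_ne_zero))).neg
    simpa [Function.comp_def] using (Real.continuous_exp.tendsto 0).comp h2
  have h0 : Tendsto (fun u : ℝ => (2 * B)⁻¹ * Real.exp (-(B / u ^ 2))) (𝓝[>] 0)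
      (𝓝 ((2 * B)⁻¹ * 0)) := by
    refine Tendsto.const_mul _ (Real.tendsto_exp_atBot.comp (tendsto_neg_atTop_atBot.comp ?_))
    have h3 : Tendsto (fun u : ℝ => (u⁻¹) ^ 2) (𝓝[>] 0) atTop :=
      (tendsto_pow_atTop two_ne_zero).comp tendsto_inv_nhdsGT_zero
    simpa [div_eq_mul_inv] using h3.const_mul_atTop hB
  have := integral_Ioi_zero_of_hasDerivAt hderiv (fun u hu => by
    have : (0 : ℝ) < u := hu
    positivity) h0 hinf
  simpa using this

/-- The kernel of the Gaussian superposition `G_μ(x) = ∫₀^∞ k(x, u) du`. -/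
def subordination (μ : ℝ) (x : E3) (u : ℝ) : ℝ :=
  (2 * (Real.pi * √Real.pi))⁻¹ * Real.exp (-(‖x‖ * u) ^ 2 - (√μ / 2 / u) ^ 2)

theorem green_eq_integral {μ : ℝ} (hμ : 0 < μ) {x : E3} (hx : x ≠ 0) :
    green μ x = ((∫ u in Set.Ioi (0 : ℝ), subordination μ x u : ℝ) : ℂ) := by
  have hn : 0 < ‖x‖ := norm_pos_iff.2 hx
  unfold subordination green
  rw [integral_const_mul, integral_exp_neg_sq_sub_inv_sq hn (by positivity)]
  congr 1
  have : √Real.pi ≠ 0 := by positivity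
  have hpi := Real.pi_ne_zero
  rw [show -(2 * ‖x‖ * (√μ / 2)) = -(√μ * ‖x‖) by ring]
  field_simp
  norm_num

theorem fourier_subordination {μ : ℝ} (hμ : 0 < μ) (ξ : E3) {u : ℝ} (hu : 0 < u) :
    Integrable (fun x : E3 => (subordination μ x u : ℂ)) ∧
    𝓕 (fun x : E3 => (subordination μ x u : ℂ)) ξ =
      ((2⁻¹ * ((u ^ 3)⁻¹ * Real.exp (-(symbol μ ξ / 4 / u ^ 2))) : ℝ) : ℂ) := by
  set c : ℂ := (((2 * (Real.pi * √Real.pi))⁻¹ * Real.exp (-(√μ / 2 / u) ^ 2) : ℝ) : ℂ) with hc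
  have hfun : (fun x : E3 => (subordination μ x u : ℂ)) =
      fun x : E3 => c * Complex.exp (-((u ^ 2 : ℝ) : ℂ) * (‖x‖ : ℂ) ^ 2) := by
    funext x
    rw [hc, subordination, sub_eq_add_neg, Real.exp_add]
    push_cast
    rw [show -((‖x‖ : ℂ) * u) ^ 2 = -(u : ℂ) ^ 2 * (‖x‖ : ℂ) ^ 2 by ring]
    ring
  have hre : 0 < (((u ^ 2 : ℝ) : ℂ)).re := by
    rw [Complex.ofReal_re]; positivity
  constructor
  · rw [hfun]
    have := GaussianFourier.integrable_cexp_neg_mul_sq_norm_add hre 0 (0 : E3)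
    simp only [zero_mul, add_zero] at this
    exact this.const_mul c
  · rw [hfun]
    have h1 : 𝓕 (fun x : E3 => c * Complex.exp (-((u ^ 2 : ℝ) : ℂ) * (‖x‖ : ℂ) ^ 2)) ξ =
        c * 𝓕 (fun x : E3 => Complex.exp (-((u ^ 2 : ℝ) : ℂ) * (‖x‖ : ℂ) ^ 2)) ξ := by
      rw [Real.fourier_eq, Real.fourier_eq, ← integral_const_mul]
      congr 1
      funext x
      rw [Circle.smul_def, Circle.smul_def, smul_eq_mul, smul_eq_mul]
      ring
    rw [h1, fourier_gaussian_innerProductSpace hre]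
    have h2 : ((Real.pi : ℂ) / ((u ^ 2 : ℝ) : ℂ)) ^ ((Module.finrank ℝ E3 : ℂ) / 2) =
        ((Real.pi * √Real.pi * (u ^ 3)⁻¹ : ℝ) : ℂ) := by
      rw [← Complex.ofReal_div, finrank_euclideanSpace, Fintype.card_fin,
        show (((3 : ℕ) : ℂ) / 2) = ((3 / 2 : ℝ) : ℂ) by push_cast; rfl,
        ← Complex.ofReal_cpow (by positivity)]
      congr 1
      rw [Real.div_rpow Real.pi_pos.le (by positivity), ← Real.rpow_natCast u 2,
        ← Real.rpow_mul hu.le, show ((2 : ℕ) : ℝ) * (3 / 2) = ((3 : ℕ) : ℝ) by norm_num,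
        Real.rpow_natCast, show (3 / 2 : ℝ) = 1 + 1 / 2 by norm_num, Real.rpow_add Real.pi_pos,
        Real.rpow_one, ← Real.sqrt_eq_rpow, div_eq_mul_inv]
    have h3 : Complex.exp (-(Real.pi : ℂ) ^ 2 * (‖ξ‖ : ℂ) ^ 2 / ((u ^ 2 : ℝ) : ℂ)) =
        ((Real.exp (-(Real.pi ^ 2 * ‖ξ‖ ^ 2 / u ^ 2)) : ℝ) : ℂ) := by
      push_cast
      congr 1
      ring
    have h4 : Real.exp (-(symbol μ ξ / 4 / u ^ 2)) =
        Real.exp (-(√μ / 2 / u) ^ 2) * Real.exp (-(Real.pi ^ 2 * ‖ξ‖ ^ 2 / u ^ 2)) := by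
      rw [← Real.exp_add]
      congr 1
      rw [div_pow, div_pow, Real.sq_sqrt hμ.le]
      unfold symbol
      field_simp
      ring
    rw [h2, h3, hc, h4, ← Complex.ofReal_mul, ← Complex.ofReal_mul]
    congr 1
    have : √Real.pi ≠ 0 := by positivity
    have hpi := Real.pi_ne_zero
    field_simp

theorem integrable_subordination_prod {μ : ℝ} (hμ : 0 < μ) :
    Integrable (Function.uncurry fun (x : E3) (u : ℝ) => (subordination μ x u : ℂ))
      ((volume : Measure E3).prod (volume.restrict (Set.Ioi (0 : ℝ)))) := by
  have hmeas : Measurable (Function.uncurry fun (x : E3) (u : ℝ) => (subordination μ x u : ℂ)) := by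
    unfold Function.uncurry subordination
    fun_prop
  rw [integrable_prod_iff' hmeas.aestronglyMeasurable]
  constructor
  · filter_upwards [ae_restrict_mem measurableSet_Ioi] with u hu
    exact (fourier_subordination hμ 0 hu).1
  · have h1 := ((integral_inv_cube_mul_exp (B := symbol μ 0 / 4)
      (by have := symbol_pos hμ 0; positivity)).1.const_mul 2⁻¹)
    refine (integrableOn_congr_fun (fun u hu => ?_) measurableSet_Ioi).1 h1
    have h2 := (fourier_subordination hμ 0 hu).2
    have h3 : ∀ x : E3, ‖(subordination μ x u : ℂ)‖ = subordination μ x u := fun x => by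
      rw [Complex.norm_real, Real.norm_of_nonneg]
      unfold subordination
      positivity
    simp only [Function.uncurry, h3]
    rw [Real.fourier_eq] at h2
    simp only [inner_zero_right, neg_zero, AddChar.map_zero_eq_one, one_smul] at h2
    rw [integral_complex_ofReal] at h2
    exact (Complex.ofReal_injective h2).symm

theorem integrable_green {μ : ℝ} (hμ : 0 < μ) : Integrable (green μ) := by
  have h := (integrable_subordination_prod hμ).integral_prod_left
  refine h.congr ?_
  have hne : ∀ᵐ x : E3, x ≠ 0 := by simp [ae_iff]
  filter_upwards [hne] with x hx
  rw [green_eq_integral hμ hx, ← integral_complex_ofReal]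
  rfl

theorem fourier_green {μ : ℝ} (hμ : 0 < μ) (ξ : E3) :
    𝓕 (green μ) ξ = ((symbol μ ξ)⁻¹ : ℝ) := by
  have hpos := symbol_pos hμ ξ
  have hne : ∀ᵐ x : E3, x ≠ 0 := by simp [ae_iff]
  have hint := integrable_subordination_prod hμ
  calc 𝓕 (green μ) ξ = ∫ x : E3, ∫ u in Set.Ioi (0 : ℝ),
        Real.fourierChar (-inner ℝ x ξ) • (subordination μ x u : ℂ) := by
        rw [Real.fourier_eq]
        refine integral_congr_ae ?_
        filter_upwards [hne] with x hx
        rw [green_eq_integral hμ hx, ← integral_complex_ofReal, Circle.smul_def, ← integral_smul]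
        rfl
    _ = ∫ u in Set.Ioi (0 : ℝ), ∫ x : E3,
        Real.fourierChar (-inner ℝ x ξ) • (subordination μ x u : ℂ) := by
        refine integral_integral_swap ?_
        refine hint.mono ?_ (Filter.Eventually.of_forall fun p => ?_)
        · refine AEStronglyMeasurable.smul ?_ hint.aestronglyMeasurable
          have : Continuous fun p : E3 × ℝ => Real.fourierChar (-inner ℝ p.1 ξ) :=
            Real.continuous_fourierChar.comp (by fun_prop)
          exact (continuous_subtype_val.comp this).aestronglyMeasurable
        · simp [Function.uncurry, Circle.smul_def, Circle.norm_coe]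
    _ = ∫ u in Set.Ioi (0 : ℝ),
        ((2⁻¹ * ((u ^ 3)⁻¹ * Real.exp (-(symbol μ ξ / 4 / u ^ 2))) : ℝ) : ℂ) := by
        refine setIntegral_congr_fun measurableSet_Ioi fun u hu => ?_
        rw [← (fourier_subordination hμ ξ hu).2, Real.fourier_eq]
    _ = _ := by
        rw [integral_complex_ofReal, integral_const_mul,
          (integral_inv_cube_mul_exp (B := symbol μ ξ / 4) (by positivity)).2]
        congr 1
        field_simp
        norm_num

/-! ### Distributions and the Fourier transform on `L²` -/

theorem ext_fourier {f g : L2} (h : (𝓕 f : L2) =ᵐ[volume] (𝓕 g : L2)) : f = g := by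
  have h1 : (𝓕 f : L2) = 𝓕 g := Lp.ext h
  exact (Lp.fourierTransformₗᵢ E3 ℂ).injective h1

theorem ae_eq_of_schwartz {f g : E3 → ℂ} (hf : LocallyIntegrable f) (hg : LocallyIntegrable g)
    (h : ∀ u : 𝓢(E3, ℂ), ∫ x, u x * f x = ∫ x, u x * g x) : f =ᵐ[volume] g := by
  refine ae_eq_of_integral_contDiff_smul_eq hf hg fun φ hφ hc => ?_
  have hφ' : ContDiff ℝ (⊤ : ℕ∞) (fun x => (φ x : ℂ)) := Complex.ofRealCLM.contDiff.comp hφ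
  have hc' : HasCompactSupport (fun x => (φ x : ℂ)) := hc.comp_left Complex.ofReal_zero
  have := h (hc'.toSchwartzMap hφ')
  simpa using this

theorem locallyIntegrable_coeFn (f : L2) : LocallyIntegrable (f : E3 → ℂ) :=
  (Lp.memLp f).locallyIntegrable one_le_two

theorem smulLeftCLM_eq_iff {w : E3 → ℂ} (hw : w.HasTemperateGrowth) (φ f : L2) :
    TemperedDistribution.smulLeftCLM ℂ w (φ : 𝓢'(E3, ℂ)) = (f : 𝓢'(E3, ℂ)) ↔
      (f : E3 → ℂ) =ᵐ[volume] fun ξ => w ξ * φ ξ := by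
  have hl : LocallyIntegrable (fun ξ => w ξ * φ ξ) := by
    have := (locallyIntegrable_coeFn φ).smul_continuous hw.1.continuous
    simpa [smul_eq_mul, mul_comm] using this
  have key : ∀ u : 𝓢(E3, ℂ), TemperedDistribution.smulLeftCLM ℂ w (φ : 𝓢'(E3, ℂ)) u =
      ∫ x, u x * (w x * φ x) := by
    intro u
    rw [TemperedDistribution.smulLeftCLM_apply_apply, Lp.toTemperedDistribution_apply]
    congr 1
    funext x
    rw [SchwartzMap.smulLeftCLM_apply_apply hw]
    simp only [smul_eq_mul]
    ring
  constructor
  · intro h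
    refine ae_eq_of_schwartz (locallyIntegrable_coeFn f) hl fun u => ?_
    rw [← key u, h, Lp.toTemperedDistribution_apply]
    rfl
  · intro h
    ext u
    rw [key u, Lp.toTemperedDistribution_apply]
    refine integral_congr_ae ?_
    filter_upwards [h] with x hx
    rw [hx, smul_eq_mul]

theorem continuous_fourier {f : E3 → ℂ} (hf : Integrable f) : Continuous (𝓕 f) :=
  VectorFourier.fourierIntegral_continuous Real.continuous_fourierChar continuous_inner hf

theorem integral_schwartz_fourier_mul {f : E3 → ℂ} (hf : Integrable f) (u : 𝓢(E3, ℂ)) :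
    ∫ x, (𝓕 u : 𝓢(E3, ℂ)) x * f x = ∫ x, u x * 𝓕 f x := by
  rw [SchwartzMap.fourier_coe]
  simpa [flip_innerₗ] using! VectorFourier.integral_fourierIntegral_smul_eq_flip (L := innerₗ E3)
    Real.continuous_fourierChar continuous_inner u.integrable hf

/-- On `L¹ ∩ L²` the Fourier transform of `L²` is given by the Fourier integral. -/
theorem fourier_toLp_ae_eq {f : E3 → ℂ} (hf : Integrable f) (hf2 : MemLp f 2) :
    (𝓕 (hf2.toLp f) : L2) =ᵐ[volume] 𝓕 f := by
  refine ae_eq_of_schwartz (locallyIntegrable_coeFn _) (continuous_fourier hf).locallyIntegrable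
    fun u => ?_
  have h1 := congrArg (fun D : 𝓢'(E3, ℂ) => D u)
    (Lp.fourier_toTemperedDistribution_eq (hf2.toLp f))
  simp only [TemperedDistribution.fourier_apply, Lp.toTemperedDistribution_apply,
    smul_eq_mul] at h1
  rw [← h1, ← integral_schwartz_fourier_mul hf]
  refine integral_congr_ae ?_
  filter_upwards [hf2.coeFn_toLp] with x hx
  rw [hx]

theorem integral_schwartz_fourierInv_mul {f : E3 → ℂ} (hf : Integrable f) (u : 𝓢(E3, ℂ)) :
    ∫ x, (𝓕⁻ u : 𝓢(E3, ℂ)) x * f x = ∫ x, u x * 𝓕⁻ f x := by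
  have h1 := integral_schwartz_fourier_mul hf (𝓕⁻ (𝓕⁻ u))
  rw [FourierTransform.fourier_fourierInv_eq] at h1
  rw [h1, ← integral_neg_eq_self]
  refine integral_congr_ae (Filter.Eventually.of_forall fun x => ?_)
  simp only
  rw [Real.fourierInv_eq_fourier_neg f x, SchwartzMap.fourierInv_coe,
    Real.fourierInv_eq_fourier_neg, neg_neg]
  rw [← SchwartzMap.fourier_coe, FourierTransform.fourier_fourierInv_eq]

theorem continuous_fourierInv {f : E3 → ℂ} (hf : Integrable f) : Continuous (𝓕⁻ f) := by
  have : 𝓕⁻ f = fun x => 𝓕 f (-x) := funext fun x => Real.fourierInv_eq_fourier_neg f x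
  rw [this]
  exact (continuous_fourier hf).comp continuous_neg

/-- A function with integrable Fourier transform is continuous, and its value at the origin is
the integral of its Fourier transform. -/
theorem hasValueAtZero_of_integrable {F : L2} (h : Integrable (𝓕 F : L2)) :
    HasValueAtZero F (∫ ξ, (𝓕 F : L2) ξ) := by
  refine ⟨𝓕⁻ ((𝓕 F : L2) : E3 → ℂ), continuous_fourierInv h, ?_, ?_⟩
  · refine ae_eq_of_schwartz (locallyIntegrable_coeFn _)
      (continuous_fourierInv h).locallyIntegrable fun u => ?_
    have h1 := congrArg (fun D : 𝓢'(E3, ℂ) => D u)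
      (Lp.fourierInv_toTemperedDistribution_eq (𝓕 F : L2))
    rw [FourierTransform.fourierInv_fourier_eq] at h1
    simp only [TemperedDistribution.fourierInv_apply, Lp.toTemperedDistribution_apply,
      smul_eq_mul] at h1
    rw [← h1, integral_schwartz_fourierInv_mul h]
  · rw [Real.fourierInv_eq]
    simp

theorem fourier_greenL2 {μ : ℝ} (hμ : 0 < μ) :
    (𝓕 (greenL2 hμ) : L2) =ᵐ[volume] fun ξ => (((symbol μ ξ)⁻¹ : ℝ) : ℂ) := by
  filter_upwards [fourier_toLp_ae_eq (integrable_green hμ) (memLp_green hμ)] with ξ hξ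
  rw [← fourier_green hμ ξ, ← hξ]
  rfl

theorem inner_eq_integral_fourier (f g : L2) :
    inner ℂ f g = ∫ ξ, (starRingEnd ℂ) ((𝓕 f : L2) ξ) * (𝓕 g : L2) ξ := by
  rw [← Lp.inner_fourier_eq, L2.inner_def]
  exact integral_congr_ae (.of_forall fun ξ => RCLike.inner_apply' _ _)

theorem inner_greenL2_left {μ : ℝ} (hμ : 0 < μ) (h : L2) :
    inner ℂ (greenL2 hμ) h = ∫ ξ, (((symbol μ ξ)⁻¹ : ℝ) : ℂ) * (𝓕 h : L2) ξ := by
  rw [inner_eq_integral_fourier]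
  refine integral_congr_ae ?_
  filter_upwards [fourier_greenL2 hμ] with ξ hξ
  rw [hξ, Complex.conj_ofReal]

theorem enorm_inner_greenL2_le {μ : ℝ} (hμ : 0 < μ) (h : L2) :
    ‖inner ℂ (greenL2 hμ) h‖ₑ ≤
      ∫⁻ ξ, ‖(𝓕 h : L2) ξ‖ₑ * ENNReal.ofReal (symbol μ ξ)⁻¹ := by
  rw [inner_greenL2_left]
  refine (enorm_integral_le_lintegral_enorm _).trans (le_of_eq (lintegral_congr fun ξ => ?_))
  rw [enorm_mul, mul_comm, ← ofReal_norm (((symbol μ ξ)⁻¹ : ℝ) : ℂ), Complex.norm_real,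
    Real.norm_of_nonneg (by have := symbol_pos hμ ξ; positivity)]

theorem inner_greenL2_greenL2 {μ ν : ℝ} (hμ : 0 < μ) (hν : 0 < ν) :
    inner ℂ (greenL2 hμ) (greenL2 hν) = (((4 * Real.pi * (√μ + √ν))⁻¹ : ℝ) : ℂ) := by
  have hs : 0 < √μ + √ν := by positivity
  let k : ℝ → ℝ := fun ρ => Real.exp (-(√μ * ρ)) / (4 * Real.pi * ρ) *
    (Real.exp (-(√ν * ρ)) / (4 * Real.pi * ρ))
  have h1 : inner ℂ (greenL2 hμ) (greenL2 hν) = ((∫ x : E3, k ‖x‖ : ℝ) : ℂ) := by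
    rw [L2.inner_def, ← integral_complex_ofReal]
    refine integral_congr_ae ?_
    filter_upwards [(memLp_green hμ).coeFn_toLp, (memLp_green hν).coeFn_toLp] with x hx hx'
    rw [greenL2, greenL2, hx, hx', RCLike.inner_apply', green, green]
    rw [Complex.conj_ofReal, ← Complex.ofReal_mul]
  rw [h1, integral_fun_norm_addHaar (volume : Measure E3) k]
  congr 1
  have h2 : ∫ ρ in Set.Ioi (0 : ℝ), ρ ^ (Module.finrank ℝ E3 - 1) • k ρ =
      ((4 * Real.pi) ^ 2)⁻¹ * (√μ + √ν)⁻¹ := by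
    have h3 : ∀ ρ ∈ Set.Ioi (0 : ℝ), ρ ^ (Module.finrank ℝ E3 - 1) • k ρ =
        ((4 * Real.pi) ^ 2)⁻¹ * Real.exp (-(√μ + √ν) * ρ) := by
      intro ρ hρ
      have h0 : ρ ≠ 0 := ne_of_gt hρ
      have hpi := Real.pi_ne_zero
      simp only [k, finrank_euclideanSpace, Fintype.card_fin, smul_eq_mul]
      rw [show -(√μ + √ν) * ρ = -(√μ * ρ) + -(√ν * ρ) by ring, Real.exp_add]
      field_simp
    rw [setIntegral_congr_fun measurableSet_Ioi h3, integral_const_mul,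
      integral_exp_mul_Ioi (by linarith) 0, mul_zero, Real.exp_zero, neg_div_neg_eq, one_div]
  have hv : (volume : Measure E3).real (Metric.ball 0 1) = Real.pi * 4 / 3 := by
    rw [measureReal_def, EuclideanSpace.volume_ball_fin_three]
    rw [ENNReal.ofReal_one]
    simp
    positivity
  rw [h2, hv, finrank_euclideanSpace, Fintype.card_fin, nsmul_eq_mul, smul_eq_mul]
  have hpi := Real.pi_ne_zero
  field_simp
  norm_num

theorem norm_greenL2_sq {μ : ℝ} (hμ : 0 < μ) : ‖greenL2 hμ‖ ^ 2 = (8 * Real.pi * √μ)⁻¹ := by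
  have h := inner_greenL2_greenL2 hμ hμ
  rw [inner_self_eq_norm_sq_to_K] at h
  have h2 : ‖greenL2 hμ‖ ^ 2 = (4 * Real.pi * (√μ + √μ))⁻¹ := by
    apply Complex.ofReal_injective
    rw [← h]
    push_cast
    rfl
  rw [h2]
  congr 1
  ring

/-! ### Sobolev norms on the Fourier side -/

/-- The square of the `H^s` norm computed with the symbol `lam + |p|²`, as an extended number. -/
def sobolevSq (lam s : ℝ) (F : L2) : ENNReal :=
  ∫⁻ ξ, ‖(𝓕 F : L2) ξ‖ₑ ^ 2 * ENNReal.ofReal (symbol lam ξ ^ s)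

theorem eLpNorm_two_sq (f : E3 → ℂ) : eLpNorm f 2 volume ^ 2 = ∫⁻ ξ, ‖f ξ‖ₑ ^ 2 := by
  rw [eLpNorm_eq_lintegral_rpow_enorm_toReal two_ne_zero ENNReal.ofNat_ne_top,
    ← ENNReal.rpow_natCast, ← ENNReal.rpow_mul]
  simp

theorem measurable_coeFn (f : L2) : Measurable (f : E3 → ℂ) := (Lp.stronglyMeasurable f).measurable

@[fun_prop]
theorem measurable_enorm_coeFn (f : L2) : Measurable fun ξ => ‖f ξ‖ₑ :=
  (measurable_coeFn f).enorm

theorem lintegral_enorm_sq (f : L2) : ∫⁻ ξ, ‖f ξ‖ₑ ^ 2 = ENNReal.ofReal (‖f‖ ^ 2) := by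
  rw [← eLpNorm_two_sq, ← Lp.enorm_def, ENNReal.ofReal_pow (norm_nonneg _), ofReal_norm]

theorem lintegral_enorm_fourier_sq (f : L2) :
    ∫⁻ ξ, ‖(𝓕 f : L2) ξ‖ₑ ^ 2 = ENNReal.ofReal (‖f‖ ^ 2) := by
  rw [lintegral_enorm_sq, Lp.norm_fourier_eq]

theorem lintegral_mul_ofReal_rpow_le {p q : E3 → ℝ} {s C : ℝ} (hs : 0 ≤ s) (hC : 0 ≤ C)
    (hp : ∀ ξ, 0 ≤ p ξ) (hq : ∀ ξ, 0 ≤ q ξ) (h : ∀ ξ, p ξ ≤ C * q ξ) (f : E3 → ENNReal) :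
    ∫⁻ ξ, f ξ * ENNReal.ofReal (p ξ ^ s) ≤
      ENNReal.ofReal (C ^ s) * ∫⁻ ξ, f ξ * ENNReal.ofReal (q ξ ^ s) := by
  rw [← lintegral_const_mul' _ _ ENNReal.ofReal_ne_top]
  refine lintegral_mono fun ξ => ?_
  rw [mul_left_comm, ← ENNReal.ofReal_mul (by positivity), ← Real.mul_rpow hC (hq ξ)]
  gcongr
  · exact hp ξ
  · exact h ξ

theorem symbol_le_mul {lam μ : ℝ} (hlam : 0 < lam) (hμ : 0 < μ) (ξ : E3) :
    symbol lam ξ ≤ max 1 (lam / μ) * symbol μ ξ := by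
  have h1 : 1 ≤ max 1 (lam / μ) := le_max_left _ _
  have h2 : lam ≤ max 1 (lam / μ) * μ := by
    calc lam = lam / μ * μ := by field_simp
      _ ≤ _ := by gcongr; exact le_max_right _ _
  unfold symbol
  nlinarith [mul_le_mul_of_nonneg_right h1 (sq_nonneg (2 * Real.pi * ‖ξ‖))]

theorem sobolevSq_le {lam μ s : ℝ} (hlam : 0 < lam) (hμ : 0 < μ) (hs : 0 ≤ s) (F : L2) :
    sobolevSq lam s F ≤ ENNReal.ofReal (max 1 (lam / μ) ^ s) * sobolevSq μ s F :=
  lintegral_mul_ofReal_rpow_le hs (le_trans zero_le_one (le_max_left _ _))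
    (fun ξ => (symbol_pos hlam ξ).le) (fun ξ => (symbol_pos hμ ξ).le) (symbol_le_mul hlam hμ) _

theorem enorm_ofReal_rpow_mul_sq {p s : ℝ} (hp : 0 ≤ p) (z : ℂ) :
    ‖((p ^ (s / 2) : ℝ) : ℂ) * z‖ₑ ^ 2 = ‖z‖ₑ ^ 2 * ENNReal.ofReal (p ^ s) := by
  rw [enorm_mul, mul_pow, mul_comm, ← ofReal_norm ((p ^ (s / 2) : ℝ) : ℂ), Complex.norm_real,
    Real.norm_of_nonneg (by positivity), ← ENNReal.ofReal_pow (by positivity),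
    ← Real.rpow_mul_natCast hp]
  congr 3
  push_cast
  ring

theorem memHs_iff {lam s : ℝ} (hlam : 0 < lam) (hs : 0 ≤ s) (F : L2) :
    MemHs s F ↔ sobolevSq lam s F ≠ ⊤ := by
  have hw : (fun ξ : E3 => (((1 + ‖ξ‖ ^ 2) ^ (s / 2) : ℝ) : ℂ)).HasTemperateGrowth := by fun_prop
  rw [MemHs, TemperedDistribution.memSobolev_iff_exists_smulLeftCLM_fourier,
    Lp.fourier_toTemperedDistribution_eq]
  simp_rw [smulLeftCLM_eq_iff hw]
  set w : E3 → ℂ := fun ξ => (((1 + ‖ξ‖ ^ 2) ^ (s / 2) : ℝ) : ℂ) * (𝓕 F : L2) ξ with hwdef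
  have hmeas : AEStronglyMeasurable w volume := by
    refine AEStronglyMeasurable.mul ?_ (Lp.aestronglyMeasurable _)
    exact hw.1.continuous.aestronglyMeasurable
  have h1 : (∃ f : L2, (f : E3 → ℂ) =ᵐ[volume] w) ↔ MemLp w 2 volume :=
    ⟨fun ⟨f, hf⟩ => (memLp_congr_ae hf).1 (Lp.memLp f), fun h => ⟨h.toLp w, h.coeFn_toLp⟩⟩
  have h2 : MemLp w 2 volume ↔
      ∫⁻ ξ, ‖(𝓕 F : L2) ξ‖ₑ ^ 2 * ENNReal.ofReal ((1 + ‖ξ‖ ^ 2) ^ s) ≠ ⊤ := by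
    have h3 : ∫⁻ ξ, ‖(𝓕 F : L2) ξ‖ₑ ^ 2 * ENNReal.ofReal ((1 + ‖ξ‖ ^ 2) ^ s) =
        eLpNorm w 2 volume ^ 2 := by
      rw [eLpNorm_two_sq]
      exact lintegral_congr fun ξ => (enorm_ofReal_rpow_mul_sq (by positivity) _).symm
    rw [h3, MemLp, ← lt_top_iff_ne_top, ENNReal.pow_lt_top_iff]
    simp [hmeas]
  rw [h1, h2]
  have hpi : 1 ≤ (2 * Real.pi) ^ 2 := by nlinarith [Real.pi_gt_three]
  constructor
  · intro h
    have h4 : ∀ ξ : E3, symbol lam ξ ≤ (lam + (2 * Real.pi) ^ 2) * (1 + ‖ξ‖ ^ 2) := fun ξ => by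
      unfold symbol
      nlinarith [mul_nonneg hlam.le (sq_nonneg ‖ξ‖)]
    exact ne_top_of_le_ne_top (ENNReal.mul_ne_top ENNReal.ofReal_ne_top h)
      (lintegral_mul_ofReal_rpow_le hs (by positivity) (fun ξ => (symbol_pos hlam ξ).le)
        (fun ξ => by positivity) h4 _)
  · intro h
    have h4 : ∀ ξ : E3, 1 + ‖ξ‖ ^ 2 ≤ max 1 (1 / lam) * symbol lam ξ := fun ξ => by
      refine le_trans ?_ (symbol_le_mul one_pos hlam ξ)
      unfold symbol
      nlinarith [mul_le_mul_of_nonneg_right hpi (sq_nonneg ‖ξ‖)]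
    exact ne_top_of_le_ne_top (ENNReal.mul_ne_top ENNReal.ofReal_ne_top h)
      (lintegral_mul_ofReal_rpow_le hs (le_trans zero_le_one (le_max_left _ _))
        (fun ξ => by positivity) (fun ξ => (symbol_pos hlam ξ).le) h4 _)

theorem ofReal_sobolevNorm_sq {s : ℝ} {F : L2} (hF : sobolevSq 1 s F ≠ ⊤) :
    ENNReal.ofReal (sobolevNorm s F ^ 2) = sobolevSq 1 s F := by
  have h1 : eLpNorm (fun ξ : E3 => (((1 + (2 * Real.pi * ‖ξ‖) ^ 2) ^ (s / 2) : ℝ) : ℂ) *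
      (𝓕 F : L2) ξ) 2 volume ^ 2 = sobolevSq 1 s F := by
    rw [eLpNorm_two_sq]
    exact lintegral_congr fun ξ => enorm_ofReal_rpow_mul_sq (by positivity) _
  have h2 : eLpNorm (fun ξ : E3 => (((1 + (2 * Real.pi * ‖ξ‖) ^ 2) ^ (s / 2) : ℝ) : ℂ) *
      (𝓕 F : L2) ξ) 2 volume ≠ ⊤ := fun h => hF (by rw [← h1, h]; rfl)
  rw [sobolevNorm, ENNReal.ofReal_pow ENNReal.toReal_nonneg, ENNReal.ofReal_toReal h2, h1]

/-! ### The free resolvent and its powers -/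

theorem fourier_sub_ae (f g : L2) :
    (𝓕 (f - g) : L2) =ᵐ[volume] fun ξ => (𝓕 f : L2) ξ - (𝓕 g : L2) ξ := by
  have h : (𝓕 (f - g) : L2) = 𝓕 f - 𝓕 g := (Lp.fourierTransformₗᵢ E3 ℂ).map_sub f g
  rw [h]
  exact Lp.coeFn_sub _ _

theorem fourier_smul_ae (c : ℂ) (f : L2) :
    (𝓕 (c • f) : L2) =ᵐ[volume] fun ξ => c * (𝓕 f : L2) ξ := by
  have h : (𝓕 (c • f) : L2) = c • 𝓕 f := (Lp.fourierTransformₗᵢ E3 ℂ).map_smul c f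
  rw [h]
  exact Lp.coeFn_smul _ _

/-- The Fourier multiplier with symbol `w ∈ L^∞`. -/
def fourierMul (w : Lp ℂ ⊤ (volume : Measure E3)) : L2 →L[ℂ] L2 :=
  ((Lp.fourierTransformₗᵢ E3 ℂ).symm.toContinuousLinearEquiv : L2 →L[ℂ] L2) ∘L
    ((ContinuousLinearMap.mul ℂ ℂ).holderL volume ⊤ 2 2 w) ∘L
      ((Lp.fourierTransformₗᵢ E3 ℂ).toContinuousLinearEquiv : L2 →L[ℂ] L2)

theorem fourier_fourierMul (w : Lp ℂ ⊤ (volume : Measure E3)) (h : L2) :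
    (𝓕 (fourierMul w h) : L2) =ᵐ[volume] fun ξ => w ξ * (𝓕 h : L2) ξ := by
  have h1 : (𝓕 (fourierMul w h) : L2) =
      (ContinuousLinearMap.mul ℂ ℂ).holder 2 w (𝓕 h : L2) :=
    (Lp.fourierTransformₗᵢ E3 ℂ).apply_symm_apply _
  rw [h1]
  exact (ContinuousLinearMap.mul ℂ ℂ).coeFn_holder w _

theorem memLp_symbol_rpow_neg {lam r : ℝ} (hlam : 0 < lam) (hr : 0 ≤ r) :
    MemLp (fun ξ : E3 => ((symbol lam ξ ^ (-r) : ℝ) : ℂ)) ⊤ (volume : Measure E3) := by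
  refine memLp_top_of_bound (Measurable.aestronglyMeasurable (by fun_prop)) (lam ^ (-r))
    (.of_forall fun ξ => ?_)
  have := symbol_pos hlam ξ
  rw [Complex.norm_real, Real.norm_of_nonneg (by positivity)]
  exact Real.rpow_le_rpow_of_nonpos hlam (le_symbol lam ξ) (by linarith)

/-- The power `(-Δ + lam) ^ (-r)` of the free resolvent. -/
def freePow {lam r : ℝ} (hlam : 0 < lam) (hr : 0 ≤ r) : L2 →L[ℂ] L2 :=
  fourierMul ((memLp_symbol_rpow_neg hlam hr).toLp _)

theorem fourier_freePow {lam r : ℝ} (hlam : 0 < lam) (hr : 0 ≤ r) (h : L2) :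
    (𝓕 (freePow hlam hr h) : L2) =ᵐ[volume]
      fun ξ => ((symbol lam ξ ^ (-r) : ℝ) : ℂ) * (𝓕 h : L2) ξ := by
  filter_upwards [fourier_fourierMul ((memLp_symbol_rpow_neg hlam hr).toLp _) h,
    (memLp_symbol_rpow_neg hlam hr).coeFn_toLp] with ξ h1 h2
  rw [freePow, h1, h2]

theorem isSelfAdjoint_freePow {lam r : ℝ} (hlam : 0 < lam) (hr : 0 ≤ r) :
    IsSelfAdjoint (freePow hlam hr) := by
  rw [ContinuousLinearMap.isSelfAdjoint_iff_isSymmetric]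
  intro f g
  simp only [ContinuousLinearMap.coe_coe]
  rw [inner_eq_integral_fourier, inner_eq_integral_fourier]
  refine integral_congr_ae ?_
  filter_upwards [fourier_freePow hlam hr f, fourier_freePow hlam hr g] with ξ h1 h2
  rw [h1, h2, map_mul, Complex.conj_ofReal]
  ring

theorem injective_freePow {lam r : ℝ} (hlam : 0 < lam) (hr : 0 ≤ r) :
    Function.Injective (freePow hlam hr) := by
  intro f g hfg
  apply ext_fourier
  filter_upwards [fourier_freePow hlam hr f, fourier_freePow hlam hr g] with ξ h1 h2
  rw [hfg, h2] at h1
  have hp := symbol_pos hlam ξ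
  have h3 : ((symbol lam ξ ^ (-r) : ℝ) : ℂ) ≠ 0 := Complex.ofReal_ne_zero.2 (by positivity)
  exact (mul_left_cancel₀ h3 h1).symm

theorem sobolevSq_freePow {lam r : ℝ} (hlam : 0 < lam) (hr : 0 ≤ r) (h : L2) :
    sobolevSq lam (2 * r) (freePow hlam hr h) = ENNReal.ofReal (‖h‖ ^ 2) := by
  rw [← lintegral_enorm_fourier_sq, sobolevSq]
  refine lintegral_congr_ae ?_
  filter_upwards [fourier_freePow hlam hr h] with ξ h1
  have hp := symbol_pos hlam ξ
  rw [h1, show -r = (-2 * r) / 2 by ring, enorm_ofReal_rpow_mul_sq hp.le, mul_assoc,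
    ← ENNReal.ofReal_mul (by positivity), ← Real.rpow_add hp]
  simp

/-- The free resolvent `(-Δ + lam)⁻¹`. -/
def freeResolvent {lam : ℝ} (hlam : 0 < lam) : L2 →L[ℂ] L2 := freePow hlam zero_le_one

theorem fourier_freeResolvent {lam : ℝ} (hlam : 0 < lam) (h : L2) :
    (𝓕 (freeResolvent hlam h) : L2) =ᵐ[volume]
      fun ξ => (((symbol lam ξ)⁻¹ : ℝ) : ℂ) * (𝓕 h : L2) ξ := by
  filter_upwards [fourier_freePow hlam zero_le_one h] with ξ h1
  rw [freeResolvent, h1, Real.rpow_neg_one]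

theorem freeResolvent_eq_mul {lam : ℝ} (hlam : 0 < lam) :
    freeResolvent hlam = freePow hlam (r := 1 / 2) (by norm_num) *
      freePow hlam (r := 1 / 2) (by norm_num) := by
  ext1 h
  rw [mul_apply_eq_comp]
  apply ext_fourier
  filter_upwards [fourier_freeResolvent hlam h,
    fourier_freePow hlam (r := 1 / 2) (by norm_num) (freePow hlam (r := 1 / 2) (by norm_num) h),
    fourier_freePow hlam (r := 1 / 2) (by norm_num) h] with ξ h1 h2 h3
  rw [h1, h2, h3, ← mul_assoc, ← Complex.ofReal_mul, ← Real.rpow_add (symbol_pos hlam ξ)]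
  norm_num [Real.rpow_neg_one]

theorem inv_symbol_sub {lam t : ℝ} (hlam : 0 < lam) (hlam' : 0 < lam + t) (ξ : E3) :
    (((symbol lam ξ)⁻¹ : ℝ) : ℂ) - (((symbol (lam + t) ξ)⁻¹ : ℝ) : ℂ) =
      t * ((((symbol lam ξ)⁻¹ : ℝ) : ℂ) * (((symbol (lam + t) ξ)⁻¹ : ℝ) : ℂ)) := by
  have h1 := (symbol_pos hlam ξ).ne'
  have h2 := (symbol_pos hlam' ξ).ne'
  rw [← Complex.ofReal_sub, ← Complex.ofReal_mul, ← Complex.ofReal_mul]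
  congr 1
  rw [inv_sub_inv h1 h2, symbol_add] at *
  field_simp
  ring

theorem smul_freeResolvent_freeResolvent {lam t : ℝ} (hlam : 0 < lam) (hlam' : 0 < lam + t)
    (h : L2) : (t : ℂ) • freeResolvent hlam (freeResolvent hlam' h) =
      freeResolvent hlam h - freeResolvent hlam' h := by
  apply ext_fourier
  filter_upwards [fourier_smul_ae t (freeResolvent hlam (freeResolvent hlam' h)),
    fourier_sub_ae (freeResolvent hlam h) (freeResolvent hlam' h), fourier_freeResolvent hlam h,
    fourier_freeResolvent hlam' h, fourier_freeResolvent hlam (freeResolvent hlam' h)]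
    with ξ h1 h2 h3 h4 h5
  rw [h1, h2, h5, h3, h4, ← sub_mul, inv_symbol_sub hlam hlam' ξ]
  ring

theorem smul_freeResolvent_greenL2 {lam t : ℝ} (hlam : 0 < lam) (hlam' : 0 < lam + t) :
    (t : ℂ) • freeResolvent hlam (greenL2 hlam') = greenL2 hlam - greenL2 hlam' := by
  apply ext_fourier
  filter_upwards [fourier_smul_ae t (freeResolvent hlam (greenL2 hlam')),
    fourier_sub_ae (greenL2 hlam) (greenL2 hlam'), fourier_greenL2 hlam,
    fourier_greenL2 hlam', fourier_freeResolvent hlam (greenL2 hlam')] with ξ h1 h2 h3 h4 h5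
  rw [h1, h2, h5, h3, h4, inv_symbol_sub hlam hlam' ξ]

theorem smul_freeResolvent_greenL2' {lam t : ℝ} (hlam : 0 < lam) (hlam' : 0 < lam + t) :
    (t : ℂ) • freeResolvent hlam' (greenL2 hlam) = greenL2 hlam - greenL2 hlam' := by
  apply ext_fourier
  filter_upwards [fourier_smul_ae t (freeResolvent hlam' (greenL2 hlam)),
    fourier_sub_ae (greenL2 hlam) (greenL2 hlam'), fourier_greenL2 hlam,
    fourier_greenL2 hlam', fourier_freeResolvent hlam' (greenL2 hlam)] with ξ h1 h2 h3 h4 h5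
  rw [h1, h2, h5, h3, h4, inv_symbol_sub hlam hlam' ξ, mul_comm (((symbol lam ξ)⁻¹ : ℝ) : ℂ)]

/-! ### The resolvent of the point interaction -/

/-- The real number underlying `coef α lam`. -/
def realCoef (α lam : ℝ) : ℝ := α + √lam / (4 * Real.pi)

theorem coef_eq (α lam : ℝ) : coef α lam = (realCoef α lam : ℂ) := rfl

theorem realCoef_pos {α lam : ℝ} (hα : 0 ≤ α) (hlam : 0 < lam) : 0 < realCoef α lam := by
  unfold realCoef; positivity

theorem coef_ne_zero {α lam : ℝ} (hα : 0 ≤ α) (hlam : 0 < lam) : coef α lam ≠ 0 :=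
  Complex.ofReal_ne_zero.2 (realCoef_pos hα hlam).ne'

theorem mul_inner_greenL2_greenL2 (α : ℝ) {lam t : ℝ} (hlam : 0 < lam) (hlam' : 0 < lam + t) :
    (t : ℂ) * inner ℂ (greenL2 hlam) (greenL2 hlam') = coef α (lam + t) - coef α lam := by
  rw [inner_greenL2_greenL2, coef_eq, coef_eq, ← Complex.ofReal_mul, ← Complex.ofReal_sub]
  congr 1
  have h1 : 0 < √lam + √(lam + t) := by positivity
  have h2 : t = (√(lam + t) - √lam) * (√lam + √(lam + t)) := by
    ring_nf
    rw [Real.sq_sqrt hlam.le, Real.sq_sqrt hlam'.le]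
    ring
  have hpi := Real.pi_ne_zero
  unfold realCoef
  nth_rewrite 1 [h2]
  field_simp
  ring

/-- The resolvent `(-Δ_α + lam)⁻¹`, which is a rank-one perturbation of the free one. -/
def ptResolvent (α : ℝ) {lam : ℝ} (hlam : 0 < lam) : L2 →L[ℂ] L2 :=
  freeResolvent hlam +
    (coef α lam)⁻¹ • InnerProductSpace.rankOne ℂ (greenL2 hlam) (greenL2 hlam)

theorem ptResolvent_apply (α : ℝ) {lam : ℝ} (hlam : 0 < lam) (h : L2) :
    ptResolvent α hlam h = freeResolvent hlam h +
      ((coef α lam)⁻¹ * inner ℂ (greenL2 hlam) h) • greenL2 hlam := by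
  simp [ptResolvent, smul_smul]

theorem ptResolvent_nonneg {α lam : ℝ} (hα : 0 ≤ α) (hlam : 0 < lam) :
    0 ≤ ptResolvent α hlam := by
  have hD := isSelfAdjoint_freePow hlam (r := 1 / 2) (by norm_num)
  have h1 := star_mul_self_nonneg (freePow hlam (r := 1 / 2) (by norm_num))
  rw [hD.star_eq, ← freeResolvent_eq_mul] at h1
  refine add_nonneg h1 ((ContinuousLinearMap.nonneg_iff_isPositive _).2 ?_)
  refine (InnerProductSpace.isPositive_rankOne_self _).smul_of_nonneg ?_
  rw [coef_eq, ← Complex.ofReal_inv]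
  exact Complex.zero_le_real.2 (inv_nonneg.2 (realCoef_pos hα hlam).le)

theorem injective_ptResolvent {α lam : ℝ} (hα : 0 ≤ α) (hlam : 0 < lam) :
    Function.Injective (ptResolvent α hlam) := by
  rw [injective_iff_map_eq_zero]
  intro h hh
  set D := freePow hlam (r := 1 / 2) (by norm_num) with hD
  have h1 : inner ℂ h (ptResolvent α hlam h) = ((‖D h‖ ^ 2 +
      (realCoef α lam)⁻¹ * ‖inner ℂ (greenL2 hlam) h‖ ^ 2 : ℝ) : ℂ) := by
    rw [ptResolvent_apply, freeResolvent_eq_mul, mul_apply_eq_comp, inner_add_right,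
      inner_smul_right, ← hD]
    have h2 : inner ℂ h (D (D h)) = ((‖D h‖ ^ 2 : ℝ) : ℂ) := by
      rw [← ContinuousLinearMap.adjoint_inner_left, (isSelfAdjoint_freePow hlam _).adjoint_eq,
        inner_self_eq_norm_sq_to_K]
      push_cast
      rfl
    rw [h2, mul_assoc, ← inner_conj_symm h (greenL2 hlam), Complex.mul_conj,
      Complex.normSq_eq_norm_sq, coef_eq]
    push_cast
    rfl
  rw [hh, inner_zero_right] at h1
  have h2 := (Complex.ofReal_eq_zero.1 h1.symm)
  have h3 : 0 ≤ (realCoef α lam)⁻¹ * ‖inner ℂ (greenL2 hlam) h‖ ^ 2 := by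
    have := realCoef_pos hα hlam
    positivity
  have h4 : D h = 0 := by
    have : ‖D h‖ ^ 2 = 0 := le_antisymm (by linarith) (sq_nonneg _)
    simpa using this
  exact (injective_iff_map_eq_zero D).1 (injective_freePow hlam _) h h4

/-- The first resolvent identity for `-Δ_α`. -/
theorem ptResolvent_add_smul {α lam t : ℝ} (hα : 0 ≤ α) (hlam : 0 < lam) (hlam' : 0 < lam + t) :
    ptResolvent α hlam' + (t : ℂ) • (ptResolvent α hlam * ptResolvent α hlam') =
      ptResolvent α hlam := by
  ext1 h
  have ha := coef_ne_zero hα hlam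
  have ha' := coef_ne_zero hα hlam'
  have e1 := smul_freeResolvent_freeResolvent hlam hlam' h
  have e2 := smul_freeResolvent_greenL2 hlam hlam'
  have e3 : (t : ℂ) * inner ℂ (greenL2 hlam) (freeResolvent hlam' h) =
      inner ℂ (greenL2 hlam) h - inner ℂ (greenL2 hlam') h := by
    rw [← ContinuousLinearMap.adjoint_inner_left, freeResolvent,
      (isSelfAdjoint_freePow hlam' _).adjoint_eq, ← inner_sub_left,
      ← smul_freeResolvent_greenL2' hlam hlam', inner_smul_left, Complex.conj_ofReal]
    rfl
  have e4 := mul_inner_greenL2_greenL2 α hlam hlam'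
  simp only [add_apply, smul_apply, mul_apply_eq_comp, ptResolvent_apply, map_add, map_smul,
    smul_add]
  set G := greenL2 hlam
  set G' := greenL2 hlam'
  set a := coef α lam
  set a' := coef α (lam + t)
  set R := freeResolvent hlam
  set R' := freeResolvent hlam'
  have e5 : (t : ℂ) • R (R' h) + (t : ℂ) • (a⁻¹ * inner ℂ G (R' h)) • G +
      ((t : ℂ) • (a'⁻¹ * inner ℂ G' h) • R G' +
        (t : ℂ) • (a'⁻¹ * inner ℂ G' h) • (a⁻¹ * inner ℂ G G') • G) =
      (t : ℂ) • R (R' h) + (a'⁻¹ * inner ℂ G' h) • ((t : ℂ) • R G') +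
      (a⁻¹ * ((t : ℂ) * inner ℂ G (R' h) +
        a'⁻¹ * inner ℂ G' h * ((t : ℂ) * inner ℂ G G'))) • G := by
    module
  rw [e5, e1, e2, e3, e4]
  have e6 : a⁻¹ * (inner ℂ G h - inner ℂ G' h + a'⁻¹ * inner ℂ G' h * (a' - a)) =
      a⁻¹ * inner ℂ G h - a'⁻¹ * inner ℂ G' h := by
    field_simp
    ring
  rw [e6]
  module

theorem ptResolvent_eq_resolventOf {α lam t : ℝ} (hα : 0 ≤ α) (hlam : 0 < lam) (ht : 0 ≤ t)
    (hlam' : 0 < lam + t) : ptResolvent α hlam' = resolventOf (ptResolvent α hlam) t :=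
  eq_resolventOf (ptResolvent_nonneg hα hlam) ht (ptResolvent_add_smul hα hlam hlam')

/-! ### The graph of the point interaction -/

/-- A relation `g` whose points are the pairs `(R h, h - R h)` is, for injective `R`, the graph of
the operator `R⁻¹ - 1`. -/
theorem isInvAddOne_toLinearPMap {H : Type*} [NormedAddCommGroup H] [InnerProductSpace ℂ H]
    {g : Submodule ℂ (H × H)} {R : H →L[ℂ] H} (hinj : Function.Injective R)
    (hg : ∀ p : H × H, p ∈ g ↔ p.1 = R (p.2 + p.1)) : IsInvAddOne g.toLinearPMap R := by
  have h0 : ∀ x ∈ g, x.1 = 0 → x.2 = 0 := by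
    intro x hx hx1
    have h1 := (hg x).1 hx
    rw [hx1, add_zero] at h1
    exact (injective_iff_map_eq_zero R).1 hinj _ h1.symm
  have hgr := Submodule.toLinearPMap_graph_eq g h0
  constructor
  · intro h
    have h1 : (R h, h - R h) ∈ g.toLinearPMap.graph := by
      rw [hgr, hg]
      simp
    rw [LinearPMap.mem_graph_iff] at h1
    obtain ⟨y, hy1, hy2⟩ := h1
    simp only at hy1 hy2
    have hd : R h ∈ g.toLinearPMap.domain := hy1 ▸ y.2
    refine ⟨hd, ?_⟩
    have : (⟨R h, hd⟩ : g.toLinearPMap.domain) = y := Subtype.ext hy1.symm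
    rw [this, hy2]
    abel
  · intro y
    have h1 : ((y : H), g.toLinearPMap y) ∈ g := by
      have h2 := LinearPMap.mem_graph g.toLinearPMap y
      rwa [hgr] at h2
    exact ((hg _).1 h1).symm

theorem laplacian_iff_fourier (F m : L2) :
    (m : 𝓢'(E3, ℂ)) = -Δ (F : 𝓢'(E3, ℂ)) + (F : 𝓢'(E3, ℂ)) ↔
      (𝓕 m : L2) =ᵐ[volume] fun ξ => ((symbol 1 ξ : ℝ) : ℂ) * (𝓕 F : L2) ξ := by
  have hw1 : (fun ξ : E3 => ((‖ξ‖ ^ 2 : ℝ) : ℂ)).HasTemperateGrowth := by fun_prop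
  have hw2 : (((2 * Real.pi) ^ 2 : ℝ) : ℂ) • (fun ξ : E3 => ((‖ξ‖ ^ 2 : ℝ) : ℂ))
      |>.HasTemperateGrowth := by
    fun_prop
  have hw : (fun ξ : E3 => ((symbol 1 ξ : ℝ) : ℂ)) =
      (((2 * Real.pi) ^ 2 : ℝ) : ℂ) • (fun ξ : E3 => ((‖ξ‖ ^ 2 : ℝ) : ℂ)) +
        fun _ : E3 => (1 : ℂ) := by
    funext ξ
    simp only [symbol, Pi.add_apply, Pi.smul_apply, smul_eq_mul]
    push_cast
    ring
  have hwt : (fun ξ : E3 => ((symbol 1 ξ : ℝ) : ℂ)).HasTemperateGrowth := by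
    rw [hw]
    exact hw2.add (by fun_prop)
  rw [← smulLeftCLM_eq_iff hwt, ← Lp.fourier_toTemperedDistribution_eq,
    ← Lp.fourier_toTemperedDistribution_eq, hw,
    TemperedDistribution.smulLeftCLM_add hw2 (by fun_prop),
    TemperedDistribution.smulLeftCLM_smul hw1]
  have h1 : 𝓕 (-Δ (F : 𝓢'(E3, ℂ)) + (F : 𝓢'(E3, ℂ))) =
      ((((2 * Real.pi) ^ 2 : ℝ) : ℂ) • TemperedDistribution.smulLeftCLM ℂ
        (fun ξ : E3 => ((‖ξ‖ ^ 2 : ℝ) : ℂ)) + TemperedDistribution.smulLeftCLM ℂ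
        fun _ : E3 => (1 : ℂ)) (𝓕 (F : 𝓢'(E3, ℂ))) := by
    rw [FourierTransform.fourier_add, add_apply, smul_apply,
      TemperedDistribution.smulLeftCLM_const, one_smul,
      TemperedDistribution.laplacian_eq_fourierMultiplierCLM, neg_smul, neg_neg,
      ← Complex.coe_smul, FourierTransform.fourier_smul,
      TemperedDistribution.fourierMultiplierCLM_apply, FourierTransform.fourier_fourierInv_eq]
  rw [← h1]
  constructor
  · intro h
    rw [h]
  · intro h
    have h2 := congrArg 𝓕⁻ h
    rw [FourierTransform.fourierInv_fourier_eq, FourierTransform.fourierInv_fourier_eq] at h2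
    exact h2.symm

theorem laplacian_iff (F m : L2) :
    (m : 𝓢'(E3, ℂ)) = -Δ (F : 𝓢'(E3, ℂ)) + (F : 𝓢'(E3, ℂ)) ↔ F = freeResolvent one_pos m := by
  rw [laplacian_iff_fourier]
  have h0 : ∀ ξ : E3, ((symbol 1 ξ : ℝ) : ℂ) ≠ 0 := fun ξ =>
    Complex.ofReal_ne_zero.2 (symbol_pos one_pos ξ).ne'
  constructor
  · intro h
    apply ext_fourier
    filter_upwards [h, fourier_freeResolvent one_pos m] with ξ h1 h2
    rw [h2, h1, Complex.ofReal_inv, inv_mul_cancel_left₀ (h0 ξ)]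
  · rintro rfl
    filter_upwards [fourier_freeResolvent one_pos m] with ξ h2
    rw [h2, Complex.ofReal_inv, mul_inv_cancel_left₀ (h0 ξ)]

theorem hasValueAtZero_freeResolvent {lam : ℝ} (hlam : 0 < lam) (m : L2) :
    HasValueAtZero (freeResolvent hlam m) (inner ℂ (greenL2 hlam) m) := by
  have h1 := fourier_freeResolvent hlam m
  have hG : MemLp (fun ξ : E3 => (((symbol lam ξ)⁻¹ : ℝ) : ℂ)) 2 (volume : Measure E3) :=
    (memLp_congr_ae (fourier_greenL2 hlam)).1 (Lp.memLp _)
  have h2 : Integrable (𝓕 (freeResolvent hlam m) : L2) :=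
    ((hG.integrable_mul (Lp.memLp (𝓕 m : L2)))).congr h1.symm
  rw [inner_greenL2_left, ← integral_congr_ae h1]
  exact hasValueAtZero_of_integrable h2

/-- The domain condition of the point interaction is Krein's formula for its resolvent at `1`, as
`F = (-Δ + 1)⁻¹ m` has the value `⟪G_1, m⟫` at the origin. -/
theorem mem_graphPointInteraction_iff (α : ℝ) (p : L2 × L2) :
    p ∈ graphPointInteraction α ↔ p.1 = ptResolvent α one_pos (p.2 + p.1) := by
  have hv := hasValueAtZero_freeResolvent one_pos (p.2 + p.1)
  rw [ptResolvent_apply, mul_comm, ← div_eq_mul_inv]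
  constructor
  · rintro ⟨F, v, -, hFv, h1, h2⟩
    rw [laplacian_iff] at h2
    rw [h2] at hFv
    rwa [h2, hFv.unique hv] at h1
  · intro h
    refine ⟨_, _, ?_, hv, h, (laplacian_iff _ _).2 rfl⟩
    rw [memHs_iff one_pos zero_le_two]
    have := sobolevSq_freePow one_pos zero_le_one (p.2 + p.1)
    rw [mul_one] at this
    rw [freeResolvent, this]
    exact ENNReal.ofReal_ne_top

theorem isInvAddOne_pointInteraction {α : ℝ} (hα : 0 ≤ α) :
    IsInvAddOne (pointInteraction α) (ptResolvent α one_pos) :=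
  isInvAddOne_toLinearPMap (injective_ptResolvent hα one_pos) (mem_graphPointInteraction_iff α)

theorem isInvAddOne_shift_pointInteraction {α lam : ℝ} (hα : 0 ≤ α) (hlam : 0 < lam) :
    IsInvAddOne (shift (pointInteraction α) lam) (resolventOf (ptResolvent α hlam) 1) := by
  have h1 := isInvAddOne_shift (ptResolvent_nonneg hα one_pos)
    (isInvAddOne_pointInteraction hα) hlam.le
  rw [← ptResolvent_eq_resolventOf hα one_pos hlam.le (by positivity)] at h1
  rw [← ptResolvent_eq_resolventOf hα hlam zero_le_one (by positivity)]
  simpa only [add_comm lam] using h1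

theorem domain_shiftedPow {α lam : ℝ} (hα : 0 ≤ α) (hlam : 0 < lam) {s : ℝ} (hs : 0 ≤ s) :
    (shiftedPow α lam s).domain =
      LinearMap.range (opPow (ptResolvent α hlam) (s / 2)).toLinearMap := by
  rw [shiftedPow, domain_nonnegPow (isInvAddOne_shift_pointInteraction hα hlam),
    range_resolventOf_rpow (ptResolvent_nonneg hα hlam) zero_le_one (by positivity)]

theorem singularSpace_eq {α lam : ℝ} (hα : 0 ≤ α) (hlam : 0 < lam) {s : ℝ} (hs : 0 ≤ s) :
    singularSpace α s = LinearMap.range (opPow (ptResolvent α hlam) (s / 2)).toLinearMap := by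
  have h1 := isInvAddOne_shift_pointInteraction hα hlam
  have h2 := isInvAddOne_shift (ptResolvent_nonneg hα one_pos)
    (isInvAddOne_pointInteraction hα) hlam.le
  have h3 : resolventOf (ptResolvent α hlam) 1 = resolventOf (ptResolvent α one_pos) lam :=
    (invAddOne_eq h1).symm.trans (invAddOne_eq h2)
  rw [singularSpace, domain_nonnegPow (isInvAddOne_pointInteraction hα),
    ← range_resolventOf_rpow (ptResolvent_nonneg hα hlam) zero_le_one (by positivity), h3,
    range_resolventOf_rpow (ptResolvent_nonneg hα one_pos) hlam.le (by positivity)]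

theorem singularNorm_eq {α lam : ℝ} (hα : 0 ≤ α) (hlam : 0 < lam) {s : ℝ} (hs : 0 < s) (h : L2) :
    singularNorm α lam s (opPow (ptResolvent α hlam) (s / 2) h) = ‖h‖ := by
  have hd : opPow (ptResolvent α hlam) (s / 2) h ∈ (shiftedPow α lam s).domain := by
    rw [domain_shiftedPow hα hlam hs.le]
    exact ⟨h, rfl⟩
  rw [singularNorm, dif_pos hd]
  congr 1
  exact nonnegPow_apply (ptResolvent_nonneg hα hlam) (injective_ptResolvent hα hlam)
    (isInvAddOne_shift_pointInteraction hα hlam) (by positivity) h hd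

/-! ### Pairings with the Green functions -/

/-- The Fourier-side majorant `∫ f / (symbol lam + t)` of a pairing with `G_{lam+t}`. -/
def greenIntegral (lam : ℝ) (f : E3 → ENNReal) (t : ℝ) : ENNReal :=
  ∫⁻ ξ, f ξ * ENNReal.ofReal (symbol lam ξ + t)⁻¹

theorem measurable_greenIntegral (lam : ℝ) {f : E3 → ENNReal} (hf : Measurable f) :
    Measurable (greenIntegral lam f) := by
  have h : Measurable (Function.uncurry fun (t : ℝ) (ξ : E3) =>
      f ξ * ENNReal.ofReal (symbol lam ξ + t)⁻¹) := by
    unfold Function.uncurry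
    fun_prop
  exact h.lintegral_prod_right

theorem ofReal_rpow_mul_ofReal_rpow {t : ℝ} (ht : 0 < t) (a b : ℝ) :
    ENNReal.ofReal (t ^ a) * ENNReal.ofReal (t ^ b) = ENNReal.ofReal (t ^ (a + b)) := by
  rw [← ENNReal.ofReal_mul (by positivity), ← Real.rpow_add ht]

theorem lintegral_rpow_mul_greenIntegral_sq_le {σ : ℝ} (hσ : -(3 / 2) < σ) (hσ' : σ < 1 / 2)
    {lam : ℝ} (hlam : 0 < lam) {f : E3 → ENNReal} (hf : Measurable f) :
    ∫⁻ t in Set.Ioi (0 : ℝ), (ENNReal.ofReal (t ^ (-(1 / 4) - σ / 2)) * greenIntegral lam f t) ^ 2 ≤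
      pairingConst σ * ∫⁻ ξ, f ξ ^ 2 * ENNReal.ofReal (symbol lam ξ ^ (-σ)) := by
  refine le_trans (le_of_eq ?_) (lintegral_rpow_mul_lintegral_sq_le hσ hσ' hlam hf)
  refine setLIntegral_congr_fun measurableSet_Ioi fun t ht => ?_
  rw [mul_pow, sq (ENNReal.ofReal _), ofReal_rpow_mul_ofReal_rpow ht, greenIntegral]
  congr 3
  ring

theorem lintegral_greenIntegral_mul_sq_le {σ : ℝ} (hσ : -(3 / 2) < σ) (hσ' : σ < 1 / 2)
    {lam : ℝ} (hlam : 0 < lam) {f g : E3 → ENNReal} (hf : Measurable f) (hg : Measurable g) :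
    (∫⁻ t in Set.Ioi (0 : ℝ), ENNReal.ofReal (t ^ (-(1 / 2) - σ / 2)) *
        (greenIntegral lam f t * greenIntegral lam g t)) ^ 2 ≤
      (pairingConst 0 * ∫⁻ ξ, f ξ ^ 2) *
        (pairingConst σ * ∫⁻ ξ, g ξ ^ 2 * ENNReal.ofReal (symbol lam ξ ^ (-σ))) := by
  have h1 : ∫⁻ t in Set.Ioi (0 : ℝ), ENNReal.ofReal (t ^ (-(1 / 2) - σ / 2)) *
        (greenIntegral lam f t * greenIntegral lam g t) =
      ∫⁻ t in Set.Ioi (0 : ℝ), (ENNReal.ofReal (t ^ (-(1 / 4) - (0 : ℝ) / 2)) *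
        greenIntegral lam f t) * (ENNReal.ofReal (t ^ (-(1 / 4) - σ / 2)) *
          greenIntegral lam g t) := by
    refine setLIntegral_congr_fun measurableSet_Ioi fun t ht => ?_
    rw [mul_mul_mul_comm, ofReal_rpow_mul_ofReal_rpow ht]
    congr 3
    ring
  have hmf := measurable_greenIntegral lam hf
  have hmg := measurable_greenIntegral lam hg
  rw [h1]
  refine (lintegral_mul_sq_le (by fun_prop) (by fun_prop)).trans (mul_le_mul' ?_ ?_)
  · have := lintegral_rpow_mul_greenIntegral_sq_le (σ := 0) (by norm_num) (by norm_num) hlam hf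
    simpa using this
  · exact lintegral_rpow_mul_greenIntegral_sq_le hσ hσ' hlam hg

theorem enorm_ofReal_of_nonneg {x : ℝ} (hx : 0 ≤ x) : ‖(x : ℂ)‖ₑ = ENNReal.ofReal x := by
  rw [← ofReal_norm, Complex.norm_real, Real.norm_of_nonneg hx]

theorem enorm_inner_greenL2_le_greenIntegral {lam t : ℝ} (hlt : 0 < lam + t) (h : L2) :
    ‖inner ℂ (greenL2 hlt) h‖ₑ ≤ greenIntegral lam (fun ξ => ‖(𝓕 h : L2) ξ‖ₑ) t := by
  refine (enorm_inner_greenL2_le hlt h).trans (le_of_eq ?_)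
  simp only [greenIntegral, symbol_add]

theorem enorm_inner_freeResolvent_le {lam t : ℝ} (hlt : 0 < lam + t) (φ h : L2) :
    ‖inner ℂ φ (freeResolvent hlt h)‖ₑ ≤
      greenIntegral lam (fun ξ => ‖(𝓕 φ : L2) ξ‖ₑ * ‖(𝓕 h : L2) ξ‖ₑ) t := by
  rw [inner_eq_integral_fourier]
  refine (enorm_integral_le_lintegral_enorm _).trans (le_of_eq (lintegral_congr_ae ?_))
  filter_upwards [fourier_freeResolvent hlt h] with ξ h1
  have := symbol_pos hlt ξ
  rw [h1, enorm_mul, enorm_mul, RCLike.enorm_conj, enorm_ofReal_of_nonneg (by positivity),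
    symbol_add]
  ring

theorem enorm_inner_greenL2_sub_le {lam t : ℝ} (hlam : 0 < lam) (ht : 0 < t) (hlt : 0 < lam + t)
    (φ : L2) :
    ‖inner ℂ φ (greenL2 hlt - greenL2 hlam)‖ₑ ≤ ENNReal.ofReal t *
      greenIntegral lam (fun ξ => ‖(𝓕 φ : L2) ξ‖ₑ * ENNReal.ofReal (symbol lam ξ)⁻¹) t := by
  have h1 := enorm_inner_freeResolvent_le hlt φ (greenL2 hlam)
  have h2 := smul_freeResolvent_greenL2' hlam hlt
  rw [← neg_sub, ← h2, inner_neg_right, enorm_neg, inner_smul_right, enorm_mul,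
    enorm_ofReal_of_nonneg ht.le]
  gcongr
  refine h1.trans (le_of_eq (lintegral_congr_ae ?_))
  filter_upwards [fourier_greenL2 hlam] with ξ h3
  have := symbol_pos hlam ξ
  rw [h3, enorm_ofReal_of_nonneg (by positivity)]

theorem enorm_inv_coef_le {α μ : ℝ} (hα : 0 ≤ α) (hμ : 0 < μ) :
    ‖(coef α μ)⁻¹‖ₑ ≤ ENNReal.ofReal (4 * Real.pi * μ ^ (-(1 / 2) : ℝ)) := by
  have hc := realCoef_pos hα hμ
  rw [coef_eq, ← Complex.ofReal_inv, enorm_ofReal_of_nonneg (by positivity)]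
  apply ENNReal.ofReal_le_ofReal
  rw [Real.rpow_neg hμ.le, ← Real.sqrt_eq_rpow, ← div_eq_mul_inv, inv_eq_one_div,
    div_le_div_iff₀ hc (by positivity)]
  have hpi := Real.pi_pos
  unfold realCoef
  have : 4 * Real.pi * (α + √μ / (4 * Real.pi)) = 4 * Real.pi * α + √μ := by field_simp
  rw [this, one_mul]
  have : 0 ≤ 4 * Real.pi * α := by positivity
  linarith

theorem enorm_inv_coef_add_le {α lam t : ℝ} (hα : 0 ≤ α) (hlam : 0 < lam) (ht : 0 < t) :
    ‖(coef α (lam + t))⁻¹‖ₑ ≤ ENNReal.ofReal (4 * Real.pi * t ^ (-(1 / 2) : ℝ)) := by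
  refine (enorm_inv_coef_le hα (by positivity)).trans (ENNReal.ofReal_le_ofReal ?_)
  have := Real.pi_pos
  gcongr ?_ * ?_
  exact Real.rpow_le_rpow_of_nonpos ht (by linarith) (by norm_num)

/-! ### Regularity of the domain of a fractional power -/

theorem lintegral_fourier_sq_mul_symbol_rpow_neg {lam r : ℝ} (hlam : 0 < lam) (hr : 0 ≤ r)
    (φ : L2) : ∫⁻ ξ, ‖(𝓕 φ : L2) ξ‖ₑ ^ 2 * ENNReal.ofReal (symbol lam ξ ^ (-(2 * r))) =
      ENNReal.ofReal (‖freePow hlam hr φ‖ ^ 2) := by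
  rw [← lintegral_enorm_fourier_sq]
  refine lintegral_congr_ae ?_
  filter_upwards [fourier_freePow hlam hr φ] with ξ h1
  rw [h1, show -r = (-(2 * r)) / 2 by ring, enorm_ofReal_rpow_mul_sq (symbol_pos hlam ξ).le]

theorem lintegral_rpow_mul_greenIntegral_mul_le {lam r : ℝ} (hlam : 0 < lam) (hr0 : 0 < r)
    (hr1 : r < 1) (φ h : L2) :
    ∫⁻ t in Set.Ioi (0 : ℝ), ENNReal.ofReal (t ^ (-r)) *
        greenIntegral lam (fun ξ => ‖(𝓕 φ : L2) ξ‖ₑ * ‖(𝓕 h : L2) ξ‖ₑ) t ≤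
      ENNReal.ofReal (powerIntegral (-r) 1 * (‖h‖ * ‖freePow hlam hr0.le φ‖)) := by
  have hc := powerIntegral_pos (β := -r) (γ := 1) (by linarith) (by linarith)
  have h1 := lintegral_lintegral_rpow_symbol (β := -r) (γ := 1) (by linarith) (by linarith) hlam
    (f := fun ξ => ‖(𝓕 φ : L2) ξ‖ₑ * ‖(𝓕 h : L2) ξ‖ₑ) (by fun_prop)
  simp only [Real.rpow_neg_one] at h1
  simp only [greenIntegral]
  rw [h1, ENNReal.ofReal_mul hc.le]
  gcongr
  rw [← ENNReal.pow_le_pow_left_iff two_ne_zero]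
  have h2 : ∫⁻ ξ, ‖(𝓕 φ : L2) ξ‖ₑ * ‖(𝓕 h : L2) ξ‖ₑ * ENNReal.ofReal (symbol lam ξ ^ (-r + 1 - 1)) =
      ∫⁻ ξ, (‖(𝓕 φ : L2) ξ‖ₑ * ENNReal.ofReal (symbol lam ξ ^ (-r))) * ‖(𝓕 h : L2) ξ‖ₑ := by
    refine lintegral_congr fun ξ => ?_
    rw [show -r + 1 - 1 = -r by ring]
    ring
  rw [h2]
  refine (lintegral_mul_sq_le (by fun_prop) (by fun_prop)).trans (le_of_eq ?_)
  rw [lintegral_enorm_fourier_sq]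
  have h3 : ∫⁻ ξ, (‖(𝓕 φ : L2) ξ‖ₑ * ENNReal.ofReal (symbol lam ξ ^ (-r))) ^ 2 =
      ENNReal.ofReal (‖freePow hlam hr0.le φ‖ ^ 2) := by
    rw [← lintegral_fourier_sq_mul_symbol_rpow_neg]
    refine lintegral_congr fun ξ => ?_
    rw [mul_pow, sq (ENNReal.ofReal _), ofReal_rpow_mul_ofReal_rpow (symbol_pos hlam ξ)]
    congr 3
    ring
  rw [h3, ← ENNReal.ofReal_mul (by positivity), ← ENNReal.ofReal_pow (by positivity)]
  congr 1
  ring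

/-- The constant of `exists_freePow_eq`. -/
def regularityConst (r σ : ℝ) : ℝ :=
  (powerIntegral (-r) 1 + 4 * Real.pi * √(pairingConst 0 * pairingConst σ).toReal) /
    powerIntegral (-r) 1

theorem regularityConst_nonneg {r : ℝ} (hr0 : 0 < r) (hr1 : r < 1) (σ : ℝ) :
    0 ≤ regularityConst r σ := by
  have hc := powerIntegral_pos (β := -r) (γ := 1) (by linarith) (by linarith)
  have := Real.pi_pos
  unfold regularityConst
  positivity

/-- A vector `g` is in `H^{2r}` if its pairings with all `φ` are dominated by the two integrals
that come from the free part and from the rank-one part of the resolvent. -/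
theorem exists_freePow_eq {lam r σ : ℝ} (hlam : 0 < lam) (hr0 : 0 < r) (hr1 : r < 1)
    (hσ : -(3 / 2) < σ) (hσ' : σ < 1 / 2) (h g : L2) (f : L2 → E3 → ENNReal)
    (hf : ∀ φ, Measurable (f φ))
    (hfφ : ∀ φ, ∫⁻ ξ, f φ ξ ^ 2 * ENNReal.ofReal (symbol lam ξ ^ (-σ)) =
      ENNReal.ofReal (‖freePow hlam hr0.le φ‖ ^ 2))
    (hb : ∀ φ, ‖(powerIntegral (-r) 1 : ℂ) * inner ℂ φ g‖ₑ ≤ ∫⁻ t in Set.Ioi (0 : ℝ),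
      (ENNReal.ofReal (t ^ (-r)) *
        greenIntegral lam (fun ξ => ‖(𝓕 φ : L2) ξ‖ₑ * ‖(𝓕 h : L2) ξ‖ₑ) t +
      ENNReal.ofReal (4 * Real.pi) * (ENNReal.ofReal (t ^ (-(1 / 2) - σ / 2)) *
        (greenIntegral lam (fun ξ => ‖(𝓕 h : L2) ξ‖ₑ) t * greenIntegral lam (f φ) t)))) :
    ∃ k, freePow hlam hr0.le k = g ∧ ‖k‖ ≤ regularityConst r σ * ‖h‖ := by
  have hc := powerIntegral_pos (β := -r) (γ := 1) (by linarith) (by linarith)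
  have hpi := Real.pi_pos
  refine exists_eq_of_norm_inner_le (isSelfAdjoint_freePow hlam hr0.le)
    (injective_freePow hlam hr0.le) (mul_nonneg (regularityConst_nonneg hr0 hr1 σ)
      (norm_nonneg h)) fun φ => ?_
  set D := freePow hlam hr0.le
  set K := (pairingConst 0 * pairingConst σ) with hK
  have hKtop : K ≠ ⊤ := ENNReal.mul_ne_top (pairingConst_ne_top 0) (pairingConst_ne_top σ)
  have hmh := measurable_greenIntegral lam (f := fun ξ => ‖(𝓕 h : L2) ξ‖ₑ) (by fun_prop)
  have hmf := measurable_greenIntegral lam (hf φ)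
  have hm := measurable_greenIntegral lam
    (f := fun ξ => ‖(𝓕 φ : L2) ξ‖ₑ * ‖(𝓕 h : L2) ξ‖ₑ) (by fun_prop)
  have h2 : ∫⁻ t in Set.Ioi (0 : ℝ), ENNReal.ofReal (t ^ (-(1 / 2) - σ / 2)) *
        (greenIntegral lam (fun ξ => ‖(𝓕 h : L2) ξ‖ₑ) t * greenIntegral lam (f φ) t) ≤
      ENNReal.ofReal (√K.toReal * (‖h‖ * ‖D φ‖)) := by
    rw [← ENNReal.pow_le_pow_left_iff two_ne_zero]
    refine (lintegral_greenIntegral_mul_sq_le hσ hσ' hlam (by fun_prop) (hf φ)).trans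
      (le_of_eq ?_)
    rw [hfφ φ, lintegral_enorm_fourier_sq, ← ENNReal.ofReal_pow (by positivity), mul_pow,
      Real.sq_sqrt ENNReal.toReal_nonneg, ENNReal.ofReal_mul ENNReal.toReal_nonneg,
      ENNReal.ofReal_toReal hKtop, mul_pow, ENNReal.ofReal_mul (by positivity), hK]
    ring
  have h3 : ‖(powerIntegral (-r) 1 : ℂ) * inner ℂ φ g‖ₑ ≤ ENNReal.ofReal
      (powerIntegral (-r) 1 * (‖h‖ * ‖D φ‖) + 4 * Real.pi * (√K.toReal * (‖h‖ * ‖D φ‖))) := by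
    refine (hb φ).trans ?_
    rw [lintegral_add_left (by fun_prop), lintegral_const_mul' _ _ ENNReal.ofReal_ne_top,
      ENNReal.ofReal_add (by positivity) (by positivity),
      ENNReal.ofReal_mul (p := 4 * Real.pi) (by positivity)]
    exact add_le_add (lintegral_rpow_mul_greenIntegral_mul_le hlam hr0 hr1 φ h)
      (mul_le_mul_right h2 _)
  rw [← ofReal_norm, ENNReal.ofReal_le_ofReal_iff (by positivity), norm_mul, Complex.norm_real,
    Real.norm_of_nonneg hc.le] at h3
  rw [regularityConst, div_mul_eq_mul_div, div_mul_eq_mul_div, le_div_iff₀ hc]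
  linarith

theorem enorm_rpow_mul_inner_le {α lam t r : ℝ} (ht : 0 < t)
    (hlt : 0 < lam + t) (φ h u : L2) :
    ‖((t ^ (-r) : ℝ) : ℂ) * (inner ℂ φ (freeResolvent hlt h) +
      (coef α (lam + t))⁻¹ * inner ℂ (greenL2 hlt) h * inner ℂ φ u)‖ₑ ≤
    ENNReal.ofReal (t ^ (-r)) *
        greenIntegral lam (fun ξ => ‖(𝓕 φ : L2) ξ‖ₑ * ‖(𝓕 h : L2) ξ‖ₑ) t +
      ENNReal.ofReal (t ^ (-r)) * (‖(coef α (lam + t))⁻¹‖ₑ *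
        greenIntegral lam (fun ξ => ‖(𝓕 h : L2) ξ‖ₑ) t * ‖inner ℂ φ u‖ₑ) := by
  rw [enorm_mul, enorm_ofReal_of_nonneg (by positivity), ← mul_add]
  gcongr
  refine (enorm_add_le _ _).trans ?_
  rw [enorm_mul, enorm_mul]
  gcongr
  · exact enorm_inner_freeResolvent_le hlt φ h
  · exact enorm_inner_greenL2_le_greenIntegral hlt h

/-- For `s = 2r < 1/2`, the domain of `(-Δ_α + lam)^{s/2}` is contained in `H^s`. -/
theorem exists_freePow_eq_opPow {lam r : ℝ} (hlam : 0 < lam) (hr0 : 0 < r) (hr1 : r < 1 / 4)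
    {α : ℝ} (hα : 0 ≤ α) (h : L2) :
    ∃ k, freePow hlam hr0.le k = opPow (ptResolvent α hlam) r h ∧
      ‖k‖ ≤ regularityConst r (2 * r) * ‖h‖ := by
  have hT := ptResolvent_nonneg hα hlam
  refine exists_freePow_eq hlam hr0 (by linarith) (by linarith) (by linarith) h _
    (fun φ ξ => ‖(𝓕 φ : L2) ξ‖ₑ) (fun φ => by fun_prop)
    (fun φ => lintegral_fourier_sq_mul_symbol_rpow_neg hlam hr0.le φ) fun φ => ?_
  rw [← (integral_rpow_mul_inner_resolventOf hT hr0 (by linarith) φ h).2]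
  refine (enorm_integral_le_lintegral_enorm _).trans
    (setLIntegral_mono' measurableSet_Ioi fun t ht => ?_)
  have ht0 : (0 : ℝ) < t := ht
  have hlt : 0 < lam + t := by positivity
  rw [← ptResolvent_eq_resolventOf hα hlam ht0.le hlt, ptResolvent_apply, inner_add_right,
    inner_smul_right]
  refine (enorm_rpow_mul_inner_le ht0 hlt φ h _).trans ?_
  refine add_le_add le_rfl ?_
  have h1 : ‖inner ℂ φ (greenL2 hlt)‖ₑ ≤ greenIntegral lam (fun ξ => ‖(𝓕 φ : L2) ξ‖ₑ) t := by
    rw [← ofReal_norm, norm_inner_symm, ofReal_norm]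
    exact enorm_inner_greenL2_le_greenIntegral hlt φ
  calc _ ≤ ENNReal.ofReal (t ^ (-r)) * (ENNReal.ofReal (4 * Real.pi * t ^ (-(1 / 2) : ℝ)) *
        greenIntegral lam (fun ξ => ‖(𝓕 h : L2) ξ‖ₑ) t *
          greenIntegral lam (fun ξ => ‖(𝓕 φ : L2) ξ‖ₑ) t) := by
        gcongr
        exact enorm_inv_coef_add_le hα hlam ht0
    _ = _ := by
        rw [ENNReal.ofReal_mul (by positivity), show -(1 / 2) - 2 * r / 2 = -r + -(1 / 2) by ring,
          ← ofReal_rpow_mul_ofReal_rpow ht0]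
        ring

/-- Convergence of the integral of `t ^ (-r) a(t)⁻¹ ⟪G_{lam+t}, h⟫`, which gives the coefficient of
`G_lam` in `T ^ r h`. -/
theorem exists_lintegral_coef_greenIntegral_le {lam r : ℝ} (hlam : 0 < lam) (hr : 1 / 4 < r)
    (hr1 : r < 1) :
    ∃ C : ℝ, 0 ≤ C ∧ ∀ α : ℝ, 0 ≤ α → ∀ h : L2,
      ∫⁻ t in Set.Ioi (0 : ℝ), ENNReal.ofReal (t ^ (-r)) * (‖(coef α (lam + t))⁻¹‖ₑ *
        greenIntegral lam (fun ξ => ‖(𝓕 h : L2) ξ‖ₑ) t) ≤ ENNReal.ofReal (C * ‖h‖) := by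
  have hpi := Real.pi_pos
  -- any `σ` with `0 ≤ σ < 1/2` and `2r - 3/2 < σ < 2r - 1/2` will do
  set σ : ℝ := (2 * r - 1 / 2) / 3 with hσ
  set β : ℝ := -(2 * r) + 1 / 2 + σ with hβ
  have hc := powerIntegral_pos (β := β) (γ := 1) (by linarith) (by linarith)
  set K : ℝ := powerIntegral β 1 * lam ^ β * ((pairingConst σ).toReal * lam ^ (-σ)) with hK
  have hK0 : 0 ≤ K := by positivity
  refine ⟨4 * Real.pi * √K, by positivity, fun α hα h => ?_⟩
  set I := greenIntegral lam (fun ξ => ‖(𝓕 h : L2) ξ‖ₑ) with hI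
  have hm : Measurable I := measurable_greenIntegral lam (by fun_prop)
  have h1 : ∫⁻ t in Set.Ioi (0 : ℝ), (ENNReal.ofReal (t ^ (-r + 1 / 4 + σ / 2) *
      (lam + t) ^ (-(1 / 2) : ℝ))) * (ENNReal.ofReal (t ^ (-(1 / 4) - σ / 2)) * I t) ≤
      ENNReal.ofReal (√K * ‖h‖) := by
    rw [← ENNReal.pow_le_pow_left_iff two_ne_zero]
    refine (lintegral_mul_sq_le (by fun_prop) (by fun_prop)).trans ?_
    rw [← ENNReal.ofReal_pow (by positivity), mul_pow, Real.sq_sqrt hK0, hK, mul_assoc,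
      ENNReal.ofReal_mul (by positivity)]
    refine mul_le_mul' (le_of_eq ?_) ?_
    · have h2 := lintegral_rpow_mul_add_rpow (β := β) (γ := 1) (by linarith) (by linarith) hlam
      rw [show β + 1 - 1 = β by ring] at h2
      rw [← h2]
      refine setLIntegral_congr_fun measurableSet_Ioi fun t ht => ?_
      have ht0 : (0 : ℝ) < t := ht
      rw [← ENNReal.ofReal_pow (by positivity), mul_pow, ← Real.rpow_mul_natCast ht0.le,
        ← Real.rpow_mul_natCast (by positivity)]
      congr 3
      · push_cast; ring
      · norm_num
    · refine (lintegral_rpow_mul_greenIntegral_sq_le (by linarith) (by linarith) hlam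
        (by fun_prop)).trans ?_
      rw [mul_assoc, ENNReal.ofReal_mul ENNReal.toReal_nonneg,
        ENNReal.ofReal_toReal (pairingConst_ne_top σ), ENNReal.ofReal_mul (by positivity),
        ← lintegral_enorm_fourier_sq, ← lintegral_const_mul' _ _ ENNReal.ofReal_ne_top]
      refine mul_le_mul' le_rfl (lintegral_mono fun ξ => ?_)
      rw [mul_comm]
      gcongr ?_ * _
      exact ENNReal.ofReal_le_ofReal
        (Real.rpow_le_rpow_of_nonpos hlam (le_symbol lam ξ) (by linarith))
  rw [mul_assoc, ENNReal.ofReal_mul (by positivity)]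
  calc _ ≤ ∫⁻ t in Set.Ioi (0 : ℝ), ENNReal.ofReal (4 * Real.pi) *
        ((ENNReal.ofReal (t ^ (-r + 1 / 4 + σ / 2) * (lam + t) ^ (-(1 / 2) : ℝ))) *
          (ENNReal.ofReal (t ^ (-(1 / 4) - σ / 2)) * I t)) := by
        refine setLIntegral_mono' measurableSet_Ioi fun t ht => ?_
        have ht0 : (0 : ℝ) < t := ht
        refine (mul_le_mul_right (mul_le_mul_left
          (enorm_inv_coef_le hα (by positivity : 0 < lam + t)) _) _).trans (le_of_eq ?_)
        have h2 : ENNReal.ofReal (t ^ (-r)) = ENNReal.ofReal (t ^ (-r + 1 / 4 + σ / 2)) *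
            ENNReal.ofReal (t ^ (-(1 / 4) - σ / 2)) := by
          rw [ofReal_rpow_mul_ofReal_rpow ht0]
          ring_nf
        rw [ENNReal.ofReal_mul (p := 4 * Real.pi) (by positivity),
          ENNReal.ofReal_mul (p := t ^ (-r + 1 / 4 + σ / 2)) (by positivity), h2]
        ring
    _ ≤ _ := by
        rw [lintegral_const_mul' _ _ ENNReal.ofReal_ne_top]
        gcongr

theorem measurable_integral_symbol (lam : ℝ) (h : L2) :
    Measurable fun t : ℝ => ∫ ξ, (((symbol lam ξ + t)⁻¹ : ℝ) : ℂ) * (𝓕 h : L2) ξ := by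
  have hm : Measurable (Function.uncurry fun (t : ℝ) (ξ : E3) =>
      (((symbol lam ξ + t)⁻¹ : ℝ) : ℂ) * (𝓕 h : L2) ξ) := by
    have := measurable_coeFn (𝓕 h : L2)
    unfold Function.uncurry
    fun_prop
  exact (hm.stronglyMeasurable.integral_prod_right (ν := volume)).measurable

/-- For `s = 2r > 1/2`, every vector in the domain of `(-Δ_α + lam)^{s/2}` is the sum of an element
of `H^s` and of a multiple of `G_lam`. The coefficient of `G_lam` is obtained by replacing
`G_{lam+t}` by `G_lam` in `c T ^ r h = ∫ t ^ (-r) (-Δ_α + lam + t)⁻¹ h dt`. -/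
theorem exists_freePow_add_smul_eq_opPow {lam r : ℝ} (hlam : 0 < lam) (hr : 1 / 4 < r)
    (hr1 : r < 1) (hr0 : 0 ≤ r) :
    ∃ C : ℝ, 0 ≤ C ∧ ∀ α : ℝ, 0 ≤ α → ∀ h : L2, ∃ (k : L2) (q : ℂ),
      freePow hlam hr0 k + q • greenL2 hlam = opPow (ptResolvent α hlam) r h ∧
        ‖k‖ ≤ C * ‖h‖ ∧ ‖q‖ ≤ C * ‖h‖ := by
  have hrpos : 0 < r := by linarith
  have hc := powerIntegral_pos (β := -r) (γ := 1) (by linarith) (by linarith)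
  have hcC : (powerIntegral (-r) 1 : ℂ) ≠ 0 := Complex.ofReal_ne_zero.2 hc.ne'
  obtain ⟨C, hC, hCb⟩ := exists_lintegral_coef_greenIntegral_le hlam hr hr1
  refine ⟨max (regularityConst r (2 * r - 2)) (C / powerIntegral (-r) 1),
    le_trans (regularityConst_nonneg hrpos hr1 _) (le_max_left _ _), fun α hα h => ?_⟩
  have hT := ptResolvent_nonneg hα hlam
  let J : ℝ → ℂ := fun t => ∫ ξ, (((symbol lam ξ + t)⁻¹ : ℝ) : ℂ) * (𝓕 h : L2) ξ
  have hJ : ∀ t (hlt : 0 < lam + t), J t = inner ℂ (greenL2 hlt) h := fun t hlt => by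
    rw [inner_greenL2_left]
    simp only [J, symbol_add]
  let B : ℝ → ℂ := fun t => ((t ^ (-r) : ℝ) : ℂ) * ((coef α (lam + t))⁻¹ * J t)
  have hBle : ∫⁻ t in Set.Ioi (0 : ℝ), ‖B t‖ₑ ≤ ENNReal.ofReal (C * ‖h‖) := by
    refine le_trans (setLIntegral_mono' measurableSet_Ioi fun t ht => ?_) (hCb α hα h)
    have ht0 : (0 : ℝ) < t := ht
    have hlt : 0 < lam + t := by positivity
    simp only [B]
    rw [enorm_mul, enorm_mul, enorm_ofReal_of_nonneg (by positivity), hJ t hlt]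
    gcongr
    exact enorm_inner_greenL2_le_greenIntegral hlt h
  have hBm : Measurable B := by
    have := measurable_integral_symbol lam h
    have h2 : Measurable fun t : ℝ => coef α (lam + t) := by
      unfold coef; fun_prop
    simp only [B, J]
    fun_prop
  have hBi : IntegrableOn B (Set.Ioi 0) :=
    ⟨hBm.aestronglyMeasurable, hBle.trans_lt ENNReal.ofReal_lt_top⟩
  set q : ℂ := (powerIntegral (-r) 1 : ℂ)⁻¹ * ∫ t in Set.Ioi (0 : ℝ), B t with hq
  have hqle : ‖q‖ ≤ C / powerIntegral (-r) 1 * ‖h‖ := by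
    have h1 := (enorm_integral_le_lintegral_enorm B).trans hBle
    rw [← ofReal_norm, ENNReal.ofReal_le_ofReal_iff (by positivity)] at h1
    rw [hq, norm_mul, norm_inv, Complex.norm_real, Real.norm_of_nonneg hc.le, div_mul_eq_mul_div,
      div_eq_inv_mul]
    gcongr
  have key := exists_freePow_eq (σ := 2 * r - 2) hlam hrpos hr1 (by linarith) (by linarith) h
    (opPow (ptResolvent α hlam) r h - q • greenL2 hlam)
    (fun φ ξ => ‖(𝓕 φ : L2) ξ‖ₑ * ENNReal.ofReal (symbol lam ξ)⁻¹) (fun φ => by fun_prop)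
    (fun φ => ?_) (fun φ => ?_)
  · obtain ⟨k, hk1, hk2⟩ := key
    refine ⟨k, q, by rw [hk1]; abel, hk2.trans ?_, hqle.trans ?_⟩
    · gcongr; exact le_max_left _ _
    · gcongr; exact le_max_right _ _
  · rw [← lintegral_fourier_sq_mul_symbol_rpow_neg]
    refine lintegral_congr fun ξ => ?_
    have hp := symbol_pos hlam ξ
    rw [mul_pow, ← Real.rpow_neg_one, sq (ENNReal.ofReal _), ofReal_rpow_mul_ofReal_rpow hp,
      mul_assoc, ofReal_rpow_mul_ofReal_rpow hp]
    congr 3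
    ring
  · obtain ⟨h1, h2⟩ := integral_rpow_mul_inner_resolventOf hT hrpos hr1 φ h
    have h3 : (powerIntegral (-r) 1 : ℂ) * inner ℂ φ
        (opPow (ptResolvent α hlam) r h - q • greenL2 hlam) =
        ∫ t in Set.Ioi (0 : ℝ), (((t ^ (-r) : ℝ) : ℂ) *
          inner ℂ φ (resolventOf (ptResolvent α hlam) t h) - B t * inner ℂ φ (greenL2 hlam)) := by
      rw [integral_sub h1 (hBi.mul_const _), h2, integral_mul_const, inner_sub_right,
        inner_smul_right, hq, mul_sub, ← mul_assoc, mul_inv_cancel_left₀ hcC]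
    rw [h3]
    refine (enorm_integral_le_lintegral_enorm _).trans
      (setLIntegral_mono' measurableSet_Ioi fun t ht => ?_)
    have ht0 : (0 : ℝ) < t := ht
    have hlt : 0 < lam + t := by positivity
    have h4 : ((t ^ (-r) : ℝ) : ℂ) * inner ℂ φ (resolventOf (ptResolvent α hlam) t h) -
        B t * inner ℂ φ (greenL2 hlam) =
        ((t ^ (-r) : ℝ) : ℂ) * (inner ℂ φ (freeResolvent hlt h) +
          (coef α (lam + t))⁻¹ * inner ℂ (greenL2 hlt) h *
            inner ℂ φ (greenL2 hlt - greenL2 hlam)) := by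
      rw [← ptResolvent_eq_resolventOf hα hlam ht0.le hlt, ptResolvent_apply, inner_add_right,
        inner_smul_right, inner_sub_right]
      simp only [B]
      rw [hJ t hlt]
      ring
    rw [h4]
    refine (enorm_rpow_mul_inner_le ht0 hlt φ h _).trans ?_
    refine add_le_add le_rfl ?_
    calc _ ≤ ENNReal.ofReal (t ^ (-r)) * (ENNReal.ofReal (4 * Real.pi * t ^ (-(1 / 2) : ℝ)) *
          greenIntegral lam (fun ξ => ‖(𝓕 h : L2) ξ‖ₑ) t * (ENNReal.ofReal t *
            greenIntegral lam (fun ξ => ‖(𝓕 φ : L2) ξ‖ₑ * ENNReal.ofReal (symbol lam ξ)⁻¹) t)) := by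
          gcongr
          · exact enorm_inv_coef_add_le hα hlam ht0
          · exact enorm_inner_greenL2_sub_le hlam ht0 hlt φ
      _ = _ := by
          have h5 : ENNReal.ofReal t = ENNReal.ofReal (t ^ (1 : ℝ)) := by rw [Real.rpow_one]
          rw [ENNReal.ofReal_mul (by positivity), h5,
            show -(1 / 2) - (2 * r - 2) / 2 = -r + -(1 / 2) + 1 by ring,
            ← ofReal_rpow_mul_ofReal_rpow ht0, ← ofReal_rpow_mul_ofReal_rpow ht0]
          ring

/-! ### Membership in the domain of a fractional power -/

theorem inner_greenL2_comm {μ ν : ℝ} (hμ : 0 < μ) (hν : 0 < ν) :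
    inner ℂ (greenL2 hμ) (greenL2 hν) = inner ℂ (greenL2 hν) (greenL2 hμ) := by
  rw [inner_greenL2_greenL2, inner_greenL2_greenL2, add_comm]

/-- Krein's formula for `g - t (-Δ_α + lam + t)⁻¹ g` with `g = F + q G_lam`: only the coefficient of
`G_{lam+t}` involves `α`, and the contribution of `q` to it tends to `0` as `t → ∞`. -/
theorem sub_smul_ptResolvent {α lam t : ℝ} (hα : 0 ≤ α) (hlam : 0 < lam) (hlt : 0 < lam + t)
    (F : L2) (q : ℂ) :
    F + q • greenL2 hlam - (t : ℂ) • ptResolvent α hlt (F + q • greenL2 hlam) =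
      (F - (t : ℂ) • freeResolvent hlt F) + ((coef α (lam + t))⁻¹ *
        (q * coef α lam - t * inner ℂ (greenL2 hlt) F)) • greenL2 hlt := by
  have ha := coef_ne_zero hα hlt
  have e2 := smul_freeResolvent_greenL2' hlam hlt
  have e4 := mul_inner_greenL2_greenL2 α hlam hlt
  rw [inner_greenL2_comm] at e4
  rw [ptResolvent_apply, map_add, map_smul, inner_add_right, inner_smul_right]
  set G := greenL2 hlam
  set G' := greenL2 hlt
  set a := coef α lam
  set a' := coef α (lam + t)
  set R' := freeResolvent hlt
  have e5 : (t : ℂ) • (R' F + q • R' G + (a'⁻¹ * (inner ℂ G' F + q * inner ℂ G' G)) • G') =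
      (t : ℂ) • R' F + q • ((t : ℂ) • R' G) +
        (a'⁻¹ * (t * inner ℂ G' F + q * (t * inner ℂ G' G))) • G' := by
    module
  have e6 : a'⁻¹ * (t * inner ℂ G' F + q * (a' - a)) =
      q - a'⁻¹ * (q * a - t * inner ℂ G' F) := by
    field_simp
    ring
  rw [e5, e2, e4, e6]
  module

theorem enorm_greenL2_sq {μ : ℝ} (hμ : 0 < μ) :
    ‖greenL2 hμ‖ₑ ^ 2 = ENNReal.ofReal (8 * Real.pi * √μ)⁻¹ := by
  rw [← norm_greenL2_sq hμ, ← ofReal_norm, ENNReal.ofReal_pow (norm_nonneg _)]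

theorem enorm_sub_freeResolvent_sq {lam t : ℝ} (hlam : 0 < lam) (ht : 0 < t) (hlt : 0 < lam + t)
    (F : L2) : ‖F - (t : ℂ) • freeResolvent hlt F‖ₑ ^ 2 =
      ∫⁻ ξ, (‖(𝓕 F : L2) ξ‖ₑ ^ 2 * ENNReal.ofReal (symbol lam ξ ^ (2 : ℝ))) *
        ENNReal.ofReal ((symbol lam ξ + t) ^ (-2 : ℝ)) := by
  rw [← ofReal_norm, ← ENNReal.ofReal_pow (norm_nonneg _), ← lintegral_enorm_fourier_sq]
  refine lintegral_congr_ae ?_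
  filter_upwards [fourier_sub_ae F ((t : ℂ) • freeResolvent hlt F),
    fourier_smul_ae t (freeResolvent hlt F), fourier_freeResolvent hlt F] with ξ h1 h2 h3
  have hp := symbol_pos hlam ξ
  have hpt : 0 < symbol lam ξ + t := by positivity
  have h4 : (𝓕 F : L2) ξ - t * ((((symbol (lam + t) ξ)⁻¹ : ℝ) : ℂ) * (𝓕 F : L2) ξ) =
      ((symbol lam ξ * (symbol lam ξ + t)⁻¹ : ℝ) : ℂ) * (𝓕 F : L2) ξ := by
    rw [symbol_add]
    have : ((symbol lam ξ : ℝ) : ℂ) + t ≠ 0 := by exact_mod_cast hpt.ne'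
    push_cast
    field_simp
    ring
  rw [h1, h2, h3, h4, enorm_mul, enorm_ofReal_of_nonneg (by positivity), mul_pow, mul_assoc,
    ← ENNReal.ofReal_pow (by positivity), ← ENNReal.ofReal_mul (by positivity), mul_comm]
  congr 2
  rw [mul_pow, Real.rpow_neg hpt.le, Real.rpow_two, Real.rpow_two, inv_pow]

theorem lintegral_enorm_sub_freeResolvent_sq {lam r : ℝ} (hlam : 0 < lam) (hr0 : 0 < r)
    (hr1 : r < 1) (k : L2) :
    ∫⁻ t in Set.Ioi (0 : ℝ), ENNReal.ofReal (t ^ (2 * r - 1)) *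
      (∫⁻ ξ, (‖(𝓕 (freePow hlam hr0.le k) : L2) ξ‖ₑ ^ 2 * ENNReal.ofReal (symbol lam ξ ^ (2 : ℝ))) *
        ENNReal.ofReal ((symbol lam ξ + t) ^ (-2 : ℝ))) =
      ENNReal.ofReal (powerIntegral (2 * r - 1) 2) * ENNReal.ofReal (‖k‖ ^ 2) := by
  rw [lintegral_lintegral_rpow_symbol (by linarith) (by linarith) hlam (by fun_prop),
    ← sobolevSq_freePow hlam hr0.le k]
  congr 1
  refine lintegral_congr fun ξ => ?_
  rw [mul_assoc, ofReal_rpow_mul_ofReal_rpow (symbol_pos hlam ξ)]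
  congr 3
  ring

theorem enorm_inv_coef_smul_greenL2_sq_le {α μ : ℝ} (hα : 0 ≤ α) (hμ : 0 < μ) (y : ℂ) :
    ‖((coef α μ)⁻¹ * y) • greenL2 hμ‖ₑ ^ 2 ≤
      ENNReal.ofReal (2 * Real.pi * μ ^ (-(3 / 2) : ℝ)) * ‖y‖ₑ ^ 2 := by
  have hpi := Real.pi_pos
  rw [enorm_smul, enorm_mul, mul_pow, mul_pow, enorm_greenL2_sq]
  calc _ ≤ ENNReal.ofReal (4 * Real.pi * μ ^ (-(1 / 2) : ℝ)) ^ 2 * ‖y‖ₑ ^ 2 *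
        ENNReal.ofReal (8 * Real.pi * √μ)⁻¹ := by
        gcongr
        exact enorm_inv_coef_le hα hμ
    _ = _ := by
        rw [mul_right_comm, ← ENNReal.ofReal_pow (by positivity),
          ← ENNReal.ofReal_mul (by positivity)]
        congr 2
        rw [Real.sqrt_eq_rpow, mul_inv, ← Real.rpow_neg hμ.le, mul_pow,
          show (-(3 / 2) : ℝ) = -(1 / 2) + -(1 / 2) + -(1 / 2) by norm_num, Real.rpow_add hμ,
          Real.rpow_add hμ]
        field_simp
        ring

theorem ennreal_add_sq_le (a b : ENNReal) : (a + b) ^ 2 ≤ 2 * (a ^ 2 + b ^ 2) := by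
  have h := ENNReal.rpow_add_le_mul_rpow_add_rpow a b (p := 2) one_le_two
  norm_num at h
  simpa only [ENNReal.rpow_two] using h

/-- A bound for the square function of `freePow k + q G_lam`, in terms of a bound `Y` for the
coefficient of `G_{lam+t}` in `sub_smul_ptResolvent`. -/
theorem exists_opPow_eq_of_lintegral_le {lam r : ℝ} (hlam : 0 < lam) (hr0 : 0 < r) (hr1 : r < 1)
    {α : ℝ} (hα : 0 ≤ α) (k : L2) (q : ℂ) {Y : ℝ → ENNReal} (hY : Measurable Y)
    (hYb : ∀ t (_ : 0 < t) (hlt : 0 < lam + t), ‖q * coef α lam -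
      t * inner ℂ (greenL2 hlt) (freePow hlam hr0.le k)‖ₑ ≤ Y t) {M : ℝ} (hM : 0 ≤ M)
    (h : ENNReal.ofReal (2 * powerIntegral (2 * r - 1) 2 * ‖k‖ ^ 2) +
      ENNReal.ofReal (4 * Real.pi) * ∫⁻ t in Set.Ioi (0 : ℝ),
        ENNReal.ofReal (t ^ (2 * r - 1) * (lam + t) ^ (-(3 / 2) : ℝ)) * Y t ^ 2 ≤
      ENNReal.ofReal (M ^ 2)) :
    ∃ h, opPow (ptResolvent α hlam) r h = freePow hlam hr0.le k + q • greenL2 hlam ∧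
      ‖h‖ ≤ squareConst r * M := by
  have hpi := Real.pi_pos
  have hc := powerIntegral_pos (β := 2 * r - 1) (γ := 2) (by linarith) (by linarith)
  set F := freePow hlam hr0.le k with hF
  refine exists_rpow_eq_of_lintegral_le (ptResolvent_nonneg hα hlam)
    (injective_ptResolvent hα hlam) hr0 hr1 hM (le_trans ?_ h)
  calc _ ≤ ∫⁻ t in Set.Ioi (0 : ℝ), (2 * (ENNReal.ofReal (t ^ (2 * r - 1)) *
          (∫⁻ ξ, (‖(𝓕 F : L2) ξ‖ₑ ^ 2 * ENNReal.ofReal (symbol lam ξ ^ (2 : ℝ))) *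
            ENNReal.ofReal ((symbol lam ξ + t) ^ (-2 : ℝ)))) +
        ENNReal.ofReal (4 * Real.pi) *
          (ENNReal.ofReal (t ^ (2 * r - 1) * (lam + t) ^ (-(3 / 2) : ℝ)) * Y t ^ 2)) := by
        refine setLIntegral_mono' measurableSet_Ioi fun t ht => ?_
        have ht0 : (0 : ℝ) < t := ht
        have hlt : 0 < lam + t := by positivity
        rw [← ptResolvent_eq_resolventOf hα hlam ht0.le hlt, sub_smul_ptResolvent hα hlam hlt,
          ENNReal.ofReal_mul (by positivity), ENNReal.ofReal_pow (norm_nonneg _), ofReal_norm]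
        set u := F - (t : ℂ) • freeResolvent hlt F with hu
        set v := ((coef α (lam + t))⁻¹ *
          (q * coef α lam - t * inner ℂ (greenL2 hlt) F)) • greenL2 hlt with hv
        have h1 : ‖u + v‖ₑ ^ 2 ≤ 2 * (‖u‖ₑ ^ 2 + ‖v‖ₑ ^ 2) :=
          (pow_le_pow_left' (enorm_add_le u v) 2).trans (ennreal_add_sq_le _ _)
        have h3 : ENNReal.ofReal (4 * Real.pi) = 2 * ENNReal.ofReal (2 * Real.pi) := by
          rw [← ENNReal.ofReal_ofNat 2, ← ENNReal.ofReal_mul zero_le_two]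
          ring_nf
        have h2 : ‖v‖ₑ ^ 2 ≤ ENNReal.ofReal (2 * Real.pi * (lam + t) ^ (-(3 / 2) : ℝ)) *
            Y t ^ 2 := by
          refine (enorm_inv_coef_smul_greenL2_sq_le hα hlt _).trans ?_
          gcongr
          exact hYb t ht0 hlt
        rw [← enorm_sub_freeResolvent_sq hlam ht0 hlt, ← hu, h3]
        calc _ ≤ ENNReal.ofReal (t ^ (2 * r - 1)) * (2 * (‖u‖ₑ ^ 2 +
              ENNReal.ofReal (2 * Real.pi * (lam + t) ^ (-(3 / 2) : ℝ)) * Y t ^ 2)) := by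
              gcongr
              exact h1.trans (by gcongr)
          _ = _ := by
              rw [ENNReal.ofReal_mul (p := 2 * Real.pi) (by positivity),
                ENNReal.ofReal_mul (p := t ^ (2 * r - 1)) (by positivity)]
              ring
    _ = _ := by
        rw [lintegral_add_right _ (by fun_prop), lintegral_const_mul' _ _ ENNReal.ofNat_ne_top,
          lintegral_const_mul' _ _ ENNReal.ofReal_ne_top, hF,
          lintegral_enorm_sub_freeResolvent_sq hlam hr0 hr1, mul_assoc 2,
          ENNReal.ofReal_mul (p := 2) (by positivity), ENNReal.ofReal_mul hc.le,
          ENNReal.ofReal_ofNat]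

/-- For `s = 2r < 3/2`, the domain of `(-Δ_α + lam)^{s/2}` contains `H^s` and `G_lam`. -/
theorem exists_opPow_eq_freePow_add {lam r : ℝ} (hlam : 0 < lam) (hr0 : 0 < r) (hr1 : r < 3 / 4) :
    ∃ C : ℝ, 0 ≤ C ∧ ∀ α : ℝ, 0 ≤ α → ∀ (k : L2) (q : ℂ),
      ∃ h, opPow (ptResolvent α hlam) r h = freePow hlam hr0.le k + q • greenL2 hlam ∧
        ‖h‖ ≤ C * (‖k‖ + ‖q * coef α lam‖) := by
  have hpi := Real.pi_pos
  have hc := powerIntegral_pos (β := 2 * r - 1) (γ := 2) (by linarith) (by linarith)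
  have hc' := powerIntegral_pos (β := 2 * r - 1) (γ := 3 / 2) (by linarith) (by linarith)
  set A : ℝ := powerIntegral (2 * r - 1) (3 / 2) * lam ^ (2 * r - 3 / 2) with hA
  set B : ℝ := (pairingConst (-(2 * r))).toReal with hB
  have hA0 : 0 ≤ A := by positivity
  have hB0 : 0 ≤ B := ENNReal.toReal_nonneg
  set K : ℝ := 2 * powerIntegral (2 * r - 1) 2 + 8 * Real.pi * (A + B) with hK
  have hK0 : 0 ≤ K := by positivity
  have hsq : 0 ≤ squareConst r := by
    have := powerIntegral_pos (β := 0) (γ := 2) (by norm_num) (by norm_num)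
    unfold squareConst
    positivity
  refine ⟨squareConst r * √K, by positivity, fun α hα k q => ?_⟩
  set F := freePow hlam hr0.le k with hF
  set I := greenIntegral lam (fun ξ => ‖(𝓕 F : L2) ξ‖ₑ) with hI
  have hIm : Measurable I := measurable_greenIntegral lam (by fun_prop)
  rw [mul_assoc]
  refine exists_opPow_eq_of_lintegral_le hlam hr0 (by linarith) hα k q
    (Y := fun t => ‖q * coef α lam‖ₑ + ENNReal.ofReal t * I t) (by fun_prop)
    (fun t ht hlt => ?_) (by positivity) ?_
  · refine (enorm_sub_le).trans ?_
    rw [enorm_mul (t : ℂ), enorm_ofReal_of_nonneg ht.le]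
    gcongr
    exact enorm_inner_greenL2_le_greenIntegral hlt F
  have h1 : ∫⁻ t in Set.Ioi (0 : ℝ),
      ENNReal.ofReal (t ^ (2 * r - 1) * (lam + t) ^ (-(3 / 2) : ℝ)) *
        (‖q * coef α lam‖ₑ + ENNReal.ofReal t * I t) ^ 2 ≤
      ENNReal.ofReal (2 * (A * ‖q * coef α lam‖ ^ 2 + B * ‖k‖ ^ 2)) := by
    calc _ ≤ ∫⁻ t in Set.Ioi (0 : ℝ), (2 * ‖q * coef α lam‖ₑ ^ 2 *
          ENNReal.ofReal (t ^ (2 * r - 1) * (lam + t) ^ (-(3 / 2) : ℝ)) +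
          2 * (ENNReal.ofReal (t ^ (-(1 / 2) - -(2 * r))) * I t ^ 2)) := by
          refine setLIntegral_mono' measurableSet_Ioi fun t ht => ?_
          have ht0 : (0 : ℝ) < t := ht
          have h2 : (‖q * coef α lam‖ₑ + ENNReal.ofReal t * I t) ^ 2 ≤
              2 * (‖q * coef α lam‖ₑ ^ 2 + (ENNReal.ofReal t * I t) ^ 2) :=
            ennreal_add_sq_le _ _
          have h3 : ENNReal.ofReal (t ^ (2 * r - 1) * (lam + t) ^ (-(3 / 2) : ℝ)) *
              ENNReal.ofReal t ^ 2 ≤ ENNReal.ofReal (t ^ (-(1 / 2) - -(2 * r))) := by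
            rw [← ENNReal.ofReal_pow ht0.le, ← ENNReal.ofReal_mul (by positivity)]
            apply ENNReal.ofReal_le_ofReal
            calc _ ≤ t ^ (2 * r - 1) * t ^ (-(3 / 2) : ℝ) * t ^ (2 : ℝ) := by
                  rw [Real.rpow_two]
                  gcongr ?_ * ?_ * _
                  exact Real.rpow_le_rpow_of_nonpos ht0 (by linarith) (by norm_num)
              _ = _ := by
                  rw [← Real.rpow_add ht0, ← Real.rpow_add ht0]
                  congr 1
                  ring
          refine (mul_le_mul_right h2 _).trans ?_
          rw [mul_pow]
          calc _ = 2 * ‖q * coef α lam‖ₑ ^ 2 *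
                ENNReal.ofReal (t ^ (2 * r - 1) * (lam + t) ^ (-(3 / 2) : ℝ)) +
                2 * ((ENNReal.ofReal (t ^ (2 * r - 1) * (lam + t) ^ (-(3 / 2) : ℝ)) *
                  ENNReal.ofReal t ^ 2) * I t ^ 2) := by ring
            _ ≤ _ := by gcongr
      _ = 2 * ‖q * coef α lam‖ₑ ^ 2 * ENNReal.ofReal A +
          2 * ∫⁻ t in Set.Ioi (0 : ℝ), ENNReal.ofReal (t ^ (-(1 / 2) - -(2 * r))) * I t ^ 2 := by
          rw [lintegral_add_right _ (by fun_prop), lintegral_const_mul' _ _ ENNReal.ofNat_ne_top,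
            lintegral_const_mul' _ _ (by finiteness), lintegral_rpow_mul_add_rpow (by linarith)
            (by linarith) hlam, hA]
          congr 5
          ring
      _ ≤ 2 * ‖q * coef α lam‖ₑ ^ 2 * ENNReal.ofReal A +
          2 * (pairingConst (-(2 * r)) * ENNReal.ofReal (‖k‖ ^ 2)) := by
          have h4 := lintegral_rpow_mul_lintegral_sq_le (σ := -(2 * r)) (by linarith) (by linarith)
            hlam (f := fun ξ => ‖(𝓕 F : L2) ξ‖ₑ) (by fun_prop)
          rw [neg_neg] at h4
          rw [← sobolevSq_freePow hlam hr0.le k]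
          gcongr
          exact h4
      _ = _ := by
          rw [ENNReal.ofReal_mul zero_le_two, ENNReal.ofReal_add (by positivity)
            (by positivity), ENNReal.ofReal_mul hA0, ENNReal.ofReal_mul hB0, hB,
            ENNReal.ofReal_toReal (pairingConst_ne_top _), ENNReal.ofReal_pow (norm_nonneg (q * _)),
            ofReal_norm, ENNReal.ofReal_ofNat]
          ring
  refine (add_le_add le_rfl (mul_le_mul_right h1 _)).trans ?_
  rw [← ENNReal.ofReal_mul (by positivity), ← ENNReal.ofReal_add (by positivity) (by positivity)]
  apply ENNReal.ofReal_le_ofReal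
  rw [mul_pow, Real.sq_sqrt hK0]
  have hx := norm_nonneg k
  have hy := norm_nonneg (q * coef α lam)
  have h5 : 2 * powerIntegral (2 * r - 1) 2 * ‖k‖ ^ 2 + 4 * Real.pi *
      (2 * (A * ‖q * coef α lam‖ ^ 2 + B * ‖k‖ ^ 2)) ≤
      K * (‖k‖ ^ 2 + ‖q * coef α lam‖ ^ 2) := by
    have h6 : 0 ≤ 8 * Real.pi * A * ‖k‖ ^ 2 := by positivity
    have h7 : 0 ≤ 8 * Real.pi * B * ‖q * coef α lam‖ ^ 2 := by positivity
    have h8 : 0 ≤ 2 * powerIntegral (2 * r - 1) 2 * ‖q * coef α lam‖ ^ 2 := by positivity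
    rw [hK]
    linarith
  refine h5.trans ?_
  gcongr
  nlinarith [mul_nonneg hx hy]

/-! ### Values at the origin -/

theorem integrable_fourier_freePow {lam r : ℝ} (hlam : 0 < lam) (hr0 : 0 ≤ r) (hr : 3 / 4 < r)
    (k : L2) : Integrable (𝓕 (freePow hlam hr0 k) : L2) := by
  have h1 : MemLp (fun ξ => ((symbol lam ξ ^ (-r) : ℝ) : ℂ)) 2 (volume : Measure E3) := by
    rw [memLp_two_iff_integrable_sq_norm (Measurable.aestronglyMeasurable (by fun_prop))]
    refine (integrable_symbol_rpow_neg (s := 2 * r) (by linarith) hlam).congr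
      (.of_forall fun ξ => ?_)
    have hp := symbol_pos hlam ξ
    simp only
    rw [Complex.norm_real, Real.norm_of_nonneg (by positivity), ← Real.rpow_mul_natCast hp.le]
    congr 1
    push_cast
    ring
  exact (h1.integrable_mul (Lp.memLp (𝓕 k : L2))).congr (fourier_freePow hlam hr0 k).symm

theorem hasValueAtZero_freePow {lam r : ℝ} (hlam : 0 < lam) (hr0 : 0 ≤ r) (hr : 3 / 4 < r)
    (k : L2) : HasValueAtZero (freePow hlam hr0 k) (∫ ξ, (𝓕 (freePow hlam hr0 k) : L2) ξ) :=
  hasValueAtZero_of_integrable (integrable_fourier_freePow hlam hr0 hr k)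

theorem enorm_integral_sub_inner_le {lam t : ℝ} (hlam : 0 < lam) (ht : 0 < t) (hlt : 0 < lam + t)
    {F : L2} (hF : Integrable (𝓕 F : L2)) :
    ‖(∫ ξ, (𝓕 F : L2) ξ) - t * inner ℂ (greenL2 hlt) F‖ₑ ≤
      greenIntegral lam (fun ξ => ‖(𝓕 F : L2) ξ‖ₑ * ENNReal.ofReal (symbol lam ξ)) t := by
  have hi : Integrable fun ξ => (((symbol (lam + t) ξ)⁻¹ : ℝ) : ℂ) * (𝓕 F : L2) ξ := by
    refine hF.bdd_mul (c := (lam + t)⁻¹) (Measurable.aestronglyMeasurable (by fun_prop))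
      (.of_forall fun ξ => ?_)
    have := symbol_pos hlt ξ
    rw [Complex.norm_real, Real.norm_of_nonneg (by positivity)]
    exact inv_anti₀ hlt (le_symbol _ ξ)
  rw [inner_greenL2_left, ← integral_const_mul, ← integral_sub hF (hi.const_mul _)]
  refine (enorm_integral_le_lintegral_enorm _).trans (le_of_eq (lintegral_congr fun ξ => ?_))
  have hp := symbol_pos hlam ξ
  have hpt : 0 < symbol lam ξ + t := by positivity
  have h4 : (𝓕 F : L2) ξ - t * ((((symbol (lam + t) ξ)⁻¹ : ℝ) : ℂ) * (𝓕 F : L2) ξ) =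
      ((symbol lam ξ * (symbol lam ξ + t)⁻¹ : ℝ) : ℂ) * (𝓕 F : L2) ξ := by
    rw [symbol_add]
    have : ((symbol lam ξ : ℝ) : ℂ) + t ≠ 0 := by exact_mod_cast hpt.ne'
    push_cast
    field_simp
    ring
  rw [h4, enorm_mul, enorm_ofReal_of_nonneg (by positivity), ENNReal.ofReal_mul hp.le]
  ring

/-- For `s = 2r > 3/2`, the domain of `(-Δ_α + lam)^{s/2}` contains the vectors of `H^s + ℂ G_lam`
that satisfy the boundary condition of `-Δ_α`. -/
theorem exists_opPow_eq_of_hasValueAtZero {lam r : ℝ} (hlam : 0 < lam) (hr : 3 / 4 < r)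
    (hr1 : r < 1) (hr0 : 0 ≤ r) :
    ∃ C : ℝ, 0 ≤ C ∧ ∀ α : ℝ, 0 ≤ α → ∀ (k : L2) (v : ℂ), HasValueAtZero (freePow hlam hr0 k) v →
      ∃ h, opPow (ptResolvent α hlam) r h =
        freePow hlam hr0 k + (v / coef α lam) • greenL2 hlam ∧ ‖h‖ ≤ C * ‖k‖ := by
  have hpi := Real.pi_pos
  have hrpos : 0 < r := by linarith
  have hc := powerIntegral_pos (β := 2 * r - 1) (γ := 2) (by linarith) (by linarith)
  set B : ℝ := (pairingConst (2 - 2 * r)).toReal with hB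
  have hB0 : 0 ≤ B := ENNReal.toReal_nonneg
  set K : ℝ := 2 * powerIntegral (2 * r - 1) 2 + 4 * Real.pi * B with hK
  have hK0 : 0 ≤ K := by positivity
  have hsq : 0 ≤ squareConst r := by
    have := powerIntegral_pos (β := 0) (γ := 2) (by norm_num) (by norm_num)
    unfold squareConst
    positivity
  refine ⟨squareConst r * √K, by positivity, fun α hα k v hv => ?_⟩
  obtain rfl := hv.unique (hasValueAtZero_freePow hlam hr0 hr k)
  have hint := integrable_fourier_freePow hlam hr0 hr k
  set F := freePow hlam hr0 k with hF
  set I := greenIntegral lam (fun ξ => ‖(𝓕 F : L2) ξ‖ₑ * ENNReal.ofReal (symbol lam ξ)) with hI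
  have hIm : Measurable I := measurable_greenIntegral lam (by fun_prop)
  rw [mul_assoc]
  refine exists_opPow_eq_of_lintegral_le hlam hrpos hr1 hα k _ hIm
    (fun t ht hlt => ?_) (by positivity) ?_
  · rw [div_mul_cancel₀ _ (coef_ne_zero hα hlam)]
    exact enorm_integral_sub_inner_le hlam ht hlt hint
  have h1 : ∫⁻ t in Set.Ioi (0 : ℝ),
      ENNReal.ofReal (t ^ (2 * r - 1) * (lam + t) ^ (-(3 / 2) : ℝ)) * I t ^ 2 ≤
      ENNReal.ofReal (B * ‖k‖ ^ 2) := by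
    calc _ ≤ ∫⁻ t in Set.Ioi (0 : ℝ),
          ENNReal.ofReal (t ^ (-(1 / 2) - (2 - 2 * r))) * I t ^ 2 := by
          refine setLIntegral_mono' measurableSet_Ioi fun t ht => ?_
          have ht0 : (0 : ℝ) < t := ht
          gcongr
          calc _ ≤ t ^ (2 * r - 1) * t ^ (-(3 / 2) : ℝ) := by
                gcongr ?_ * ?_
                exact Real.rpow_le_rpow_of_nonpos ht0 (by linarith) (by norm_num)
            _ = _ := by
                rw [← Real.rpow_add ht0]
                congr 1
                ring
      _ ≤ pairingConst (2 - 2 * r) * ENNReal.ofReal (‖k‖ ^ 2) := by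
          have h4 := lintegral_rpow_mul_lintegral_sq_le (σ := 2 - 2 * r) (by linarith)
            (by linarith) hlam
            (f := fun ξ => ‖(𝓕 F : L2) ξ‖ₑ * ENNReal.ofReal (symbol lam ξ)) (by fun_prop)
          refine h4.trans (le_of_eq ?_)
          rw [← sobolevSq_freePow hlam hr0 k]
          congr 1
          refine lintegral_congr fun ξ => ?_
          have hp := symbol_pos hlam ξ
          rw [mul_pow, mul_assoc, ← ENNReal.ofReal_pow hp.le, ← Real.rpow_two,
            ofReal_rpow_mul_ofReal_rpow hp]
          congr 3
          ring
      _ = _ := by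
          rw [ENNReal.ofReal_mul hB0, hB, ENNReal.ofReal_toReal (pairingConst_ne_top _)]
  refine (add_le_add le_rfl (mul_le_mul_right h1 _)).trans ?_
  rw [← ENNReal.ofReal_mul (by positivity), ← ENNReal.ofReal_add (by positivity) (by positivity)]
  apply ENNReal.ofReal_le_ofReal
  rw [mul_pow, Real.sq_sqrt hK0, hK]
  linarith

/-! ### Uniqueness of the singular part -/

theorem eq_zero_of_freePow_eq_smul_greenL2 {lam r : ℝ} (hlam : 0 < lam) (hr0 : 0 ≤ r)
    (hr : 1 / 4 ≤ r) (hr1 : r ≤ 1) {k : L2} {q : ℂ} (h : freePow hlam hr0 k = q • greenL2 hlam) :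
    q = 0 := by
  by_contra hq
  have h1 := sobolevSq_freePow hlam hr0 k
  have h2 : sobolevSq lam (2 * r) (q • greenL2 hlam) =
      ‖q‖ₑ ^ 2 * ∫⁻ ξ, ENNReal.ofReal (symbol lam ξ ^ (2 * r - 2)) := by
    rw [sobolevSq, ← lintegral_const_mul' _ _ (by finiteness)]
    refine lintegral_congr_ae ?_
    filter_upwards [fourier_smul_ae q (greenL2 hlam), fourier_greenL2 hlam] with ξ h3 h4
    have hp := symbol_pos hlam ξ
    rw [h3, h4, enorm_mul, enorm_ofReal_of_nonneg (by positivity), mul_pow, mul_assoc,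
      ← Real.rpow_neg_one, sq (ENNReal.ofReal _), ofReal_rpow_mul_ofReal_rpow hp,
      ofReal_rpow_mul_ofReal_rpow hp]
    congr 3
    ring
  rw [h, h2, lintegral_symbol_rpow_eq_top (by linarith) (by linarith) hlam,
    ENNReal.mul_top (by simpa using hq)] at h1
  exact ENNReal.ofReal_ne_top h1.symm

/-- Elements of `H^s` are separated from multiples of `G_lam` when `s ≥ 1/2`. -/
theorem freePow_add_smul_greenL2_inj {lam r : ℝ} (hlam : 0 < lam) (hr0 : 0 ≤ r)
    (hr : 1 / 4 ≤ r) (hr1 : r ≤ 1) {k k' : L2} {q q' : ℂ}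
    (h : freePow hlam hr0 k + q • greenL2 hlam = freePow hlam hr0 k' + q' • greenL2 hlam) :
    k = k' ∧ q = q' := by
  have h1 : freePow hlam hr0 (k - k') = (q' - q) • greenL2 hlam := by
    rw [map_sub, sub_smul, sub_eq_sub_iff_add_eq_add, h]
    abel
  have h2 := eq_zero_of_freePow_eq_smul_greenL2 hlam hr0 hr hr1 h1
  have h3 : q = q' := (sub_eq_zero.1 h2).symm
  refine ⟨injective_freePow hlam hr0 ?_, h3⟩
  rw [h3] at h
  exact add_right_cancel h

/-- For `s = 2r > 3/2`, no nonzero multiple of `G_lam` is in the domain of `(-Δ_α + lam)^{s/2}`: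
with `A = -Δ_α + lam`, the norm of `A (A + t)⁻¹ G_lam` is of order `t ^ (-3/4)`, whereas it would
have to be at most of order `t ^ (-r)`. -/
theorem eq_zero_of_opPow_eq_smul_greenL2 {lam r α : ℝ} (hlam : 0 < lam) (hr : 3 / 4 < r)
    (hr1 : r ≤ 1) (hα : 0 ≤ α) {h : L2} {q : ℂ}
    (hq : opPow (ptResolvent α hlam) r h = q • greenL2 hlam) : q = 0 := by
  have hpi := Real.pi_pos
  set w : ℝ := √(lam + 1) with hw
  have hw0 : 0 < w := by positivity
  set b : ℝ := α + w / (4 * Real.pi) with hb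
  have hb0 : 0 < b := by positivity
  have key : ∀ t : ℝ, 1 ≤ t → ‖q * coef α lam‖ ^ 2 ≤
      8 * Real.pi * w * b ^ 2 * ‖h‖ ^ 2 * t ^ (-(2 * r - 3 / 2)) := by
    intro t ht
    have ht0 : 0 < t := by linarith
    have hlt : 0 < lam + t := by positivity
    have h1 := norm_rpow_sub_resolventOf_le (ptResolvent_nonneg hα hlam) (by linarith : 0 ≤ r) hr1
      ht0 h
    rw [hq, ← ptResolvent_eq_resolventOf hα hlam ht0.le hlt] at h1
    have h2 := sub_smul_ptResolvent hα hlam hlt 0 q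
    simp only [zero_add, map_zero, smul_zero, sub_zero, inner_zero_right, mul_zero] at h2
    rw [h2, norm_smul, norm_mul, norm_inv, coef_eq α (lam + t), Complex.norm_real,
      Real.norm_of_nonneg (realCoef_pos hα hlt).le] at h1
    have h3 := pow_le_pow_left₀ (by have := realCoef_pos hα hlt; positivity) h1 2
    rw [mul_pow, mul_pow, mul_pow, norm_greenL2_sq, inv_pow] at h3
    have h4 : √(lam + t) ≤ w * t ^ (1 / 2 : ℝ) := by
      rw [hw, ← Real.sqrt_eq_rpow, ← Real.sqrt_mul (by positivity)]
      apply Real.sqrt_le_sqrt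
      nlinarith
    have ht1 : 1 ≤ t ^ (1 / 2 : ℝ) := Real.one_le_rpow ht (by norm_num)
    have h5 : realCoef α (lam + t) ≤ b * t ^ (1 / 2 : ℝ) := by
      have h6 : √(lam + t) / (4 * Real.pi) ≤ w * t ^ (1 / 2 : ℝ) / (4 * Real.pi) := by gcongr
      have h7 : α ≤ α * t ^ (1 / 2 : ℝ) := le_mul_of_one_le_right hα ht1
      calc realCoef α (lam + t) ≤ α * t ^ (1 / 2 : ℝ) + w * t ^ (1 / 2 : ℝ) / (4 * Real.pi) :=
            add_le_add h7 h6
        _ = _ := by rw [hb]; ring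
    have hc := realCoef_pos hα hlt
    have hs : 0 < √(lam + t) := by positivity
    calc ‖q * coef α lam‖ ^ 2 = ((realCoef α (lam + t) ^ 2)⁻¹ * ‖q * coef α lam‖ ^ 2 *
          (8 * Real.pi * √(lam + t))⁻¹) * (realCoef α (lam + t) ^ 2 *
            (8 * Real.pi * √(lam + t))) := by field_simp
      _ ≤ ((t ^ (-r)) ^ 2 * ‖h‖ ^ 2) * ((b * t ^ (1 / 2 : ℝ)) ^ 2 *
            (8 * Real.pi * (w * t ^ (1 / 2 : ℝ)))) := by gcongr
      _ = 8 * Real.pi * w * b ^ 2 * ‖h‖ ^ 2 * ((t ^ (-r)) * (t ^ (-r)) * (t ^ (1 / 2 : ℝ) *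
            t ^ (1 / 2 : ℝ) * t ^ (1 / 2 : ℝ))) := by ring
      _ = _ := by
          rw [← Real.rpow_add ht0, ← Real.rpow_add ht0, ← Real.rpow_add ht0, ← Real.rpow_add ht0]
          congr 2
          ring
  have hlim : Filter.Tendsto (fun t : ℝ => 8 * Real.pi * w * b ^ 2 * ‖h‖ ^ 2 *
      t ^ (-(2 * r - 3 / 2))) Filter.atTop (nhds 0) := by
    have := (tendsto_rpow_neg_atTop (by linarith : 0 < 2 * r - 3 / 2)).const_mul
      (8 * Real.pi * w * b ^ 2 * ‖h‖ ^ 2)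
    rwa [mul_zero] at this
  have h0 : ‖q * coef α lam‖ ^ 2 ≤ 0 :=
    ge_of_tendsto hlim (Filter.eventually_atTop.2 ⟨1, key⟩)
  have h1 : q * coef α lam = 0 := by
    have : ‖q * coef α lam‖ ^ 2 = 0 := le_antisymm h0 (sq_nonneg _)
    simpa using this
  exact (mul_eq_zero.1 h1).resolve_right (coef_ne_zero hα hlam)

/-! ### Sobolev spaces as ranges of powers of the free resolvent -/

theorem exists_freePow_eq_of_sobolevSq_ne_top {lam r : ℝ} (hlam : 0 < lam) (hr0 : 0 ≤ r) {F : L2}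
    (h : sobolevSq lam (2 * r) F ≠ ⊤) : ∃ k, freePow hlam hr0 k = F := by
  have hm : MemLp (fun ξ => ((symbol lam ξ ^ (2 * r / 2) : ℝ) : ℂ) * (𝓕 F : L2) ξ) 2
      (volume : Measure E3) := by
    refine ⟨AEStronglyMeasurable.mul (Measurable.aestronglyMeasurable (by fun_prop))
      (Lp.aestronglyMeasurable _), ?_⟩
    have h1 : eLpNorm (fun ξ => ((symbol lam ξ ^ (2 * r / 2) : ℝ) : ℂ) * (𝓕 F : L2) ξ) 2
        volume ^ 2 = sobolevSq lam (2 * r) F := by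
      rw [eLpNorm_two_sq]
      exact lintegral_congr fun ξ => enorm_ofReal_rpow_mul_sq (symbol_pos hlam ξ).le _
    rw [← h1, ← lt_top_iff_ne_top, ENNReal.pow_lt_top_iff] at h
    simpa using h
  refine ⟨(Lp.fourierTransformₗᵢ E3 ℂ).symm (hm.toLp _), ext_fourier ?_⟩
  have h2 : (𝓕 ((Lp.fourierTransformₗᵢ E3 ℂ).symm (hm.toLp _)) : L2) = hm.toLp _ :=
    (Lp.fourierTransformₗᵢ E3 ℂ).apply_symm_apply _
  filter_upwards [fourier_freePow hlam hr0 ((Lp.fourierTransformₗᵢ E3 ℂ).symm (hm.toLp _)),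
    hm.coeFn_toLp] with ξ h3 h4
  rw [h3, h2, h4, ← mul_assoc, ← Complex.ofReal_mul, ← Real.rpow_add (symbol_pos hlam ξ)]
  norm_num

theorem memHs_iff_exists_freePow {lam s : ℝ} (hlam : 0 < lam) (hs : 0 ≤ s) (hr : 0 ≤ s / 2)
    (F : L2) : MemHs s F ↔ ∃ k, freePow hlam hr k = F := by
  have h2 : 2 * (s / 2) = s := by ring
  rw [memHs_iff hlam hs]
  constructor
  · intro h
    exact exists_freePow_eq_of_sobolevSq_ne_top hlam hr (by rwa [h2])
  · rintro ⟨k, rfl⟩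
    have := sobolevSq_freePow hlam hr k
    rw [h2] at this
    rw [this]
    exact ENNReal.ofReal_ne_top

/-- The `H^s` norm of `(-Δ + lam)^{-s/2} k` is equivalent to the norm of `k`. -/
theorem exists_sobolevNorm_freePow_le {lam s : ℝ} (hlam : 0 < lam) (hs : 0 ≤ s)
    (hr : 0 ≤ s / 2) : ∃ C : ℝ, 0 ≤ C ∧ ∀ k : L2,
      ‖k‖ ≤ C * sobolevNorm s (freePow hlam hr k) ∧
        sobolevNorm s (freePow hlam hr k) ≤ C * ‖k‖ := by
  set m : ℝ := max (max 1 (lam / 1) ^ s) (max 1 (1 / lam) ^ s) with hm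
  have hm1 : max 1 (lam / 1) ^ s ≤ m := le_max_left _ _
  have hm2 : max 1 (1 / lam) ^ s ≤ m := le_max_right _ _
  have hm0 : 0 ≤ m := le_trans (Real.rpow_nonneg (le_trans zero_le_one (le_max_left _ _)) s) hm1
  refine ⟨√m, Real.sqrt_nonneg _, fun k => ?_⟩
  set F := freePow hlam hr k with hF
  have hsob : 0 ≤ sobolevNorm s F := ENNReal.toReal_nonneg
  have h1 : sobolevSq lam s F = ENNReal.ofReal (‖k‖ ^ 2) := by
    rw [← sobolevSq_freePow hlam hr k]
    congr 1
    ring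
  have h2 : sobolevSq 1 s F ≠ ⊤ :=
    (memHs_iff one_pos hs F).1 ((memHs_iff hlam hs F).2 (by rw [h1]; exact ENNReal.ofReal_ne_top))
  have h3 := ofReal_sobolevNorm_sq h2
  have h4 := sobolevSq_le hlam one_pos hs F
  have h5 := sobolevSq_le one_pos hlam hs F
  rw [h1, ← h3, ← ENNReal.ofReal_mul (Real.rpow_nonneg (le_trans zero_le_one (le_max_left _ _)) s),
    ENNReal.ofReal_le_ofReal_iff (mul_nonneg (Real.rpow_nonneg
      (le_trans zero_le_one (le_max_left _ _)) s) (sq_nonneg _))] at h4 h5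
  constructor
  · refine (pow_le_pow_iff_left₀ (norm_nonneg _) (by positivity) two_ne_zero).1 (h4.trans ?_)
    rw [mul_pow, Real.sq_sqrt hm0]
    gcongr
  · refine (pow_le_pow_iff_left₀ hsob (by positivity) two_ne_zero).1 (h5.trans ?_)
    rw [mul_pow, Real.sq_sqrt hm0]
    gcongr

/-! ### The three regimes -/

theorem injective_opPow_ptResolvent {α lam r : ℝ} (hα : 0 ≤ α) (hlam : 0 < lam) (hr : 0 ≤ r) :
    Function.Injective (opPow (ptResolvent α hlam) r) :=
  injective_rpow (ptResolvent_nonneg hα hlam) (injective_ptResolvent hα hlam) hr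

theorem singularSpace_of_lt_half {lam s : ℝ} (hlam : 0 < lam) (hs0 : 0 < s) (hs : s < 1 / 2) :
    ∃ c C : ℝ, 0 < c ∧ 0 < C ∧ ∀ α : ℝ, 0 ≤ α →
      (∀ g : L2, g ∈ singularSpace α s ↔ MemHs s g) ∧
      ∀ g ∈ singularSpace α s,
        c * sobolevNorm s g ≤ singularNorm α lam s g ∧
        singularNorm α lam s g ≤ C * sobolevNorm s g := by
  have hr : 0 < s / 2 := by positivity
  obtain ⟨C₀, hC₀, hn⟩ := exists_sobolevNorm_freePow_le hlam hs0.le hr.le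
  obtain ⟨C₂, hC₂, hb⟩ := exists_opPow_eq_freePow_add hlam hr (by linarith)
  set C₁ := regularityConst (s / 2) (2 * (s / 2)) with hC₁def
  have hC₁ : 0 ≤ C₁ := regularityConst_nonneg hr (by linarith) _
  have hreg : ∀ α : ℝ, 0 ≤ α → ∀ h, ∃ k, freePow hlam hr.le k =
      opPow (ptResolvent α hlam) (s / 2) h ∧ ‖k‖ ≤ C₁ * ‖h‖ := fun α hα h =>
    exists_freePow_eq_opPow hlam hr (by linarith) hα h
  refine ⟨(C₀ * C₁ + 1)⁻¹, C₂ * C₀ + 1, by positivity, by positivity, fun α hα => ⟨fun g => ?_, ?_⟩⟩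
  · rw [singularSpace_eq hα hlam hs0.le, memHs_iff_exists_freePow hlam hs0.le hr.le]
    constructor
    · rintro ⟨h, rfl⟩
      obtain ⟨k, hk, -⟩ := hreg α hα h
      exact ⟨k, hk⟩
    · rintro ⟨k, rfl⟩
      obtain ⟨h, hh, -⟩ := hb α hα k 0
      exact ⟨h, by simpa using hh⟩
  · rw [singularSpace_eq hα hlam hs0.le]
    rintro _ ⟨h, rfl⟩
    change _ * sobolevNorm s (opPow (ptResolvent α hlam) (s / 2) h) ≤
      singularNorm α lam s (opPow (ptResolvent α hlam) (s / 2) h) ∧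
      singularNorm α lam s (opPow (ptResolvent α hlam) (s / 2) h) ≤ _
    rw [singularNorm_eq hα hlam hs0]
    obtain ⟨k, hk, hkh⟩ := hreg α hα h
    obtain ⟨h', hh', hle⟩ := hb α hα k 0
    rw [zero_smul, add_zero, hk] at hh'
    obtain rfl := injective_opPow_ptResolvent hα hlam hr.le hh'
    rw [zero_mul, norm_zero, add_zero] at hle
    have h0 : 0 ≤ sobolevNorm s (freePow hlam hr.le k) := ENNReal.toReal_nonneg
    obtain ⟨hn1, hn2⟩ := hn k
    change _ * sobolevNorm s (opPow (ptResolvent α hlam) (s / 2) h') ≤ _ ∧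
      _ ≤ _ * sobolevNorm s (opPow (ptResolvent α hlam) (s / 2) h')
    rw [← hk, inv_mul_le_iff₀ (by positivity)]
    have hh0 := norm_nonneg h'
    constructor
    · nlinarith [mul_le_mul_of_nonneg_left hkh hC₀]
    · nlinarith [mul_le_mul_of_nonneg_left hn1 hC₂]

theorem singularSpace_of_mem_Ioo {lam s : ℝ} (hlam : 0 < lam) (hs : 1 / 2 < s) (hs' : s < 3 / 2)
    {α : ℝ} (hα : 0 ≤ α) :
    (∀ g : L2, g ∈ singularSpace α s ↔
      ∃ (F : L2) (q : ℂ), MemHs s F ∧ g = F + q • greenL2 hlam) ∧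
    ∃ c C : ℝ, 0 < c ∧ 0 < C ∧ ∀ (F : L2) (q : ℂ), MemHs s F →
      c * (sobolevNorm s F + (1 + α) * ‖q‖) ≤ singularNorm α lam s (F + q • greenL2 hlam) ∧
      singularNorm α lam s (F + q • greenL2 hlam) ≤
        C * (sobolevNorm s F + (1 + α) * ‖q‖) := by
  have hs0 : 0 < s := by linarith
  have hr : 0 < s / 2 := by positivity
  obtain ⟨C₀, hC₀, hn⟩ := exists_sobolevNorm_freePow_le hlam hs0.le hr.le
  obtain ⟨C₁, hC₁, hreg⟩ := exists_freePow_add_smul_eq_opPow hlam (r := s / 2) (by linarith)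
    (by linarith) hr.le
  obtain ⟨C₂, hC₂, hb⟩ := exists_opPow_eq_freePow_add hlam hr (by linarith)
  have ha := realCoef_pos hα hlam
  constructor
  · intro g
    rw [singularSpace_eq hα hlam hs0.le]
    constructor
    · rintro ⟨h, rfl⟩
      obtain ⟨k, q, hk, -⟩ := hreg α hα h
      exact ⟨_, q, (memHs_iff_exists_freePow hlam hs0.le hr.le _).2 ⟨k, rfl⟩, hk.symm⟩
    · rintro ⟨F, q, hF, rfl⟩
      obtain ⟨k, rfl⟩ := (memHs_iff_exists_freePow hlam hs0.le hr.le _).1 hF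
      obtain ⟨h, hh, -⟩ := hb α hα k q
      exact ⟨h, hh⟩
  · refine ⟨(C₀ * C₁ + (1 + α) * C₁ + 1)⁻¹, C₂ * (C₀ + realCoef α lam) + 1, by positivity,
      by positivity, fun F q hF => ?_⟩
    obtain ⟨k, rfl⟩ := (memHs_iff_exists_freePow hlam hs0.le hr.le _).1 hF
    obtain ⟨h, hh, hle⟩ := hb α hα k q
    obtain ⟨k', q', hk, hkh, hqh⟩ := hreg α hα h
    rw [hh] at hk
    obtain ⟨rfl, rfl⟩ := freePow_add_smul_greenL2_inj hlam hr.le (by linarith) (by linarith) hk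
    rw [← hh, singularNorm_eq hα hlam hs0, inv_mul_le_iff₀ (by positivity)]
    obtain ⟨hn1, hn2⟩ := hn k'
    set N := sobolevNorm s (freePow hlam hr.le k') with hN
    have h0 : 0 ≤ N := ENNReal.toReal_nonneg
    have hh0 := norm_nonneg h
    have hq0 := norm_nonneg q'
    rw [norm_mul, coef_eq, Complex.norm_real, Real.norm_of_nonneg ha.le] at hle
    constructor
    · have h1 := mul_le_mul_of_nonneg_left hkh hC₀
      have h2 := mul_le_mul_of_nonneg_left hqh (by positivity : 0 ≤ 1 + α)
      linarith
    · have h1 : ‖k'‖ + ‖q'‖ * realCoef α lam ≤ (C₀ + realCoef α lam) * (N + (1 + α) * ‖q'‖) := by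
        have e1 : 0 ≤ realCoef α lam * N := by positivity
        have e2 : 0 ≤ C₀ * ((1 + α) * ‖q'‖) := by positivity
        have e3 : 0 ≤ realCoef α lam * (α * ‖q'‖) := by positivity
        linarith
      have h2 := mul_le_mul_of_nonneg_left h1 hC₂
      have h3 : 0 ≤ N + (1 + α) * ‖q'‖ := by positivity
      linarith

theorem singularSpace_of_three_halves_lt {lam s : ℝ} (hlam : 0 < lam) (hs : 3 / 2 < s)
    (hs2 : s < 2) :
    (∀ F : L2, MemHs s F → ∃ v : ℂ, HasValueAtZero F v) ∧
    ∃ c C : ℝ, 0 < c ∧ 0 < C ∧ ∀ α : ℝ, 0 ≤ α →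
      (∀ g : L2, g ∈ singularSpace α s ↔
        ∃ (F : L2) (v : ℂ), MemHs s F ∧ HasValueAtZero F v ∧
          g = F + (v / coef α lam) • greenL2 hlam) ∧
      ∀ (F : L2) (v : ℂ), MemHs s F → HasValueAtZero F v →
        c * sobolevNorm s F ≤ singularNorm α lam s (F + (v / coef α lam) • greenL2 hlam) ∧
        singularNorm α lam s (F + (v / coef α lam) • greenL2 hlam) ≤ C * sobolevNorm s F := by
  have hs0 : 0 < s := by linarith
  have hr : 0 < s / 2 := by positivity
  obtain ⟨C₀, hC₀, hn⟩ := exists_sobolevNorm_freePow_le hlam hs0.le hr.le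
  obtain ⟨C₁, hC₁, hreg⟩ := exists_freePow_add_smul_eq_opPow hlam (r := s / 2) (by linarith)
    (by linarith) hr.le
  obtain ⟨C₂, hC₂, hb⟩ := exists_opPow_eq_of_hasValueAtZero hlam (r := s / 2) (by linarith)
    (by linarith) hr.le
  refine ⟨fun F hF => ?_, (C₀ * C₁ + 1)⁻¹, C₂ * C₀ + 1, by positivity, by positivity,
    fun α hα => ⟨fun g => ?_, fun F v hF hv => ?_⟩⟩
  · obtain ⟨k, rfl⟩ := (memHs_iff_exists_freePow hlam hs0.le hr.le _).1 hF
    exact ⟨_, hasValueAtZero_freePow hlam hr.le (by linarith) k⟩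
  · rw [singularSpace_eq hα hlam hs0.le]
    constructor
    · rintro ⟨h, rfl⟩
      obtain ⟨k, q, hk, -⟩ := hreg α hα h
      have hv := hasValueAtZero_freePow hlam hr.le (by linarith) k
      set v : ℂ := ∫ ξ, (𝓕 (freePow hlam hr.le k) : L2) ξ
      refine ⟨_, v, (memHs_iff_exists_freePow hlam hs0.le hr.le _).2 ⟨k, rfl⟩, hv, ?_⟩
      -- the vector with the correct coefficient of `G_lam` is also in the domain
      obtain ⟨h', hh', -⟩ := hb α hα k v hv
      have h1 : opPow (ptResolvent α hlam) (s / 2) (h - h') =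
          (q - v / coef α lam) • greenL2 hlam := by
        rw [map_sub, ← hk, hh', sub_smul]
        abel
      have h2 := eq_zero_of_opPow_eq_smul_greenL2 hlam (by linarith) (by linarith) hα h1
      rw [← sub_eq_zero.1 h2]
      exact hk.symm
    · rintro ⟨F, v, hF, hv, rfl⟩
      obtain ⟨k, rfl⟩ := (memHs_iff_exists_freePow hlam hs0.le hr.le _).1 hF
      obtain ⟨h, hh, -⟩ := hb α hα k v hv
      exact ⟨h, hh⟩
  · obtain ⟨k, rfl⟩ := (memHs_iff_exists_freePow hlam hs0.le hr.le _).1 hF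
    obtain ⟨h, hh, hle⟩ := hb α hα k v hv
    obtain ⟨k', q', hk, hkh, -⟩ := hreg α hα h
    rw [hh] at hk
    obtain ⟨rfl, -⟩ := freePow_add_smul_greenL2_inj hlam hr.le (by linarith) (by linarith) hk
    rw [← hh, singularNorm_eq hα hlam hs0, inv_mul_le_iff₀ (by positivity)]
    obtain ⟨hn1, hn2⟩ := hn k'
    have h0 : 0 ≤ sobolevNorm s (freePow hlam hr.le k') := ENNReal.toReal_nonneg
    have hh0 := norm_nonneg h
    constructor
    · nlinarith [mul_le_mul_of_nonneg_left hkh hC₀]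
    · nlinarith [mul_le_mul_of_nonneg_left hn1 hC₂]

end PointInteraction
end
open PointInteraction in
theorem theorem2 (lam : ℝ) (hlam : 0 < lam) (s : ℝ) (hs0 : 0 < s) (hs2 : s < 2) :
    -- the norm is defined on all of the singular space
    (∀ α : ℝ, 0 ≤ α → (shiftedPow α lam s).domain = singularSpace α s) ∧
    -- (i)
    (s < 1 / 2 →
      ∃ c C : ℝ, 0 < c ∧ 0 < C ∧ ∀ α : ℝ, 0 ≤ α →
        (∀ g : L2, g ∈ singularSpace α s ↔ MemHs s g) ∧
        ∀ g ∈ singularSpace α s,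
          c * sobolevNorm s g ≤ singularNorm α lam s g ∧
          singularNorm α lam s g ≤ C * sobolevNorm s g) ∧
    -- (ii)
    (1 / 2 < s → s < 3 / 2 →
      ∀ α : ℝ, 0 ≤ α →
        (∀ g : L2, g ∈ singularSpace α s ↔
          ∃ (F : L2) (q : ℂ), MemHs s F ∧ g = F + q • greenL2 hlam) ∧
        ∃ c C : ℝ, 0 < c ∧ 0 < C ∧ ∀ (F : L2) (q : ℂ), MemHs s F →
          c * (sobolevNorm s F + (1 + α) * ‖q‖) ≤
            singularNorm α lam s (F + q • greenL2 hlam) ∧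
          singularNorm α lam s (F + q • greenL2 hlam) ≤
            C * (sobolevNorm s F + (1 + α) * ‖q‖)) ∧
    -- (iii)
    (3 / 2 < s →
      (∀ F : L2, MemHs s F → ∃ v : ℂ, HasValueAtZero F v) ∧
      ∃ c C : ℝ, 0 < c ∧ 0 < C ∧ ∀ α : ℝ, 0 ≤ α →
        (∀ g : L2, g ∈ singularSpace α s ↔
          ∃ (F : L2) (v : ℂ), MemHs s F ∧ HasValueAtZero F v ∧
            g = F + (v / coef α lam) • greenL2 hlam) ∧
        ∀ (F : L2) (v : ℂ), MemHs s F → HasValueAtZero F v →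
          c * sobolevNorm s F ≤
            singularNorm α lam s (F + (v / coef α lam) • greenL2 hlam) ∧
          singularNorm α lam s (F + (v / coef α lam) • greenL2 hlam) ≤
            C * sobolevNorm s F) := by
  refine ⟨fun α hα => ?_, fun hs => singularSpace_of_lt_half hlam hs0 hs,
    fun hs hs' α hα => singularSpace_of_mem_Ioo hlam hs hs' hα,
    fun hs => singularSpace_of_three_halves_lt hlam hs hs2⟩
  rw [domain_shiftedPow hα hlam hs0.le, singularSpace_eq hα hlam hs0.le]
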